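/- Let $\mathcal C$ be a small dg category over a field $\mathbf k$. Write $D(\mathcal C)$ for the derived category of right dg $\mathcal C$-modules and $\mathrm{Perf}(\mathcal C)\subset D(\mathcal C)$ for the idempotent-completed pretriangulated closure of $\mathcal C$, i.e. the smallest full subcategory that contains the representable modules $\mathrm{Hom}(-,x)$ and is closed under quasi-isomorphisms, shifts, cones, finite direct sums and direct summands. As usual, an "object of $\mathcal C$" means an object of $\mathrm{Perf}(\mathcal C)$. Write $D(\mathcal C^{op}\otimes\mathcal C)$ for the derived category of dg $\mathcal C$-$\mathcal C$-bimodules, let $\Delta$ be the diagonal bimodule given by the complexes $\mathrm{Hom}^\bullet(F_1,F_2)$, and for a bimodule $K$ and a right module $F$ let $\Phi_K(F)=K\otimes^{\mathbf L}_{\mathcal C}F\in D(\mathcal C)$ be the convolution. For a class $\mathcal G$ of objects in one of these derived categories let $\langle\mathcal G\rangle$ (resp. $\mathrm{ads}(\mathcal G)$) be the smallest full subcategory that contains $\mathcal G$ and is closed under quasi-isomorphisms, shifts, direct summands and finite (resp. arbitrary) direct sums. Let $\mathcal G_1*\mathcal G_2$ consist of the objects $\mathrm{cone}(G_1\to G_2)$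 with $G_i\in\mathcal G_i$; put $\langle\mathcal G\rangle_0=0$ and $\langle\mathcal G\rangle_n=\langle\langle\mathcal G\rangle_{n-1}*\langle\mathcal G\rangle\rangle$ for $n\ge1$. The generation time of a class of objects $\mathcal E$ by $\mathcal G$ is $$\mathrm{gentime}_{\mathcal G}(\mathcal E)=\min\bigl(\{n\in\mathbb N : \mathcal E\subset\langle\mathcal G\rangle_{n+1}\}\cup\{+\infty\}\bigr),$$ and the Rouquier dimension $\mathrm{Rdim}(\mathcal C)$ is the minimum of $\mathrm{gentime}_G(\mathrm{Perf}(\mathcal C))$ over all $G\in\mathrm{Perf}(\mathcal C)$. A bimodule $G_{12}$ is weakly product, with witness $G_2\in\mathrm{Perf}(\mathcal C)$, if $\Phi_{G_{12}}(F)\in\mathrm{ads}(G_2)$ for all $F\in\mathrm{Perf}(\mathcal C)$. **Theorem.** Let $G_{12}$ be a dg $\mathcal C$-$\mathcal C$-bimodule and suppose that $\mathrm{gentime}_{G_{12}}(\Delta)=t$ with $t\in\mathbb N$. If $G_{12}$ is weakly product with witness $G_2$, then $\mathrm{gentime}_{G_2}(\mathrm{Perf}(\mathcal C))\le t$; in particular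 $\mathrm{Rdim}(\mathcal C)\le t$. More generally, for every full subcategory $\mathcal E\subset\mathrm{Perf}(\mathcal C)$ (for example the representable modules alone) and every $G_2\in\mathrm{Perf}(\mathcal C)$ such that $\Phi_{G_{12}}(F)\in\mathrm{ads}(G_2)$ for all $F\in\mathcal E$, one has $\mathrm{gentime}_{G_2}(\mathcal E)\le t$. -/

import Mathlib

universe u

/-- The Koszul sign `(-1)^n`, as an element of the ground field. -/
def koszulSign (k : Type u) [Field k] (n : ℤ) : k := ((n.negOnePow : ℤˣ) : ℤ)

section koszulSign

variable (k : Type u) [Field k]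

theorem koszulSign_zero : koszulSign k 0 = 1 := by simp [koszulSign]

theorem koszulSign_add (m n : ℤ) :
    koszulSign k (m + n) = koszulSign k m * koszulSign k n := by
  simp [koszulSign, Int.negOnePow_add]

theorem koszulSign_succ (n : ℤ) : koszulSign k (n + 1) = -koszulSign k n := by
  simp [koszulSign, Int.negOnePow_succ]

theorem koszulSign_mul_self (n : ℤ) : koszulSign k n * koszulSign k n = 1 := by
  rcases Int.even_or_odd n with h | h
  · simp [koszulSign, Int.negOnePow_even _ h]
  · simp [koszulSign, Int.negOnePow_odd _ h]

end koszulSign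

/-- A (small) dg category over a field `k`, with cohomological grading. Degrees of composites and
of differentials are carried by explicit equations between integers.
`comp p q n h g f` is the composite `g ∘ f` of `f : x ⟶ y` of degree `q` and `g : y ⟶ z` of
degree `p`; it has degree `n = p + q`. -/
structure DGCategory (k : Type u) [Field k] where
  Obj : Type u
  Hom : Obj → Obj → ℤ → Type u
  [addCommGroupHom : ∀ x y n, AddCommGroup (Hom x y n)]
  [moduleHom : ∀ x y n, Module k (Hom x y n)]
  d : ∀ {x y : Obj} (p q : ℤ), p + 1 = q → (Hom x y p →ₗ[k] Hom x y q)
  comp : ∀ {x y z : Obj} (p q n : ℤ), p + q = n →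
    (Hom y z p →ₗ[k] Hom x y q →ₗ[k] Hom x z n)
  one : ∀ x : Obj, Hom x x 0
  d_d : ∀ {x y : Obj} (p q r : ℤ) (h : p + 1 = q) (h' : q + 1 = r) (f : Hom x y p),
    d q r h' (d p q h f) = 0
  d_comp : ∀ {x y z : Obj} (p q n p' q' n' : ℤ) (h : p + q = n) (hp : p + 1 = p')
    (hq : q + 1 = q') (hn : n + 1 = n') (g : Hom y z p) (f : Hom x y q),
    d n n' hn (comp p q n h g f) =
      comp p' q n' (by omega) (d p p' hp g) f +
        koszulSign k p • comp p q' n' (by omega) g (d q q' hq f)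
  comp_assoc : ∀ {w x y z : Obj} (p q r s t n : ℤ) (hs : p + q = s) (ht : q + r = t)
    (hn : p + t = n) (f₁ : Hom y z p) (f₂ : Hom x y q) (f₃ : Hom w x r),
    comp s r n (by omega) (comp p q s hs f₁ f₂) f₃ =
      comp p t n hn f₁ (comp q r t ht f₂ f₃)
  one_comp : ∀ {x y : Obj} (p : ℤ) (f : Hom x y p), comp 0 p p (zero_add p) (one y) f = f
  comp_one : ∀ {x y : Obj} (p : ℤ) (f : Hom x y p), comp p 0 p (add_zero p) f (one x) = f

attribute [instance] DGCategory.addCommGroupHom DGCategory.moduleHom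

/-- A dg `B`-`C`-bimodule, that is, a dg module over `Bᵒᵖ ⊗ C`: complexes `M(b, c)`, covariant in
`b` (left action of `B`) and contravariant in `c` (right action of `C`), with commuting actions
that satisfy the graded Leibniz rule. -/
structure DGBimodule {k : Type u} [Field k] (B C : DGCategory k) where
  obj : B.Obj → C.Obj → ℤ → Type u
  [addCommGroupObj : ∀ b c n, AddCommGroup (obj b c n)]
  [moduleObj : ∀ b c n, Module k (obj b c n)]
  d : ∀ {b : B.Obj} {c : C.Obj} (p q : ℤ), p + 1 = q → (obj b c p →ₗ[k] obj b c q)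
  lact : ∀ {b b' : B.Obj} {c : C.Obj} (p q n : ℤ), p + q = n →
    (B.Hom b b' p →ₗ[k] obj b c q →ₗ[k] obj b' c n)
  ract : ∀ {b : B.Obj} {c c' : C.Obj} (p q n : ℤ), p + q = n →
    (obj b c p →ₗ[k] C.Hom c' c q →ₗ[k] obj b c' n)
  d_d : ∀ {b : B.Obj} {c : C.Obj} (p q r : ℤ) (h : p + 1 = q) (h' : q + 1 = r)
    (m : obj b c p), d q r h' (d p q h m) = 0
  d_lact : ∀ {b b' : B.Obj} {c : C.Obj} (p q n p' q' n' : ℤ) (h : p + q = n)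
    (hp : p + 1 = p') (hq : q + 1 = q') (hn : n + 1 = n') (g : B.Hom b b' p) (m : obj b c q),
    d n n' hn (lact p q n h g m) =
      lact p' q n' (by omega) (B.d p p' hp g) m +
        koszulSign k p • lact p q' n' (by omega) g (d q q' hq m)
  d_ract : ∀ {b : B.Obj} {c c' : C.Obj} (p q n p' q' n' : ℤ) (h : p + q = n)
    (hp : p + 1 = p') (hq : q + 1 = q') (hn : n + 1 = n') (m : obj b c p) (f : C.Hom c' c q),
    d n n' hn (ract p q n h m f) =
      ract p' q n' (by omega) (d p p' hp m) f +
        koszulSign k p • ract p q' n' (by omega) m (C.d q q' hq f)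
  lact_lact : ∀ {b b' b'' : B.Obj} {c : C.Obj} (p q r s t n : ℤ) (hs : p + q = s)
    (ht : q + r = t) (hn : p + t = n) (g : B.Hom b' b'' p) (g' : B.Hom b b' q) (m : obj b c r),
    lact s r n (by omega) (B.comp p q s hs g g') m = lact p t n hn g (lact q r t ht g' m)
  ract_ract : ∀ {b : B.Obj} {c c' c'' : C.Obj} (p q r s t n : ℤ) (hs : p + q = s)
    (ht : q + r = t) (hn : p + t = n) (m : obj b c p) (f : C.Hom c' c q) (f' : C.Hom c'' c' r),
    ract s r n (by omega) (ract p q s hs m f) f' = ract p t n hn m (C.comp q r t ht f f')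
  lact_ract : ∀ {b b' : B.Obj} {c c' : C.Obj} (p q r s t n : ℤ) (hs : p + q = s)
    (ht : q + r = t) (hn : p + t = n) (g : B.Hom b b' p) (m : obj b c q) (f : C.Hom c' c r),
    ract s r n (by omega) (lact p q s hs g m) f = lact p t n hn g (ract q r t ht m f)
  one_lact : ∀ {b : B.Obj} {c : C.Obj} (p : ℤ) (m : obj b c p),
    lact 0 p p (zero_add p) (B.one b) m = m
  ract_one : ∀ {b : B.Obj} {c : C.Obj} (p : ℤ) (m : obj b c p),
    ract p 0 p (add_zero p) m (C.one c) = m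

attribute [instance] DGBimodule.addCommGroupObj DGBimodule.moduleObj

section UnitCategory

variable (k : Type u) [Field k]

/-- The degree `n` part of `k`, regarded as a graded vector space concentrated in degree `0`. -/
def unitDeg (n : ℤ) : Submodule k k where
  carrier := {a | n ≠ 0 → a = 0}
  add_mem' := by
    intro a b ha hb hn
    rw [ha hn, hb hn, add_zero]
  zero_mem' := fun _ => rfl
  smul_mem' := by
    intro c a ha hn
    rw [ha hn, smul_zero]

/-- The dg category with one object whose endomorphism algebra is `k`. -/
@[reducible] def DGCategory.unit : DGCategory k where
  Obj := PUnit
  Hom := fun _ _ n => unitDeg k n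
  d := fun _ _ _ => 0
  comp := fun p q n h => LinearMap.mk₂ k
    (fun a b => ⟨(a : k) * (b : k), by
      intro hn
      by_cases hp : p = 0
      · rw [b.2 (by omega), mul_zero]
      · rw [a.2 hp, zero_mul]⟩)
    (fun a a' b => Subtype.ext (add_mul (a : k) a' b))
    (fun c a b => Subtype.ext (mul_assoc c (a : k) b))
    (fun a b b' => Subtype.ext (mul_add (a : k) b b'))
    (fun c a b => Subtype.ext (mul_left_comm (a : k) c b))
  one := fun _ => ⟨1, fun h => absurd rfl h⟩
  d_d := by intros; rfl
  d_comp := by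
    intros
    simp only [LinearMap.zero_apply, map_zero, smul_zero, add_zero]
  comp_assoc := by
    intros
    exact Subtype.ext (mul_assoc _ _ _)
  one_comp := by
    intros
    exact Subtype.ext (one_mul _)
  comp_one := by
    intros
    exact Subtype.ext (mul_one _)

end UnitCategory

/-- Right dg `C`-modules, that is, dg functors from `Cᵒᵖ` to complexes over `k`: they are the
`k`-`C`-bimodules. -/
abbrev DGModule {k : Type u} [Field k] (C : DGCategory k) := DGBimodule (DGCategory.unit k) C

section ScalarAct

variable {k : Type u} [Field k] (V : ℤ → Type u) [∀ n, AddCommGroup (V n)] [∀ n, Module k (V n)]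

/-- The action of the graded vector space `k` (in degree `0`) on a graded vector space by
scalars. -/
def scalarAct (p q n : ℤ) (h : p + q = n) : unitDeg k p →ₗ[k] V q →ₗ[k] V n :=
  if hp : p = 0 then by
    have e : q = n := by omega
    subst e
    exact (LinearMap.lsmul k (V q)).comp (unitDeg k p).subtype
  else 0

theorem scalarAct_zero (q : ℤ) (h : 0 + q = q) (a : unitDeg k 0) (v : V q) :
    scalarAct V 0 q q h a v = (a : k) • v := by
  simp [scalarAct]

theorem unitDeg_eq_zero {p : ℤ} (hp : p ≠ 0) (a : unitDeg k p) : a = 0 :=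
  Subtype.ext (a.2 hp)

theorem scalarAct_comm {W : ℤ → Type u} [∀ n, AddCommGroup (W n)] [∀ n, Module k (W n)] (r : ℤ)
    (R : ∀ q s : ℤ, q + r = s → (V q →ₗ[k] W s)) (p q s t n : ℤ) (hs : p + q = s)
    (ht : q + r = t) (hn : p + t = n) (a : unitDeg k p) (v : V q) :
    R s n (by omega) (scalarAct V p q s hs a v) = scalarAct W p t n hn a (R q t ht v) := by
  by_cases h0 : p = 0
  · subst h0
    obtain rfl : q = s := by omega
    obtain rfl : t = n := by omega
    rw [scalarAct_zero, scalarAct_zero, map_smul]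
  · rw [unitDeg_eq_zero h0 a]
    simp

theorem koszulSign_smul_scalarAct (p q n : ℤ) (h : p + q = n) (a : unitDeg k p) (v : V q) :
    koszulSign k p • scalarAct V p q n h a v = scalarAct V p q n h a v := by
  by_cases h0 : p = 0
  · subst h0
    rw [koszulSign_zero, one_smul]
  · rw [unitDeg_eq_zero h0 a]
    simp

theorem scalarAct_scalarAct (p q r s t n : ℤ) (hs : p + q = s) (ht : q + r = t) (hn : p + t = n)
    (a : unitDeg k p) (a' : unitDeg k q) (a'' : unitDeg k s) (v : V r)
    (e : (a'' : k) = (a : k) * (a' : k)) :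
    scalarAct V s r n (by omega) a'' v = scalarAct V p t n hn a (scalarAct V q r t ht a' v) := by
  by_cases h0 : p = 0
  · subst h0
    obtain rfl : q = s := by omega
    obtain rfl : t = n := by omega
    by_cases h1 : q = 0
    · subst h1
      obtain rfl : r = t := by omega
      rw [scalarAct_zero, scalarAct_zero, scalarAct_zero, e, mul_smul]
    · rw [unitDeg_eq_zero h1 a', unitDeg_eq_zero h1 a'']
      simp
  · have e' : a'' = 0 := by
      apply Subtype.ext
      rw [e, unitDeg_eq_zero h0 a]
      simp
    rw [e', unitDeg_eq_zero h0 a]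
    simp

end ScalarAct

namespace DGCategory

variable {k : Type u} [Field k] (C : DGCategory k)

/-- The diagonal bimodule `Δ(b, c) = Hom(c, b)`. -/
@[reducible] def diagonal : DGBimodule C C where
  obj := fun b c n => C.Hom c b n
  d := fun p q h => C.d p q h
  lact := fun p q n h => C.comp p q n h
  ract := fun p q n h => C.comp p q n h
  d_d := C.d_d
  d_lact := C.d_comp
  d_ract := C.d_comp
  lact_lact := C.comp_assoc
  ract_ract := C.comp_assoc
  lact_ract := C.comp_assoc
  one_lact := C.one_comp
  ract_one := C.comp_one

/-- The representable right module `Hom(-, x)`. -/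
@[reducible] def representable (x : C.Obj) : DGModule C where
  obj := fun _ c n => C.Hom c x n
  d := fun p q h => C.d p q h
  lact := fun {_ _ c} p q n h => scalarAct (fun n => C.Hom c x n) p q n h
  ract := fun p q n h => C.comp p q n h
  d_d := C.d_d
  d_lact := by
    intro _ _ c p q n p' q' n' h hp hq hn g m
    have e1 := scalarAct_comm (fun n => C.Hom c x n) (W := fun n => C.Hom c x n) 1
      (fun q s h => C.d q s h) p q n q' n' h hq (by omega) g m
    have e2 := koszulSign_smul_scalarAct (fun n => C.Hom c x n) p q' n' (by omega) g
      (C.d q q' hq m)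
    have e3 : scalarAct (k := k) (fun n => C.Hom c x n) p' q n' (by omega) 0 m = 0 := by simp
    refine e1.trans (e2.symm.trans ?_)
    refine (zero_add _).symm.trans ?_
    exact congrArg (· + _) e3.symm
  d_ract := C.d_comp
  lact_lact := by
    intro _ _ _ c p q r s t n hs ht hn g g' m
    exact scalarAct_scalarAct (fun n => C.Hom c x n) p q r s t n hs ht hn g g' _ m rfl
  ract_ract := C.comp_assoc
  lact_ract := by
    intro _ _ c c' p q r s t n hs ht hn g m f
    exact scalarAct_comm (fun n => C.Hom c x n) (W := fun n => C.Hom c' x n) r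
      (fun q s h => (C.comp q r s h).flip f) p q s t n hs ht hn g m
  one_lact := by
    intro _ c p m
    have e := scalarAct_zero (k := k) (fun n => C.Hom c x n) p (zero_add p)
      ⟨1, fun h => absurd rfl h⟩ m
    exact e.trans (one_smul k _)
  ract_one := C.comp_one

end DGCategory

namespace DGBimodule

variable {k : Type u} [Field k] {A B C : DGCategory k}

/-- Morphisms of dg bimodules: closed maps of degree `0` that commute with both actions. -/
structure Hom (M N : DGBimodule B C) where
  app : ∀ (b : B.Obj) (c : C.Obj) (n : ℤ), M.obj b c n →ₗ[k] N.obj b c n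
  app_d : ∀ {b : B.Obj} {c : C.Obj} (p q : ℤ) (h : p + 1 = q) (m : M.obj b c p),
    app b c q (M.d p q h m) = N.d p q h (app b c p m)
  app_lact : ∀ {b b' : B.Obj} {c : C.Obj} (p q n : ℤ) (h : p + q = n) (g : B.Hom b b' p)
    (m : M.obj b c q), app b' c n (M.lact p q n h g m) = N.lact p q n h g (app b c q m)
  app_ract : ∀ {b : B.Obj} {c c' : C.Obj} (p q n : ℤ) (h : p + q = n) (m : M.obj b c p)
    (f : C.Hom c' c q), app b c' n (M.ract p q n h m f) = N.ract p q n h (app b c p m) f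

/-- A morphism is a quasi-isomorphism if it is injective (first clause) and surjective (second
clause) on the cohomology of `M(b, c)`, in every degree and for all objects `b` and `c`. -/
def IsQuasiIso {M N : DGBimodule B C} (f : Hom M N) : Prop :=
  ∀ (b : B.Obj) (c : C.Obj) (p q r : ℤ) (h : p + 1 = q) (h' : q + 1 = r),
    (∀ m : M.obj b c q, M.d q r h' m = 0 → (∃ y, N.d p q h y = f.app b c q m) →
      ∃ x, M.d p q h x = m) ∧
    (∀ y : N.obj b c q, N.d q r h' y = 0 →
      ∃ m, M.d q r h' m = 0 ∧ ∃ z, f.app b c q m + N.d p q h z = y)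

/-- A bimodule is acyclic if all its cohomology vanishes. -/
def IsAcyclic (M : DGBimodule B C) : Prop :=
  ∀ (b : B.Obj) (c : C.Obj) (p q r : ℤ) (h : p + 1 = q) (h' : q + 1 = r) (m : M.obj b c q),
    M.d q r h' m = 0 → ∃ x, M.d p q h x = m

/-- The shift `M[i]`, with `M[i]ⁿ = Mⁿ⁺ⁱ`, differential `(-1)ⁱ d`, the same right action, and the
left action twisted by the sign `(-1)^(i·p)` for scalars of degree `p`. -/
@[reducible] def shift (i : ℤ) (M : DGBimodule B C) : DGBimodule B C where
  obj := fun b c n => M.obj b c (n + i)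
  d := fun p q h => koszulSign k i • M.d (p + i) (q + i) (by omega)
  lact := fun p q n h => koszulSign k (i * p) • M.lact p (q + i) (n + i) (by omega)
  ract := fun p q n h => M.ract (p + i) q (n + i) (by omega)
  d_d := by
    intros
    simp [M.d_d]
  d_lact := by
    intro b b' c p q n p' q' n' h hp hq hn g m
    subst hp
    have e : koszulSign k (i * (p + 1)) = koszulSign k (i * p) * koszulSign k i := by
      rw [← koszulSign_add]; congr 1; ring
    simp only [LinearMap.smul_apply, map_smul, e,
      M.d_lact p (q + i) (n + i) (p + 1) (q' + i) (n' + i) (by omega) rfl (by omega) (by omega) g m]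
    module
  d_ract := by
    intro b c c' p q n p' q' n' h hp hq hn m f
    have e : koszulSign k i * koszulSign k (p + i) = koszulSign k p := by
      rw [koszulSign_add, mul_comm, mul_assoc, koszulSign_mul_self, mul_one]
    simp only [LinearMap.smul_apply, map_smul, smul_add, smul_smul, e,
      M.d_ract (p + i) q (n + i) (p' + i) q' (n' + i) (by omega) (by omega) hq (by omega) m f]
  lact_lact := by
    intro b b' b'' c p q r s t n hs ht hn g g' m
    subst hs
    have e : koszulSign k (i * (p + q)) = koszulSign k (i * p) * koszulSign k (i * q) := by
      rw [← koszulSign_add]; congr 1; ring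
    simp only [LinearMap.smul_apply, map_smul, smul_smul, e, mul_comm,
      M.lact_lact p q (r + i) (p + q) (t + i) (n + i) rfl (by omega) (by omega) g g' m]
  ract_ract := by
    intro b c c' c'' p q r s t n hs ht hn m f f'
    exact M.ract_ract (p + i) q r (s + i) t (n + i) (by omega) ht (by omega) m f f'
  lact_ract := by
    intro b b' c c' p q r s t n hs ht hn g m f
    simp only [LinearMap.smul_apply, map_smul,
      M.lact_ract p (q + i) r (s + i) (t + i) (n + i) (by omega) (by omega) (by omega) g m f]
  one_lact := by
    intro b c p m
    simp only [mul_zero, koszulSign_zero, one_smul]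
    exact M.one_lact (p + i) m
  ract_one := by
    intro b c p m
    exact M.ract_one (p + i) m

/-- The direct sum of a family of dg bimodules. -/
@[reducible] def dsum {ι : Type u} (M : ι → DGBimodule B C) : DGBimodule B C where
  obj := fun b c n => Π₀ i, (M i).obj b c n
  d := fun p q h => DFinsupp.mapRange.linearMap (fun i => (M i).d p q h)
  lact := fun p q n h => LinearMap.mk₂ k
    (fun g x => DFinsupp.mapRange.linearMap (fun i => (M i).lact p q n h g) x)
    (by intros; ext i; simp) (by intros; ext i; simp)
    (by intros; ext i; simp) (by intros; ext i; simp)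
  ract := fun p q n h => LinearMap.mk₂ k
    (fun x f => DFinsupp.mapRange.linearMap (fun i => ((M i).ract p q n h).flip f) x)
    (by intros; ext i; simp) (by intros; ext i; simp)
    (by intros; ext i; simp) (by intros; ext i; simp)
  d_d := by
    intros; ext i; simp [(M i).d_d]
  d_lact := by
    intro b b' c p q n p' q' n' h hp hq hn g m
    ext i
    simpa using (M i).d_lact p q n p' q' n' h hp hq hn g (m i)
  d_ract := by
    intro b c c' p q n p' q' n' h hp hq hn m f
    ext i
    simpa using (M i).d_ract p q n p' q' n' h hp hq hn (m i) f
  lact_lact := by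
    intro b b' b'' c p q r s t n hs ht hn g g' m
    ext i
    simpa using (M i).lact_lact p q r s t n hs ht hn g g' (m i)
  ract_ract := by
    intro b c c' c'' p q r s t n hs ht hn m f f'
    ext i
    simpa using (M i).ract_ract p q r s t n hs ht hn (m i) f f'
  lact_ract := by
    intro b b' c c' p q r s t n hs ht hn g m f
    ext i
    simpa using (M i).lact_ract p q r s t n hs ht hn g (m i) f
  one_lact := by
    intro b c p m
    ext i
    simpa using (M i).one_lact p (m i)
  ract_one := by
    intro b c p m
    ext i
    simpa using (M i).ract_one p (m i)

/-- The differential `(m, x) ↦ (-d m, f m + d x)` of the mapping cone. -/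
def coneD {M N : DGBimodule B C} (f : Hom M N) (b : B.Obj) (c : C.Obj) (p q : ℤ)
    (h : p + 1 = q) :
    (M.obj b c (p + 1) × N.obj b c p) →ₗ[k] (M.obj b c (q + 1) × N.obj b c q) := by
  subst h
  exact LinearMap.prod
    (-(M.d (p + 1) (p + 1 + 1) rfl ∘ₗ LinearMap.fst k _ _))
    (f.app b c (p + 1) ∘ₗ LinearMap.fst k _ _ + N.d p (p + 1) rfl ∘ₗ LinearMap.snd k _ _)

theorem coneD_apply {M N : DGBimodule B C} (f : Hom M N) (b : B.Obj) (c : C.Obj) (p : ℤ)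
    (x : M.obj b c (p + 1) × N.obj b c p) :
    coneD f b c p (p + 1) rfl x =
      (-M.d (p + 1) (p + 1 + 1) rfl x.1, f.app b c (p + 1) x.1 + N.d p (p + 1) rfl x.2) := rfl

/-- The mapping cone of a morphism `f : M ⟶ N`: it is `M[1] ⊕ N` with its two actions, and with
the differential twisted by `f`. -/
@[reducible] def cone {M N : DGBimodule B C} (f : Hom M N) : DGBimodule B C where
  obj := fun b c n => M.obj b c (n + 1) × N.obj b c n
  d := fun {b c} p q h => coneD f b c p q h
  lact := fun p q n h => LinearMap.mk₂ k
    (fun g x => (koszulSign k p • M.lact p (q + 1) (n + 1) (by omega) g x.1, N.lact p q n h g x.2))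
    (by intros; ext <;> simp)
    (by intro a g x; exact Prod.ext (by simp [smul_comm (koszulSign k p) a]) (by simp))
    (by intros; ext <;> simp)
    (by intro a g x; exact Prod.ext (by simp [smul_comm (koszulSign k p) a]) (by simp))
  ract := fun p q n h => LinearMap.mk₂ k
    (fun x g => (M.ract (p + 1) q (n + 1) (by omega) x.1 g, N.ract p q n h x.2 g))
    (by intros; ext <;> simp) (by intros; ext <;> simp)
    (by intros; ext <;> simp) (by intros; ext <;> simp)
  d_d := by
    intro b c p q r h h' m
    subst h
    subst h'
    rw [coneD_apply, coneD_apply]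
    ext
    · simp [M.d_d]
    · simp [N.d_d, f.app_d]
  d_lact := by
    intro b b' c p q n p' q' n' h hp hq hn g m
    subst hp
    subst hq
    subst hn
    simp only [LinearMap.mk₂_apply, coneD_apply]
    ext
    · simp only [map_smul, map_neg, Prod.fst_add, Prod.smul_fst, koszulSign_succ,
        M.d_lact p (q + 1) (n + 1) (p + 1) (q + 1 + 1) (n + 1 + 1) (by omega) rfl rfl rfl g m.1]
      module
    · simp only [map_smul, map_add, Prod.snd_add, Prod.smul_snd, f.app_lact,
        N.d_lact p q n (p + 1) (q + 1) (n + 1) h rfl rfl rfl g m.2]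
      module
  d_ract := by
    intro b c c' p q n p' q' n' h hp hq hn m g
    subst hp
    subst hq
    subst hn
    simp only [LinearMap.mk₂_apply, coneD_apply]
    ext
    · simp only [map_neg, LinearMap.neg_apply, Prod.fst_add, Prod.smul_fst, koszulSign_succ,
        M.d_ract (p + 1) q (n + 1) (p + 1 + 1) (q + 1) (n + 1 + 1) (by omega) rfl rfl rfl m.1 g]
      module
    · simp only [map_add, LinearMap.add_apply, Prod.snd_add, Prod.smul_snd, f.app_ract,
        N.d_ract p q n (p + 1) (q + 1) (n + 1) h rfl rfl rfl m.2 g]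
      module
  lact_lact := by
    intro b b' b'' c p q r s t n hs ht hn g g' m
    subst hs
    simp only [LinearMap.mk₂_apply, map_smul, koszulSign_add, smul_smul,
      M.lact_lact p q (r + 1) (p + q) (t + 1) (n + 1) rfl (by omega) (by omega) g g' m.1,
      N.lact_lact p q r (p + q) t n rfl ht hn g g' m.2]
  ract_ract := by
    intro b c c' c'' p q r s t n hs ht hn m f f'
    simp only [LinearMap.mk₂_apply,
      M.ract_ract (p + 1) q r (s + 1) t (n + 1) (by omega) ht (by omega) m.1 f f',
      N.ract_ract p q r s t n hs ht hn m.2 f f']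
  lact_ract := by
    intro b b' c c' p q r s t n hs ht hn g m f
    simp only [LinearMap.mk₂_apply, map_smul, LinearMap.smul_apply,
      M.lact_ract p (q + 1) r (s + 1) (t + 1) (n + 1) (by omega) (by omega) (by omega) g m.1 f,
      N.lact_ract p q r s t n hs ht hn g m.2 f]
  one_lact := by
    intro b c p m
    simp only [LinearMap.mk₂_apply, koszulSign_zero, one_smul, N.one_lact]
    exact Prod.ext (M.one_lact (p + 1) m.1) rfl
  ract_one := by
    intro b c p m
    simp only [LinearMap.mk₂_apply, N.ract_one]
    exact Prod.ext (M.ract_one (p + 1) m.1) rfl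

section Tensor

open scoped TensorProduct

variable (X : DGBimodule A B) (K : DGBimodule B C)

/-- Index set of the summands `X(a, b)ᵖ ⊗ K(b, c)^q` with `p + q = n`. -/
abbrev TensorIdx (B : DGCategory k) (n : ℤ) : Type u :=
  {t : B.Obj × ℤ × ℤ // t.2.1 + t.2.2 = n}

noncomputable instance (B : DGCategory k) (n : ℤ) : DecidableEq (TensorIdx B n) :=
  Classical.decEq _

/-- The degree `n` part of the direct sum of the complexes `X(a, b) ⊗ K(b, c)` over all `b`. -/
abbrev TensorPre (a : A.Obj) (c : C.Obj) (n : ℤ) : Type u :=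
  DirectSum (TensorIdx B n) fun t => X.obj a t.1.1 t.1.2.1 ⊗[k] K.obj t.1.1 c t.1.2.2

noncomputable def preMul {a : A.Obj} {b : B.Obj} {c : C.Obj} (p q n : ℤ) (h : p + q = n) :
    X.obj a b p →ₗ[k] K.obj b c q →ₗ[k] TensorPre X K a c n :=
  (TensorProduct.mk k (X.obj a b p) (K.obj b c q)).compr₂
    (DirectSum.lof k (TensorIdx B n)
      (fun t => X.obj a t.1.1 t.1.2.1 ⊗[k] K.obj t.1.1 c t.1.2.2) ⟨(b, p, q), h⟩)

/-- The relations `x g ⊗ y = x ⊗ g y` for morphisms `g` of `B`. -/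
def tensorRel (a : A.Obj) (c : C.Obj) (n : ℤ) : Submodule k (TensorPre X K a c n) :=
  Submodule.span k {z | ∃ (b b' : B.Obj) (p r q s t : ℤ) (hs : p + r = s) (ht : r + q = t)
    (hn : p + t = n) (x : X.obj a b' p) (g : B.Hom b b' r) (y : K.obj b c q),
    z = preMul X K s q n (by omega) (X.ract p r s hs x g) y -
      preMul X K p t n hn x (K.lact r q t ht g y)}

/-- The degree `n` part of `(X ⊗_B K)(a, c)`. -/
abbrev TensorObj (a : A.Obj) (c : C.Obj) (n : ℤ) : Type u :=
  TensorPre X K a c n ⧸ tensorRel X K a c n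

/-- The class of `x ⊗ y` in `X ⊗_B K`. -/
noncomputable def tmul {a : A.Obj} {b : B.Obj} {c : C.Obj} (p q n : ℤ) (h : p + q = n) :
    X.obj a b p →ₗ[k] K.obj b c q →ₗ[k] TensorObj X K a c n :=
  (preMul X K p q n h).compr₂ (tensorRel X K a c n).mkQ

theorem tmul_balanced {a : A.Obj} {b b' : B.Obj} {c : C.Obj} (p r q s t n : ℤ) (hs : p + r = s)
    (ht : r + q = t) (hn : p + t = n) (x : X.obj a b' p) (g : B.Hom b b' r) (y : K.obj b c q) :
    tmul X K s q n (by omega) (X.ract p r s hs x g) y =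
      tmul X K p t n hn x (K.lact r q t ht g y) := by
  refine (Submodule.Quotient.eq _).2 (Submodule.subset_span ?_)
  exact ⟨b, b', p, r, q, s, t, hs, ht, hn, x, g, y, rfl⟩

variable {X K}

theorem tensor_hom_ext {a : A.Obj} {c : C.Obj} {n : ℤ} {V : Type u} [AddCommGroup V] [Module k V]
    {f g : TensorObj X K a c n →ₗ[k] V}
    (h : ∀ (b : B.Obj) (p q : ℤ) (e : p + q = n) (x : X.obj a b p) (y : K.obj b c q),
      f (tmul X K p q n e x y) = g (tmul X K p q n e x y)) : f = g := by
  apply Submodule.linearMap_qext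
  apply DirectSum.linearMap_ext
  rintro ⟨⟨b, p, q⟩, e⟩
  apply TensorProduct.ext'
  intro x y
  exact h b p q e x y

/-- A balanced family of bilinear maps induces a linear map on `X ⊗_B K`. -/
noncomputable def tensorLift {a : A.Obj} {c : C.Obj} {n : ℤ} {V : Type u} [AddCommGroup V]
    [Module k V]
    (φ : ∀ (b : B.Obj) (p q : ℤ), p + q = n → (X.obj a b p →ₗ[k] K.obj b c q →ₗ[k] V))
    (hφ : ∀ (b b' : B.Obj) (p r q s t : ℤ) (hs : p + r = s) (ht : r + q = t) (hn : p + t = n)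
      (x : X.obj a b' p) (g : B.Hom b b' r) (y : K.obj b c q),
      φ b s q (by omega) (X.ract p r s hs x g) y = φ b' p t hn x (K.lact r q t ht g y)) :
    TensorObj X K a c n →ₗ[k] V :=
  (tensorRel X K a c n).liftQ
    (DirectSum.toModule k (TensorIdx B n) V fun t =>
      TensorProduct.lift (φ t.1.1 t.1.2.1 t.1.2.2 t.2)) (by
    refine Submodule.span_le.2 ?_
    rintro z ⟨b, b', p, r, q, s, t, hs, ht, hn, x, g, y, rfl⟩
    simp only [SetLike.mem_coe, LinearMap.mem_ker, map_sub, preMul, LinearMap.compr₂_apply,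
      DirectSum.toModule_lof, TensorProduct.mk_apply, TensorProduct.lift.tmul]
    rw [hφ b b' p r q s t hs ht hn x g y, sub_self])

theorem tensorLift_tmul {a : A.Obj} {c : C.Obj} {n : ℤ} {V : Type u} [AddCommGroup V]
    [Module k V]
    (φ : ∀ (b : B.Obj) (p q : ℤ), p + q = n → (X.obj a b p →ₗ[k] K.obj b c q →ₗ[k] V))
    (hφ : ∀ (b b' : B.Obj) (p r q s t : ℤ) (hs : p + r = s) (ht : r + q = t) (hn : p + t = n)
      (x : X.obj a b' p) (g : B.Hom b b' r) (y : K.obj b c q),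
      φ b s q (by omega) (X.ract p r s hs x g) y = φ b' p t hn x (K.lact r q t ht g y))
    {b : B.Obj} (p q : ℤ) (h : p + q = n) (x : X.obj a b p) (y : K.obj b c q) :
    tensorLift φ hφ (tmul X K p q n h x y) = φ b p q h x y := by
  refine (Submodule.liftQ_apply _ _ _).trans ?_
  simp only [preMul, LinearMap.compr₂_apply]
  rw [DirectSum.toModule_lof, TensorProduct.mk_apply, TensorProduct.lift.tmul]

variable (X K)

/-- The differential `d (x ⊗ y) = d x ⊗ y + (-1)^|x| x ⊗ d y`. -/
noncomputable def tensorD (a : A.Obj) (c : C.Obj) (n n' : ℤ) (h : n + 1 = n') :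
    TensorObj X K a c n →ₗ[k] TensorObj X K a c n' :=
  tensorLift
    (fun _ p q e =>
      (tmul X K (p + 1) q n' (by omega)).comp (X.d p (p + 1) rfl) +
      koszulSign k p • (tmul X K p (q + 1) n' (by omega)).compl₂ (K.d q (q + 1) rfl))
    (by
      intro b b' p r q s t hs ht hn x g y
      have e1 := tmul_balanced X K (p + 1) r q (s + 1) t n' (by omega) ht (by omega)
        (X.d p (p + 1) rfl x) g y
      have e2 := tmul_balanced X K p (r + 1) q (s + 1) (t + 1) n' (by omega) (by omega) (by omega)
        x (B.d r (r + 1) rfl g) y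
      have e3 := tmul_balanced X K p r (q + 1) s (t + 1) n' hs (by omega) (by omega)
        x g (K.d q (q + 1) rfl y)
      have e4 : koszulSign k s = koszulSign k p * koszulSign k r := by
        rw [← hs, koszulSign_add]
      simp only [LinearMap.add_apply, LinearMap.comp_apply, LinearMap.smul_apply,
        LinearMap.compl₂_apply,
        X.d_ract p r s (p + 1) (r + 1) (s + 1) hs rfl rfl rfl x g,
        K.d_lact r q t (r + 1) (q + 1) (t + 1) ht rfl rfl rfl g y,
        map_add, map_smul, e1, e2, e3, e4]
      module)

theorem tensorD_tmul {a : A.Obj} {b : B.Obj} {c : C.Obj} (p q n p' q' n' : ℤ) (h : p + q = n)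
    (hp : p + 1 = p') (hq : q + 1 = q') (hn : n + 1 = n') (x : X.obj a b p) (y : K.obj b c q) :
    tensorD X K a c n n' hn (tmul X K p q n h x y) =
      tmul X K p' q n' (by omega) (X.d p p' hp x) y +
        koszulSign k p • tmul X K p q' n' (by omega) x (K.d q q' hq y) := by
  subst hp
  subst hq
  rw [tensorD, tensorLift_tmul]
  rfl

/-- The left action `g (x ⊗ y) = g x ⊗ y`. -/
noncomputable def tensorLact {a a' : A.Obj} {c : C.Obj} (r m n : ℤ) (h : r + m = n) :
    A.Hom a a' r →ₗ[k] TensorObj X K a c m →ₗ[k] TensorObj X K a' c n :=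
  (tensorLift
    (V := A.Hom a a' r →ₗ[k] TensorObj X K a' c n)
    (fun _ p q e => LinearMap.mk₂ k
      (fun x y => ((tmul X K (r + p) q n (by omega)).flip y).comp
        ((X.lact r p (r + p) rfl).flip x))
      (by intros; ext; simp) (by intros; ext; simp) (by intros; ext; simp)
      (by intros; ext; simp))
    (by
      intro b b' p l q s t hs ht hn x g y
      ext f
      have e1 := X.lact_ract r p l (r + p) s (r + s) rfl hs rfl f x g
      have e2 := tmul_balanced X K (r + p) l q (r + s) t n (by omega) ht (by omega)
        (X.lact r p (r + p) rfl f x) g y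
      simp only [LinearMap.mk₂_apply, LinearMap.comp_apply, LinearMap.flip_apply]
      rw [← e1, e2])).flip

theorem tensorLact_tmul {a a' : A.Obj} {b : B.Obj} {c : C.Obj} (r p q m s n : ℤ) (hm : p + q = m)
    (hs : r + p = s) (hn : r + m = n) (g : A.Hom a a' r) (x : X.obj a b p) (y : K.obj b c q) :
    tensorLact X K r m n hn g (tmul X K p q m hm x y) =
      tmul X K s q n (by omega) (X.lact r p s hs g x) y := by
  subst hs
  rw [tensorLact, LinearMap.flip_apply, tensorLift_tmul]
  rfl

/-- The right action `(x ⊗ y) f = x ⊗ y f`. -/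
noncomputable def tensorRact {a : A.Obj} {c c' : C.Obj} (m r n : ℤ) (h : m + r = n) :
    TensorObj X K a c m →ₗ[k] C.Hom c' c r →ₗ[k] TensorObj X K a c' n :=
  tensorLift
    (V := C.Hom c' c r →ₗ[k] TensorObj X K a c' n)
    (fun _ p q e => LinearMap.mk₂ k
      (fun x y => (tmul X K p (q + r) n (by omega) x).comp (K.ract q r (q + r) rfl y))
      (by intros; ext; simp) (by intros; ext; simp) (by intros; ext; simp)
      (by intros; ext; simp))
    (by
      intro b b' p l q s t hs ht hn x g y
      ext f
      have e1 := K.lact_ract l q r t (q + r) (t + r) ht rfl (by omega) g y f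
      have e2 := tmul_balanced X K p l (q + r) s (t + r) n hs (by omega) (by omega)
        x g (K.ract q r (q + r) rfl y f)
      simp only [LinearMap.mk₂_apply, LinearMap.comp_apply]
      rw [e1, e2])

theorem tensorRact_tmul {a : A.Obj} {b : B.Obj} {c c' : C.Obj} (p q r m t n : ℤ) (hm : p + q = m)
    (ht : q + r = t) (hn : m + r = n) (x : X.obj a b p) (y : K.obj b c q) (f : C.Hom c' c r) :
    tensorRact X K m r n hn (tmul X K p q m hm x y) f =
      tmul X K p t n (by omega) x (K.ract q r t ht y f) := by
  subst ht
  rw [tensorRact, tensorLift_tmul]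
  rfl

theorem tensorD_tensorRact {a : A.Obj} {c c' : C.Obj} (p q n p' q' n' : ℤ) (h : p + q = n)
    (hp : p + 1 = p') (hq : q + 1 = q') (hn : n + 1 = n') (m : TensorObj X K a c p)
    (f : C.Hom c' c q) :
    tensorD X K a c' n n' hn (tensorRact X K p q n h m f) =
      tensorRact X K p' q n' (by omega) (tensorD X K a c p p' hp m) f +
        koszulSign k p • tensorRact X K p q' n' (by omega) m (C.d q q' hq f) := by
  have key : (tensorD X K a c' n n' hn).comp ((tensorRact X K p q n h).flip f) =
      ((tensorRact X K p' q n' (by omega)).flip f).comp (tensorD X K a c p p' hp) +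
        koszulSign k p • (tensorRact X K p q' n' (by omega)).flip (C.d q q' hq f) := by
    refine tensor_hom_ext ?_
    intro b i j e x y
    simp only [LinearMap.comp_apply, LinearMap.add_apply, LinearMap.smul_apply,
      LinearMap.flip_apply]
    rw [tensorRact_tmul X K i j q p (j + q) n e rfl h,
      tensorD_tmul X K i (j + q) n (i + 1) (j + q + 1) n' (by omega) rfl rfl hn,
      tensorD_tmul X K i j p (i + 1) (j + 1) p' e rfl rfl hp,
      map_add, map_smul, LinearMap.add_apply, LinearMap.smul_apply,
      tensorRact_tmul X K (i + 1) j q p' (j + q) n' (by omega) rfl (by omega),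
      tensorRact_tmul X K i (j + 1) q p' (j + q + 1) n' (by omega) (by omega) (by omega),
      tensorRact_tmul X K i j q' p (j + q + 1) n' e (by omega) (by omega),
      K.d_ract j q (j + q) (j + 1) q' (j + q + 1) rfl rfl hq rfl y f]
    have e4 : koszulSign k p = koszulSign k i * koszulSign k j := by
      rw [← e, koszulSign_add]
    rw [e4, map_add, map_smul, smul_add, smul_smul]
    exact (add_assoc _ _ _).symm
  exact LinearMap.congr_fun key m

/-- The (underived) tensor product `X ⊗_B K` of an `A`-`B`-bimodule and a `B`-`C`-bimodule. -/
@[reducible] noncomputable def tensor : DGBimodule A C where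
  obj := fun a c n => TensorObj X K a c n
  d := fun {a c} p q h => tensorD X K a c p q h
  lact := fun p q n h => tensorLact X K p q n h
  ract := fun p q n h => tensorRact X K p q n h
  d_d := by
    intro a c p q r h h' m
    refine LinearMap.congr_fun (f := (tensorD X K a c q r h').comp (tensorD X K a c p q h))
      (g := 0) (tensor_hom_ext ?_) m
    intro b i j e x y
    rw [LinearMap.comp_apply,
      tensorD_tmul X K i j p (i + 1) (j + 1) q e rfl rfl h, map_add, map_smul,
      tensorD_tmul X K (i + 1) j q (i + 1 + 1) (j + 1) r (by omega) rfl rfl h',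
      tensorD_tmul X K i (j + 1) q (i + 1) (j + 1 + 1) r (by omega) rfl rfl h',
      X.d_d, K.d_d, koszulSign_succ]
    simp
  d_lact := by
    intro a a' c p q n p' q' n' h hp hq hn g m
    refine LinearMap.congr_fun
      (f := (tensorD X K a' c n n' hn).comp (tensorLact X K p q n h g))
      (g := tensorLact X K p' q n' (by omega) (A.d p p' hp g) +
        koszulSign k p • (tensorLact X K p q' n' (by omega) g).comp (tensorD X K a c q q' hq))
      (tensor_hom_ext ?_) m
    intro b i j e x y
    simp only [LinearMap.comp_apply, LinearMap.add_apply, LinearMap.smul_apply]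
    rw [tensorLact_tmul X K p i j q (p + i) n e rfl h,
      tensorD_tmul X K (p + i) j n (p + i + 1) (j + 1) n' (by omega) rfl rfl hn,
      tensorLact_tmul X K p' i j q (p + i + 1) n' e (by omega) (by omega),
      tensorD_tmul X K i j q (i + 1) (j + 1) q' e rfl rfl hq, map_add, map_smul,
      tensorLact_tmul X K p (i + 1) j q' (p + i + 1) n' (by omega) (by omega) (by omega),
      tensorLact_tmul X K p i (j + 1) q' (p + i) n' (by omega) rfl (by omega),
      X.d_lact p i (p + i) p' (i + 1) (p + i + 1) rfl hp rfl rfl g x, koszulSign_add]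
    simp only [map_add, map_smul, LinearMap.add_apply, LinearMap.smul_apply]
    module
  d_ract := tensorD_tensorRact X K
  lact_lact := by
    intro a a' a'' c p q r s t n hs ht hn g g' m
    refine LinearMap.congr_fun
      (f := tensorLact X K s r n (by omega) (A.comp p q s hs g g'))
      (g := (tensorLact X K p t n hn g).comp (tensorLact X K q r t ht g'))
      (tensor_hom_ext ?_) m
    intro b i j e x y
    rw [LinearMap.comp_apply, tensorLact_tmul X K s i j r (s + i) n e rfl (by omega),
      tensorLact_tmul X K q i j r (q + i) t e rfl ht,
      tensorLact_tmul X K p (q + i) j t (s + i) n (by omega) (by omega) hn,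
      X.lact_lact p q i s (q + i) (s + i) hs rfl (by omega) g g' x]
  ract_ract := by
    intro a c c' c'' p q r s t n hs ht hn m f f'
    refine LinearMap.congr_fun
      (f := ((tensorRact X K s r n (by omega)).flip f').comp ((tensorRact X K p q s hs).flip f))
      (g := (tensorRact X K p t n hn).flip (C.comp q r t ht f f'))
      (tensor_hom_ext ?_) m
    intro b i j e x y
    simp only [LinearMap.comp_apply, LinearMap.flip_apply]
    rw [tensorRact_tmul X K i j q p (j + q) s e rfl hs,
      tensorRact_tmul X K i (j + q) r s (j + t) n (by omega) (by omega) (by omega),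
      tensorRact_tmul X K i j t p (j + t) n e rfl hn,
      K.ract_ract j q r (j + q) t (j + t) rfl ht rfl y f f']
  lact_ract := by
    intro a a' c c' p q r s t n hs ht hn g m f
    refine LinearMap.congr_fun
      (f := ((tensorRact X K s r n (by omega)).flip f).comp (tensorLact X K p q s hs g))
      (g := (tensorLact X K p t n hn g).comp ((tensorRact X K q r t ht).flip f))
      (tensor_hom_ext ?_) m
    intro b i j e x y
    simp only [LinearMap.comp_apply, LinearMap.flip_apply]
    rw [tensorLact_tmul X K p i j q (p + i) s e rfl hs,
      tensorRact_tmul X K (p + i) j r s (j + r) n (by omega) rfl (by omega),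
      tensorRact_tmul X K i j r q (j + r) t e rfl ht,
      tensorLact_tmul X K p i (j + r) t (p + i) n (by omega) rfl hn]
  one_lact := by
    intro a c p m
    refine LinearMap.congr_fun (f := tensorLact X K 0 p p (zero_add p) (A.one a))
      (g := LinearMap.id) (tensor_hom_ext ?_) m
    intro b i j e x y
    rw [tensorLact_tmul X K 0 i j p i p e (zero_add i) (zero_add p), X.one_lact]
    rfl
  ract_one := by
    intro a c p m
    refine LinearMap.congr_fun (f := (tensorRact X K p 0 p (add_zero p)).flip (C.one c))
      (g := LinearMap.id) (tensor_hom_ext ?_) m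
    intro b i j e x y
    rw [LinearMap.flip_apply,
      tensorRact_tmul X K i j 0 p j p e (add_zero j) (add_zero p), K.ract_one]
    rfl

end Tensor

/-- A right dg `B`-module `P` is h-flat if `P ⊗_B N` is acyclic for every acyclic left dg
`B`-module `N`. -/
def IsHFlat (P : DGModule B) : Prop :=
  ∀ N : DGBimodule B (DGCategory.unit k), IsAcyclic N → IsAcyclic (tensor P N)

/-- `X` is a model of the (derived) convolution `Φ_K(F)`, the derived tensor product over `B` of
the bimodule `K` with the right `B`-module `F`: it is `P ⊗_B K` for some h-flat resolution
`P ⟶ F`. Every dg module has an h-flat resolution, and any two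
models are connected by quasi-isomorphisms. -/
def IsConvolution (K : DGBimodule B C) (F : DGModule B) (X : DGModule C) : Prop :=
  ∃ (P : DGModule B) (f : Hom P F), IsQuasiIso f ∧ IsHFlat P ∧ X = tensor P K

/-- The idempotent closure `⟨𝒢⟩`: the smallest class of objects of the derived category that
contains `𝒢` and is closed under quasi-isomorphisms, shifts, finite direct sums and direct
summands. -/
inductive finClosure (𝒢 : Set (DGBimodule B C)) : Set (DGBimodule B C)
  | of (M : DGBimodule B C) (h : M ∈ 𝒢) : finClosure 𝒢 M
  | qis {M N : DGBimodule B C} (f : Hom M N) (hf : IsQuasiIso f) (h : finClosure 𝒢 M) :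
      finClosure 𝒢 N
  | qis_symm {M N : DGBimodule B C} (f : Hom M N) (hf : IsQuasiIso f) (h : finClosure 𝒢 N) :
      finClosure 𝒢 M
  | shift (i : ℤ) (M : DGBimodule B C) (h : finClosure 𝒢 M) : finClosure 𝒢 (M.shift i)
  | dsum {ι : Type u} [Finite ι] (M : ι → DGBimodule B C) (h : ∀ i, finClosure 𝒢 (M i)) :
      finClosure 𝒢 (dsum M)
  | summand {ι : Type u} (M : ι → DGBimodule B C) (h : finClosure 𝒢 (DGBimodule.dsum M)) (i : ι) :
      finClosure 𝒢 (M i)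

/-- The class `ads(𝒢)`: the smallest class of objects of the derived category that contains `𝒢`
and is closed under quasi-isomorphisms, shifts, arbitrary direct sums and direct summands. -/
inductive ads (𝒢 : Set (DGBimodule B C)) : Set (DGBimodule B C)
  | of (M : DGBimodule B C) (h : M ∈ 𝒢) : ads 𝒢 M
  | qis {M N : DGBimodule B C} (f : Hom M N) (hf : IsQuasiIso f) (h : ads 𝒢 M) : ads 𝒢 N
  | qis_symm {M N : DGBimodule B C} (f : Hom M N) (hf : IsQuasiIso f) (h : ads 𝒢 N) : ads 𝒢 M
  | shift (i : ℤ) (M : DGBimodule B C) (h : ads 𝒢 M) : ads 𝒢 (M.shift i)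
  | dsum {ι : Type u} (M : ι → DGBimodule B C) (h : ∀ i, ads 𝒢 (M i)) : ads 𝒢 (dsum M)
  | summand {ι : Type u} (M : ι → DGBimodule B C) (h : ads 𝒢 (DGBimodule.dsum M)) (i : ι) :
      ads 𝒢 (M i)

/-- `𝒢₁ * 𝒢₂`: the cones of morphisms from objects of `𝒢₁` to objects of `𝒢₂`. (If `𝒢₁` is closed
under quasi-isomorphisms, every cone of a morphism in the derived category is quasi-isomorphic to
one of these.) -/
def star (𝒢₁ 𝒢₂ : Set (DGBimodule B C)) : Set (DGBimodule B C) :=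
  {M | ∃ M₁ ∈ 𝒢₁, ∃ M₂ ∈ 𝒢₂, ∃ f : Hom M₁ M₂, M = cone f}

/-- `⟨𝒢⟩₀` consists of the zero objects of the derived category, and
`⟨𝒢⟩ₖ₊₁ = ⟨⟨𝒢⟩ₖ * ⟨𝒢⟩⟩`. -/
def gen (𝒢 : Set (DGBimodule B C)) : ℕ → Set (DGBimodule B C)
  | 0 => {M | IsAcyclic M}
  | n + 1 => finClosure (star (gen 𝒢 n) (finClosure 𝒢))

/-- The generation time of `ℰ` by `𝒢`: the least `n` with `ℰ ⊆ ⟨𝒢⟩ₙ₊₁`, or `∞` if there is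
none. -/
noncomputable def genTime (𝒢 ℰ : Set (DGBimodule B C)) : ℕ∞ :=
  ⨅ (n : ℕ) (_ : ℰ ⊆ gen 𝒢 (n + 1)), (n : ℕ∞)

end DGBimodule

namespace DGCategory

variable {k : Type u} [Field k] (C : DGCategory k)

/-- `Perf(C)`, the idempotent-completed pretriangulated closure of `C`: the smallest class of
objects of the derived category of right dg `C`-modules that contains the representable modules
and is closed under quasi-isomorphisms, shifts, cones, finite direct sums and direct summands. -/
inductive Perf : Set (DGModule C)
  | representable (x : C.Obj) : Perf (C.representable x)
  | qis {M N : DGModule C} (f : DGBimodule.Hom M N) (hf : DGBimodule.IsQuasiIso f)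
      (h : Perf M) : Perf N
  | qis_symm {M N : DGModule C} (f : DGBimodule.Hom M N) (hf : DGBimodule.IsQuasiIso f)
      (h : Perf N) : Perf M
  | shift (i : ℤ) (M : DGModule C) (h : Perf M) : Perf (M.shift i)
  | cone {M N : DGModule C} (f : DGBimodule.Hom M N) (hM : Perf M) (hN : Perf N) :
      Perf (DGBimodule.cone f)
  | dsum {ι : Type u} [Finite ι] (M : ι → DGModule C) (h : ∀ i, Perf (M i)) :
      Perf (DGBimodule.dsum M)
  | summand {ι : Type u} (M : ι → DGModule C) (h : Perf (DGBimodule.dsum M)) (i : ι) :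
      Perf (M i)

/-- The Rouquier dimension of `C`: the least generation time of `Perf(C)` by one of its
objects, or `∞`. -/
noncomputable def Rdim : ℕ∞ :=
  ⨅ G ∈ C.Perf, DGBimodule.genTime {G} C.Perf

variable {C}

/-- The bimodule `G₁₂` is weakly product on the class `ℰ` of `C`-modules, with witness the perfect
module `G₂`: the convolution `Φ_{G₁₂}(F)` lies in `ads(G₂)` for every `F` in `ℰ`. -/
def IsWeaklyProductOn (ℰ : Set (DGModule C)) (G₁₂ : DGBimodule C C) (G₂ : DGModule C) : Prop :=
  G₂ ∈ C.Perf ∧ ∀ F ∈ ℰ, ∃ X : DGModule C,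
    DGBimodule.IsConvolution G₁₂ F X ∧ X ∈ DGBimodule.ads {G₂}

/-- Weakly product bimodules: there is a perfect module `G₂` with `Φ_{G₁₂}(F) ∈ ads(G₂)` for every
perfect module `F`. -/
def IsWeaklyProduct (G₁₂ : DGBimodule C C) : Prop :=
  ∃ G₂ : DGModule C, IsWeaklyProductOn C.Perf G₁₂ G₂

end DGCategory

/-! Let `P ⟶ F` be the h-flat resolution for which `tensor P G₁₂` lies in `ads {G₂}`. Convolution
with `P` preserves quasi-isomorphisms, cones, shifts, sums and summands, and it sends the diagonal
back to `P`. A construction of the diagonal from `G₁₂` in `t + 1` layers thus becomes a construction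
of `P` from `ads {G₂}` in `t + 1` layers. What remains is to pass from arbitrary to finite direct
sums without adding layers, and this is where perfectness of `F` enters. A morphism from a compact
object to an object built in `n` layers from `ads {G₂}` factors through a compact object built in
`n` layers from finite sums of shifts of `G₂`. Applied to the identity of `F`, this exhibits `F` as
a retract of an object of `gen {G₂} (t + 1)`.

No localisation is constructed. Derived morphisms are computed in the homotopy category `Ho C`, out
of h-projective modules: `HProj.exists_lift` and `HProj.eq_of_comp_eq` say that quasi-isomorphisms
become invertible there. By `exists_good` every perfect module has a compact h-projective
resolution. The delicate case is that of direct summands, where a homotopy idempotent has to be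
split by the cone of an endomorphism of a countable direct sum.

The factorisation property is `FactorsThrough`, and the closure of this class under the operations
defining `ads` and `gen` carries the argument. Its heart is `FactorsThrough.star`. Given a morphism
from `X[1]` to the cone of `M ⟶ N`, its component in `M[1]` factors through some `W₁`. The other
component and the factorisation define a morphism to `N` from the cone of `X ⟶ W₁`, which is again
compact and h-projective, so this morphism factors through some `W₂`. The original morphism then
factors through a cone of `W₁ ⟶ W₂`.

`tensor_mem_factorsThrough_gen` transports this along the layers of `gen`.
`mem_gen_of_diagonal_mem_gen` combines it with the retraction of `tensor P C.diagonal` onto `P`.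
Finally `mem_finClosure_of_homotopy_retract` turns a retract up to homotopy into an honest summand.
-/

namespace DGBimodule

open CategoryTheory

/-! ### The additive category of dg bimodules; cocycles, coboundaries and quasi-isomorphisms. -/

section Basic

variable {k : Type u} [Field k] {B C : DGCategory k}

attribute [ext] Hom

theorem hom_ext_app {M N : DGBimodule B C} {f g : Hom M N}
    (h : ∀ b c n (m : M.obj b c n), f.app b c n m = g.app b c n m) : f = g := by
  ext b c n m
  exact h b c n m

/-- Dg bimodules and closed morphisms of degree `0` form a category. -/
instance : Category (DGBimodule B C) where
  Hom M N := Hom M N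
  id M :=
    { app := fun _ _ _ => LinearMap.id
      app_d := fun _ _ _ _ => rfl
      app_lact := fun _ _ _ _ _ _ => rfl
      app_ract := fun _ _ _ _ _ _ => rfl }
  comp f g :=
    { app := fun b c n => g.app b c n ∘ₗ f.app b c n
      app_d := by intros; simp [f.app_d, g.app_d]
      app_lact := by intros; simp [f.app_lact, g.app_lact]
      app_ract := by intros; simp [f.app_ract, g.app_ract] }

@[simp] theorem id_app_apply (M : DGBimodule B C) (b : B.Obj) (c : C.Obj) (n : ℤ)
    (m : M.obj b c n) : Hom.app (𝟙 M) b c n m = m := rfl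

@[simp] theorem comp_app_apply {M N L : DGBimodule B C} (f : M ⟶ N) (g : N ⟶ L) (b : B.Obj)
    (c : C.Obj) (n : ℤ) (m : M.obj b c n) :
    Hom.app (f ≫ g) b c n m = g.app b c n (f.app b c n m) := rfl

variable {M N : DGBimodule B C}

instance : Zero (Hom M N) where
  zero :=
    { app := fun _ _ _ => 0
      app_d := by intros; simp
      app_lact := by intros; simp
      app_ract := by intros; simp }

instance : Add (Hom M N) where
  add f g :=
    { app := fun b c n => f.app b c n + g.app b c n
      app_d := by intros; simp [f.app_d, g.app_d]
      app_lact := by intros; simp [f.app_lact, g.app_lact]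
      app_ract := by intros; simp [f.app_ract, g.app_ract] }

instance : Neg (Hom M N) where
  neg f :=
    { app := fun b c n => -f.app b c n
      app_d := by intros; simp [f.app_d]
      app_lact := by intros; simp [f.app_lact]
      app_ract := by intros; simp [f.app_ract] }

instance : Sub (Hom M N) where
  sub f g :=
    { app := fun b c n => f.app b c n - g.app b c n
      app_d := by intros; simp [f.app_d, g.app_d]
      app_lact := by intros; simp [f.app_lact, g.app_lact]
      app_ract := by intros; simp [f.app_ract, g.app_ract] }

instance : SMul ℕ (Hom M N) where
  smul r f :=
    { app := fun b c n => r • f.app b c n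
      app_d := by intros; simp [f.app_d]
      app_lact := by intros; simp [f.app_lact]
      app_ract := by intros; simp [f.app_ract] }

instance : SMul ℤ (Hom M N) where
  smul r f :=
    { app := fun b c n => r • f.app b c n
      app_d := by intros; simp [f.app_d]
      app_lact := by intros; simp [f.app_lact]
      app_ract := by intros; simp [f.app_ract] }

instance : AddCommGroup (Hom M N) :=
  Function.Injective.addCommGroup (Hom.app) (fun _ _ h => Hom.ext h) rfl
    (fun _ _ => rfl) (fun _ => rfl) (fun _ _ => rfl) (fun _ _ => rfl) (fun _ _ => rfl)

instance : Preadditive (DGBimodule B C) where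
  homGroup M N := inferInstanceAs (AddCommGroup (Hom M N))
  add_comp := by
    intro M N L f f' g
    exact hom_ext_app fun b c n m => map_add (g.app b c n) _ _
  comp_add := by
    intro M N L f f' g
    rfl

variable {b : B.Obj} {c : C.Obj} {n : ℤ}

@[simp] theorem zero_app_apply (m : M.obj b c n) : Hom.app (0 : M ⟶ N) b c n m = 0 := rfl

@[simp] theorem add_app_apply (f g : M ⟶ N) (m : M.obj b c n) :
    Hom.app (f + g) b c n m = f.app b c n m + g.app b c n m := rfl

@[simp] theorem sub_app_apply (f g : M ⟶ N) (m : M.obj b c n) :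
    Hom.app (f - g) b c n m = f.app b c n m - g.app b c n m := rfl

@[simp] theorem neg_app_apply (f : M ⟶ N) (m : M.obj b c n) :
    Hom.app (-f) b c n m = -f.app b c n m := rfl

theorem sum_app_apply {ι : Type*} (J : Finset ι) (f : ι → (M ⟶ N)) (m : M.obj b c n) :
    Hom.app (∑ j ∈ J, f j) b c n m = ∑ j ∈ J, (f j).app b c n m := by
  classical
  induction J using Finset.induction_on with
  | empty => simp
  | insert a s ha ih => rw [Finset.sum_insert ha, Finset.sum_insert ha, add_app_apply, ih]

/-- The cocycles of degree `n`. -/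
def cyc (M : DGBimodule B C) (b : B.Obj) (c : C.Obj) (n : ℤ) : Submodule k (M.obj b c n) :=
  LinearMap.ker (M.d n (n + 1) rfl)

/-- The coboundaries of degree `n`. -/
def bdry (M : DGBimodule B C) (b : B.Obj) (c : C.Obj) (n : ℤ) : Submodule k (M.obj b c n) :=
  LinearMap.range (M.d (n - 1) n (by omega))

theorem mem_cyc {m : M.obj b c n} (q : ℤ) (h : n + 1 = q) :
    m ∈ M.cyc b c n ↔ M.d n q h m = 0 := by
  subst h
  rfl

theorem mem_bdry {m : M.obj b c n} (p : ℤ) (h : p + 1 = n) :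
    m ∈ M.bdry b c n ↔ ∃ x, M.d p n h x = m := by
  obtain rfl : p = n - 1 := by omega
  rfl

theorem d_mem_bdry (p : ℤ) (h : p + 1 = n) (x : M.obj b c p) : M.d p n h x ∈ M.bdry b c n :=
  (mem_bdry p h).2 ⟨x, rfl⟩

theorem app_mem_cyc (f : M ⟶ N) {m : M.obj b c n} (hm : m ∈ M.cyc b c n) :
    f.app b c n m ∈ N.cyc b c n := by
  rw [mem_cyc (n + 1) rfl] at hm ⊢
  rw [← f.app_d, hm, map_zero]

theorem app_mem_bdry (f : M ⟶ N) {m : M.obj b c n} (hm : m ∈ M.bdry b c n) :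
    f.app b c n m ∈ N.bdry b c n := by
  obtain ⟨x, rfl⟩ := (mem_bdry (n - 1) (by omega)).1 hm
  rw [f.app_d]
  exact d_mem_bdry _ _ _

theorem isAcyclic_iff : M.IsAcyclic ↔ ∀ b c n, ∀ m ∈ M.cyc b c n, m ∈ M.bdry b c n := by
  constructor
  · intro h b c n m hm
    rw [mem_bdry (n - 1) (by omega)]
    exact h b c (n - 1) n (n + 1) _ rfl m hm
  · intro h b c p q r hp hr m hm
    rw [← mem_bdry]
    exact h b c q m ((mem_cyc r hr).2 hm)

theorem isQuasiIso_iff {f : M ⟶ N} : IsQuasiIso f ↔ ∀ b c n,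
    (∀ m ∈ M.cyc b c n, f.app b c n m ∈ N.bdry b c n → m ∈ M.bdry b c n) ∧
    (∀ y ∈ N.cyc b c n, ∃ m ∈ M.cyc b c n, y - f.app b c n m ∈ N.bdry b c n) := by
  constructor
  · intro h b c n
    refine ⟨fun m hm hy => ?_, fun y hy => ?_⟩
    · rw [mem_bdry (n - 1) (by omega)] at hy ⊢
      exact (h b c (n - 1) n (n + 1) _ rfl).1 m hm hy
    · obtain ⟨m, hm, z, hz⟩ := (h b c (n - 1) n (n + 1) (by omega) rfl).2 y hy
      refine ⟨m, hm, (mem_bdry (n - 1) (by omega)).2 ⟨z, ?_⟩⟩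
      rw [← hz, add_sub_cancel_left]
  · intro h b c p q r hp hr
    refine ⟨fun m hm hy => ?_, fun y hy => ?_⟩
    · rw [← mem_bdry] at hy ⊢
      exact (h b c q).1 m ((mem_cyc r hr).2 hm) hy
    · obtain ⟨m, hm, hy'⟩ := (h b c q).2 y ((mem_cyc r hr).2 hy)
      obtain ⟨z, hz⟩ := (mem_bdry p hp).1 hy'
      exact ⟨m, (mem_cyc r hr).1 hm, z, by rw [hz, add_sub_cancel]⟩

theorem isQuasiIso_id (M : DGBimodule B C) : IsQuasiIso (𝟙 M) :=
  isQuasiIso_iff.2 fun _ _ _ => ⟨fun _ _ h => h, fun y hy => ⟨y, hy, by simp⟩⟩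

theorem IsQuasiIso.comp {L : DGBimodule B C} {f : M ⟶ N} {g : N ⟶ L} (hf : IsQuasiIso f)
    (hg : IsQuasiIso g) : IsQuasiIso (f ≫ g) := by
  rw [isQuasiIso_iff] at *
  intro b c n
  refine ⟨fun m hm h => (hf b c n).1 m hm ((hg b c n).1 _ (app_mem_cyc f hm) h), fun y hy => ?_⟩
  obtain ⟨m, hm, h⟩ := (hg b c n).2 y hy
  obtain ⟨m', hm', h'⟩ := (hf b c n).2 m hm
  refine ⟨m', hm', ?_⟩
  have := add_mem h (app_mem_bdry g h')
  simpa using this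

/-- One case of two-out-of-three. It shows that the lift of a resolution through a quasi-isomorphism
is again a resolution. -/
theorem isQuasiIso_of_comp {L : DGBimodule B C} {f : M ⟶ N} {g : N ⟶ L} (hg : IsQuasiIso g)
    (hfg : IsQuasiIso (f ≫ g)) : IsQuasiIso f := by
  rw [isQuasiIso_iff] at *
  intro b c n
  refine ⟨fun m hm h => (hfg b c n).1 m hm (app_mem_bdry g h), fun y hy => ?_⟩
  obtain ⟨m, hm, h⟩ := (hfg b c n).2 _ (app_mem_cyc g hy)
  refine ⟨m, hm, (hg b c n).1 _ (sub_mem hy (app_mem_cyc f hm)) ?_⟩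
  simpa using h

theorem isQuasiIso_of_isIso (f : M ⟶ N) [IsIso f] : IsQuasiIso f := by
  have key : ∀ {M N : DGBimodule B C} (f : M ⟶ N) [IsIso f] b c n (m : M.obj b c n),
      (inv f).app b c n (f.app b c n m) = m := by
    intro M N f _ b c n m
    rw [← comp_app_apply, IsIso.hom_inv_id, id_app_apply]
  rw [isQuasiIso_iff]
  intro b c n
  refine ⟨fun m hm h => ?_, fun y hy => ⟨(inv f).app b c n y, app_mem_cyc _ hy, ?_⟩⟩
  · have := app_mem_bdry (inv f) h
    rwa [key] at this
  · have := key (inv f) b c n y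
    rw [IsIso.inv_inv] at this
    rw [this, sub_self]
    exact Submodule.zero_mem _

theorem IsAcyclic.of_isQuasiIso {f : M ⟶ N} (hf : IsQuasiIso f) (hM : M.IsAcyclic) :
    N.IsAcyclic := by
  rw [isAcyclic_iff] at *
  intro b c n y hy
  obtain ⟨m, hm, h⟩ := (isQuasiIso_iff.1 hf b c n).2 y hy
  have := add_mem h (app_mem_bdry f (hM b c n m hm))
  simpa using this

end Basic

/-! ### Right dg modules, null-homotopic morphisms and the homotopy category. -/

section Module

variable {k : Type u} [Field k] {C : DGCategory k}

/-- A left action of `k` has no freedom: linearity and the unit axiom force it to be scalar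
multiplication. Hence compatibility with the left action is automatic in `homMk`. -/
theorem unit_lact_eq (M : DGModule C) {b b' : PUnit.{u + 1}} {c : C.Obj} (p q n : ℤ)
    (h : p + q = n) (g : unitDeg k p) (m : M.obj b c q) :
    M.lact (b := b) (b' := b') p q n h g m = scalarAct (fun n => M.obj b c n) p q n h g m := by
  by_cases h0 : p = 0
  · subst h0
    obtain rfl : q = n := by omega
    rw [scalarAct_zero]
    have e : g = (g : k) • (DGCategory.unit k).one b := Subtype.ext (mul_one _).symm
    conv_lhs => rw [e]
    rw [map_smul, LinearMap.smul_apply]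
    congr 1
    exact M.one_lact q m
  · obtain rfl : g = 0 := unitDeg_eq_zero h0 g
    rw [map_zero, map_zero]

variable {M N L : DGModule C}

/-- A family of linear maps that commutes with differentials and the right action is a morphism of
right dg modules. -/
def homMk (φ : ∀ (c : C.Obj) (n : ℤ), M.obj ⟨⟩ c n →ₗ[k] N.obj ⟨⟩ c n)
    (hd : ∀ (c : C.Obj) (p q : ℤ) (h : p + 1 = q) (m : M.obj ⟨⟩ c p),
      φ c q (M.d p q h m) = N.d p q h (φ c p m))
    (hr : ∀ (c c' : C.Obj) (p q n : ℤ) (h : p + q = n) (m : M.obj ⟨⟩ c p) (f : C.Hom c' c q),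
      φ c' n (M.ract p q n h m f) = N.ract p q n h (φ c p m) f) : M ⟶ N where
  app _ c n := φ c n
  app_d p q h m := hd _ p q h m
  app_lact {b b' c} p q n h g m := by
    rw [unit_lact_eq, unit_lact_eq]
    by_cases h0 : p = 0
    · subst h0
      obtain rfl : q = n := by omega
      rw [scalarAct_zero, scalarAct_zero, map_smul]
    · obtain rfl : g = 0 := unitDeg_eq_zero h0 g
      rw [map_zero, map_zero, LinearMap.zero_apply, LinearMap.zero_apply, map_zero]
  app_ract p q n h m f := hr _ _ p q n h m f

/-- A graded map of degree `-1` that commutes with the right action. -/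
structure Pre (M N : DGModule C) where
  app : ∀ (c : C.Obj) (p q : ℤ), q + 1 = p → (M.obj ⟨⟩ c p →ₗ[k] N.obj ⟨⟩ c q)
  app_ract : ∀ {c c' : C.Obj} (p q n p' n' : ℤ) (h : p + q = n) (hp : p' + 1 = p)
    (hn : n' + 1 = n) (m : M.obj ⟨⟩ c p) (f : C.Hom c' c q),
    app c' n n' hn (M.ract p q n h m f) = N.ract p' q n' (by omega) (app c p p' hp m) f

/-- `f` is the boundary `d h + h d` of `h`. -/
def Pre.IsBoundary (h : Pre M N) (f : M ⟶ N) : Prop :=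
  ∀ (c : C.Obj) (p q r : ℤ) (hq : q + 1 = p) (hr : p + 1 = r) (m : M.obj ⟨⟩ c p),
    f.app ⟨⟩ c p m = N.d q p hq (h.app c p q hq m) + h.app c r p hr (M.d p r hr m)

/-- Null-homotopic morphisms. -/
def Null (f : M ⟶ N) : Prop := ∃ h : Pre M N, h.IsBoundary f

theorem null_zero : Null (0 : M ⟶ N) :=
  ⟨⟨fun _ _ _ _ => 0, by intros; simp⟩, by intro c p q r hq hr m; simp⟩

theorem Null.add {f g : M ⟶ N} (hf : Null f) (hg : Null g) : Null (f + g) := by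
  obtain ⟨h, hh⟩ := hf
  obtain ⟨h', hh'⟩ := hg
  refine ⟨⟨fun c p q e => h.app c p q e + h'.app c p q e, ?_⟩, ?_⟩
  · intro c c' p q n p' n' e hp hn m f
    simp [h.app_ract p q n p' n' e hp hn, h'.app_ract p q n p' n' e hp hn]
  · intro c p q r hq hr m
    simp only [add_app_apply, hh c p q r hq hr m, hh' c p q r hq hr m, LinearMap.add_apply,
      map_add]
    abel

theorem Null.neg {f : M ⟶ N} (hf : Null f) : Null (-f) := by
  obtain ⟨h, hh⟩ := hf
  refine ⟨⟨fun c p q e => -h.app c p q e, ?_⟩, ?_⟩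
  · intro c c' p q n p' n' e hp hn m f
    simp [h.app_ract p q n p' n' e hp hn]
  · intro c p q r hq hr m
    simp only [neg_app_apply, hh c p q r hq hr m, LinearMap.neg_apply, map_neg]
    abel

theorem Null.comp {f : M ⟶ N} (hf : Null f) (g : N ⟶ L) : Null (f ≫ g) := by
  obtain ⟨h, hh⟩ := hf
  refine ⟨⟨fun c p q e => g.app _ c q ∘ₗ h.app c p q e, ?_⟩, ?_⟩
  · intro c c' p q n p' n' e hp hn m f
    simp [h.app_ract p q n p' n' e hp hn, g.app_ract]
  · intro c p q r hq hr m
    simp [hh c p q r hq hr m, g.app_d]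

theorem Null.precomp {g : N ⟶ L} (hg : Null g) (f : M ⟶ N) : Null (f ≫ g) := by
  obtain ⟨h, hh⟩ := hg
  refine ⟨⟨fun c p q e => h.app c p q e ∘ₗ f.app _ c p, ?_⟩, ?_⟩
  · intro c c' p q n p' n' e hp hn m a
    simp only [LinearMap.comp_apply]
    rw [f.app_ract, h.app_ract p q n p' n' e hp hn]
  · intro c p q r hq hr m
    simp [hh c p q r hq hr (f.app _ _ _ m), f.app_d]

/-- The homotopy relation. -/
def htpy (C : DGCategory k) : HomRel (DGModule C) := fun _ _ f g => Null (f - g)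

instance : Congruence (htpy C) where
  equivalence :=
    { refl := fun f => by
        change Null (f - f)
        rw [sub_self]
        exact null_zero
      symm := fun {f g} h => by
        change Null (g - f)
        rw [← neg_sub]
        exact h.neg
      trans := fun {f g l} h h' => by
        change Null (f - l)
        rw [← sub_add_sub_cancel f g l]
        exact h.add h' }
  comp_left := by
    intro _ _ _ f g g' h
    change Null (f ≫ g - f ≫ g')
    rw [← Preadditive.comp_sub]
    exact h.precomp f
  comp_right := by
    intro _ _ _ f f' g h
    change Null (f ≫ g - f' ≫ g)
    rw [← Preadditive.sub_comp]
    exact h.comp g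

theorem htpy_add ⦃M N : DGModule C⦄ (f f' g g' : M ⟶ N) (h : htpy C f f') (h' : htpy C g g') :
    htpy C (f + g) (f' + g') := by
  change Null (f + g - (f' + g'))
  rw [add_sub_add_comm]
  exact Null.add h h'

/-- The homotopy category of right dg modules. -/
abbrev Ho (C : DGCategory k) := CategoryTheory.Quotient (htpy C)

instance : Preadditive (Ho C) := Quotient.preadditive (htpy C) htpy_add

/-- The functor from right dg modules to the homotopy category. -/
abbrev Q (C : DGCategory k) : DGModule C ⥤ Ho C := Quotient.functor (htpy C)

instance : (Q C).Additive := Quotient.functor_additive (htpy C) htpy_add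

theorem Q_map_eq_iff (f g : M ⟶ N) : (Q C).map f = (Q C).map g ↔ Null (f - g) :=
  Quotient.functor_map_eq_iff (htpy C) f g

theorem Q_map_eq_zero_iff (f : M ⟶ N) : (Q C).map f = 0 ↔ Null f := by
  rw [← (Q C).map_zero, Q_map_eq_iff, sub_zero]

/-- On a cocycle the term `h d` vanishes and only `d h` survives, so null-homotopic morphisms act as
zero on cohomology. -/
theorem Null.app_mem_bdry {f : M ⟶ N} (hf : Null f) {b : PUnit} {c : C.Obj} {n : ℤ}
    {m : M.obj b c n} (hm : m ∈ M.cyc b c n) : f.app b c n m ∈ N.bdry b c n := by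
  obtain ⟨h, hh⟩ := hf
  have := hh c n (n - 1) (n + 1) (by omega) rfl m
  rw [(mem_cyc (n + 1) rfl).1 hm, map_zero, add_zero] at this
  rw [this]
  exact d_mem_bdry _ _ _

theorem IsQuasiIso.of_Q_map_eq {f g : M ⟶ N} (hf : IsQuasiIso f)
    (h : (Q C).map f = (Q C).map g) : IsQuasiIso g := by
  rw [Q_map_eq_iff] at h
  rw [isQuasiIso_iff] at *
  intro b c n
  refine ⟨fun m hm h' => (hf b c n).1 m hm ?_, fun y hy => ?_⟩
  · have := add_mem (h.app_mem_bdry hm) h'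
    simpa using this
  · obtain ⟨m, hm, h'⟩ := (hf b c n).2 y hy
    refine ⟨m, hm, ?_⟩
    have := add_mem (h.app_mem_bdry hm) h'
    simpa using this

end Module

/-! ### Mapping cones and cohomology. -/

section Cone

variable {k : Type u} [Field k] {B C : DGCategory k} {M N : DGBimodule B C}

/-- The inclusion of the target in the mapping cone. -/
def coneInr (f : M ⟶ N) : N ⟶ cone f where
  app b c n := LinearMap.inr k _ _
  app_d := by
    intro b c p q h m
    subst h
    rw [coneD_apply]
    simp
  app_lact := by
    intros
    exact Prod.ext (by simp) rfl
  app_ract := by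
    intros
    exact Prod.ext (by simp) rfl

theorem coneInr_app (f : M ⟶ N) (b : B.Obj) (c : C.Obj) (n : ℤ) (y : N.obj b c n) :
    (coneInr f).app b c n y = (0, y) := rfl

theorem mem_cyc_cone {f : M ⟶ N} {b : B.Obj} {c : C.Obj} {n : ℤ} {x : (cone f).obj b c n} :
    x ∈ (cone f).cyc b c n ↔ x.1 ∈ M.cyc b c (n + 1) ∧
      f.app b c (n + 1) x.1 + N.d n (n + 1) rfl x.2 = 0 := by
  rw [mem_cyc (n + 1) rfl, mem_cyc (n + 1 + 1) rfl]
  change coneD f b c n (n + 1) rfl x = 0 ↔ _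
  rw [coneD_apply, Prod.mk_eq_zero, neg_eq_zero]

theorem mem_bdry_cone {f : M ⟶ N} {b : B.Obj} {c : C.Obj} {n : ℤ} {x : (cone f).obj b c n}
    (p : ℤ) (hp : p + 1 = n) :
    x ∈ (cone f).bdry b c n ↔ ∃ (u : M.obj b c n) (v : N.obj b c p),
      M.d n (n + 1) rfl u = -x.1 ∧ f.app b c n u + N.d p n hp v = x.2 := by
  subst hp
  rw [mem_bdry p rfl]
  constructor
  · rintro ⟨⟨u, v⟩, rfl⟩
    refine ⟨u, v, ?_, rfl⟩
    change _ = -(coneD f b c p (p + 1) rfl (u, v)).1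
    rw [coneD_apply, neg_neg]
  · rintro ⟨u, v, h1, h2⟩
    refine ⟨(u, v), ?_⟩
    change coneD f b c p (p + 1) rfl _ = _
    rw [coneD_apply]
    exact Prod.ext (by rw [h1, neg_neg]) h2

/-- The content is the long exact sequence of the cone, carried out as a chase with elements. -/
theorem isQuasiIso_iff_isAcyclic_cone {f : M ⟶ N} : IsQuasiIso f ↔ (cone f).IsAcyclic := by
  rw [isQuasiIso_iff, isAcyclic_iff]
  constructor
  · intro h b c n x hx
    rw [mem_cyc_cone] at hx
    obtain ⟨hx1, hx2⟩ := hx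
    have h1 : f.app b c (n + 1) x.1 ∈ N.bdry b c (n + 1) := by
      rw [eq_neg_of_add_eq_zero_left hx2]
      exact neg_mem (d_mem_bdry _ _ _)
    obtain ⟨u, hu⟩ := (mem_bdry n rfl).1 ((h b c (n + 1)).1 _ hx1 h1)
    -- Since `d u = x.1`, adding `f u` corrects `x.2` to a cocycle. If `m` lifts its class along
    -- `f`, with error `d v`, then `(m - u, v)` is a primitive of `x`.
    have h2 : x.2 + f.app b c n u ∈ N.cyc b c n := by
      rw [mem_cyc (n + 1) rfl, map_add, ← f.app_d n (n + 1) rfl, hu, ← hx2]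
      exact add_comm _ _
    obtain ⟨m, hm, h3⟩ := (h b c n).2 _ h2
    obtain ⟨v, hv⟩ := (mem_bdry (n - 1) (by omega)).1 h3
    refine (mem_bdry_cone (n - 1) (by omega)).2 ⟨m - u, v, ?_, ?_⟩
    · rw [map_sub, (mem_cyc _ rfl).1 hm, hu, zero_sub]
    · rw [hv, map_sub]
      abel
  · intro h b c n
    refine ⟨fun m hm hfm => ?_, fun y hy => ?_⟩
    · obtain ⟨p, rfl⟩ : ∃ p, n = p + 1 := ⟨n - 1, by omega⟩
      obtain ⟨y, hy⟩ := (mem_bdry p rfl).1 hfm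
      -- When `f m = d y`, the pair `(m, -y)` is a cocycle of the cone, and a primitive of it
      -- contains a primitive of `m` up to sign.
      have : ((m, -y) : (cone f).obj b c p) ∈ (cone f).cyc b c p :=
        mem_cyc_cone.2 ⟨hm, by rw [map_neg, hy, add_neg_cancel]⟩
      obtain ⟨u, v, h1, h2⟩ := (mem_bdry_cone (p - 1) (by omega)).1 (h b c p _ this)
      refine (mem_bdry p rfl).2 ⟨-u, ?_⟩
      rw [map_neg, h1, neg_neg]
    · have : ((0, y) : (cone f).obj b c n) ∈ (cone f).cyc b c n :=
        mem_cyc_cone.2 ⟨zero_mem _, by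
          rw [map_zero, zero_add]
          exact (mem_cyc _ rfl).1 hy⟩
      obtain ⟨u, v, h1, h2⟩ := (mem_bdry_cone (n - 1) (by omega)).1 (h b c n _ this)
      refine ⟨u, (mem_cyc _ rfl).2 (by rw [h1, neg_zero]), ?_⟩
      have e : y - f.app b c n u = N.d (n - 1) n (by omega) v := by
        rw [sub_eq_iff_eq_add', h2]
      rw [e]
      exact d_mem_bdry _ _ _

end Cone

/-! ### Direct sums: universal property and cohomology. -/

section DirectSum

variable {k : Type u} [Field k] {B C : DGCategory k} {ι : Type u} (M : ι → DGBimodule B C)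

/-- The projections of a direct sum. -/
def dsumπ (i : ι) : dsum M ⟶ M i where
  app b c n := DFinsupp.lapply i
  app_d := by intros; simp
  app_lact := by intros; simp
  app_ract := by intros; simp

@[simp] theorem dsumπ_app (i : ι) (b : B.Obj) (c : C.Obj) (n : ℤ) (m : (dsum M).obj b c n) :
    (dsumπ M i).app b c n m = m i := rfl

open Classical in
/-- The inclusions of a direct sum. -/
noncomputable def dsumι (i : ι) : M i ⟶ dsum M where
  app b c n := DFinsupp.lsingle (R := k) (M := fun i => (M i).obj b c n) i
  app_d := by
    intro b c p q h m
    exact (DFinsupp.mapRange_single (f := fun i => (M i).d p q h)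
      (hf := fun i => map_zero _)).symm
  app_lact := by
    intro b b' c p q n h g m
    exact (DFinsupp.mapRange_single (f := fun i => (M i).lact p q n h g)
      (hf := fun i => map_zero _)).symm
  app_ract := by
    intro b c c' p q n h m g
    exact (DFinsupp.mapRange_single (f := fun i => ((M i).ract p q n h).flip g)
      (hf := fun i => map_zero _)).symm

open Classical in
theorem dsumι_app (i : ι) (b : B.Obj) (c : C.Obj) (n : ℤ) (m : (M i).obj b c n) :
    (dsumι M i).app b c n m = DFinsupp.single i m := rfl

theorem dsumι_π (i : ι) : dsumι M i ≫ dsumπ M i = 𝟙 (M i) := by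
  classical
  exact hom_ext_app fun b c n m =>
    DFinsupp.single_eq_same (β := fun i => (M i).obj b c n) (i := i) (b := m)

theorem dsumι_π_ne {i j : ι} (h : i ≠ j) : dsumι M i ≫ dsumπ M j = 0 := by
  classical
  exact hom_ext_app fun b c n m => DFinsupp.single_eq_of_ne h.symm

open Classical in
theorem dsum_eq_sum {b : B.Obj} {c : C.Obj} {n : ℤ} (m : (dsum M).obj b c n) :
    m = ∑ i ∈ DFinsupp.support m, (dsumι M i).app b c n (m i) :=
  (DFinsupp.sum_single (f := m)).symm

variable {M}

theorem dsum_linearMap_ext {b : B.Obj} {c : C.Obj} {n : ℤ} {V : Type u} [AddCommGroup V]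
    [Module k V] {f g : (dsum M).obj b c n →ₗ[k] V}
    (h : ∀ i m, f ((dsumι M i).app b c n m) = g ((dsumι M i).app b c n m)) : f = g := by
  classical
  refine LinearMap.ext fun m => ?_
  rw [dsum_eq_sum M m, map_sum, map_sum]
  exact Finset.sum_congr rfl fun i _ => h i _

open Classical in
/-- The linear map from a component of a direct sum given by a family of linear maps. -/
noncomputable def dsumLDesc {b : B.Obj} {c : C.Obj} {n : ℤ} {V : Type u} [AddCommGroup V]
    [Module k V] (φ : ∀ i, (M i).obj b c n →ₗ[k] V) : (dsum M).obj b c n →ₗ[k] V :=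
  DFinsupp.lsum ℕ φ

@[simp] theorem dsumLDesc_ι {b : B.Obj} {c : C.Obj} {n : ℤ} {V : Type u} [AddCommGroup V]
    [Module k V] (φ : ∀ i, (M i).obj b c n →ₗ[k] V) (i : ι) (m : (M i).obj b c n) :
    dsumLDesc φ ((dsumι M i).app b c n m) = φ i m := by
  classical
  rw [dsumι_app, dsumLDesc, DFinsupp.lsum_single]

/-- The morphism out of a direct sum given by a family of morphisms. -/
noncomputable def dsumDesc {N : DGBimodule B C} (f : ∀ i, M i ⟶ N) : dsum M ⟶ N where
  app b c n := dsumLDesc fun i => (f i).app b c n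
  app_d {b c} p q h m := by
    refine LinearMap.congr_fun (f := (dsumLDesc fun i => (f i).app b c q) ∘ₗ (dsum M).d p q h)
      (g := N.d p q h ∘ₗ (dsumLDesc fun i => (f i).app b c p)) (dsum_linearMap_ext ?_) m
    intro i m
    simp only [LinearMap.comp_apply]
    rw [← (dsumι M i).app_d, dsumLDesc_ι, dsumLDesc_ι, (f i).app_d]
  app_lact {b b' c} p q n h g m := by
    refine LinearMap.congr_fun
      (f := (dsumLDesc fun i => (f i).app b' c n) ∘ₗ (dsum M).lact p q n h g)
      (g := N.lact p q n h g ∘ₗ (dsumLDesc fun i => (f i).app b c q)) (dsum_linearMap_ext ?_) m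
    intro i m
    simp only [LinearMap.comp_apply]
    rw [← (dsumι M i).app_lact, dsumLDesc_ι, dsumLDesc_ι, (f i).app_lact]
  app_ract {b c c'} p q n h m g := by
    refine LinearMap.congr_fun
      (f := (dsumLDesc fun i => (f i).app b c' n) ∘ₗ ((dsum M).ract p q n h).flip g)
      (g := (N.ract p q n h).flip g ∘ₗ (dsumLDesc fun i => (f i).app b c p))
      (dsum_linearMap_ext ?_) m
    intro i m
    simp only [LinearMap.comp_apply, LinearMap.flip_apply]
    rw [← (dsumι M i).app_ract, dsumLDesc_ι, dsumLDesc_ι, (f i).app_ract]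

theorem dsumι_desc {N : DGBimodule B C} (f : ∀ i, M i ⟶ N) (i : ι) :
    dsumι M i ≫ dsumDesc f = f i :=
  hom_ext_app fun b c n m => dsumLDesc_ι (fun i => (f i).app b c n) i m

theorem dsum_hom_ext {N : DGBimodule B C} {f g : dsum M ⟶ N}
    (h : ∀ i, dsumι M i ≫ f = dsumι M i ≫ g) : f = g := by
  refine hom_ext_app fun _ _ _ => LinearMap.congr_fun (dsum_linearMap_ext fun i m => ?_)
  exact congrArg (fun f : M i ⟶ N => f.app _ _ _ m) (h i)

/-- Elements have finite support, so the primitives of finitely many components add up to a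
primitive. This is exactness of direct sums. -/
theorem dsum_mem_bdry {b : B.Obj} {c : C.Obj} {n : ℤ} {m : (dsum M).obj b c n}
    (h : ∀ i, m i ∈ (M i).bdry b c n) : m ∈ (dsum M).bdry b c n := by
  classical
  rw [dsum_eq_sum M m]
  exact Submodule.sum_mem _ fun i _ => app_mem_bdry _ (h i)

/-- The direct sum of a family of morphisms. -/
noncomputable def dsumMap {N : ι → DGBimodule B C} (f : ∀ i, M i ⟶ N i) : dsum M ⟶ dsum N :=
  dsumDesc fun i => f i ≫ dsumι N i

theorem dsumι_map {N : ι → DGBimodule B C} (f : ∀ i, M i ⟶ N i) (i : ι) :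
    dsumι M i ≫ dsumMap f = f i ≫ dsumι N i := dsumι_desc _ i

theorem dsumMap_π {N : ι → DGBimodule B C} (f : ∀ i, M i ⟶ N i) (i : ι) :
    dsumMap f ≫ dsumπ N i = dsumπ M i ≫ f i := by
  refine dsum_hom_ext fun j => ?_
  rw [← Category.assoc, dsumι_map, Category.assoc, ← Category.assoc (dsumι M j)]
  by_cases h : j = i
  · subst h
    rw [dsumι_π, dsumι_π, Category.comp_id, Category.id_comp]
  · rw [dsumι_π_ne _ h, dsumι_π_ne _ h, Limits.comp_zero, Limits.zero_comp]

theorem IsQuasiIso.dsumMap {N : ι → DGBimodule B C} {f : ∀ i, M i ⟶ N i}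
    (hf : ∀ i, IsQuasiIso (f i)) : IsQuasiIso (dsumMap f) := by
  classical
  have key : ∀ b c n (m : (dsum M).obj b c n) i,
      (DGBimodule.dsumMap f).app b c n m i = (f i).app b c n (m i) := fun b c n m i =>
    congrArg (fun f : dsum M ⟶ N i => f.app b c n m) (dsumMap_π f i)
  rw [isQuasiIso_iff]
  intro b c n
  refine ⟨fun m hm h => dsum_mem_bdry fun i => ?_, fun y hy => ?_⟩
  · refine (isQuasiIso_iff.1 (hf i) b c n).1 _ (app_mem_cyc (dsumπ M i) hm) ?_
    have := app_mem_bdry (dsumπ N i) h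
    rwa [dsumπ_app, key] at this
  · choose m hm hm' using fun i =>
      (isQuasiIso_iff.1 (hf i) b c n).2 (y i) (app_mem_cyc (dsumπ N i) hy)
    refine ⟨∑ i ∈ DFinsupp.support y, (dsumι M i).app b c n (m i),
      Submodule.sum_mem _ fun i _ => app_mem_cyc _ (hm i), ?_⟩
    have e : y - (DGBimodule.dsumMap f).app b c n
          (∑ i ∈ DFinsupp.support y, (dsumι M i).app b c n (m i)) =
        ∑ i ∈ DFinsupp.support y, (dsumι N i).app b c n (y i - (f i).app b c n (m i)) := by
      refine (congrArg (· - _) (dsum_eq_sum N y)).trans ?_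
      rw [map_sum, ← Finset.sum_sub_distrib]
      refine Finset.sum_congr rfl fun i _ => ?_
      rw [map_sub, ← comp_app_apply (dsumι M i), dsumι_map, comp_app_apply]
    rw [e]
    exact Submodule.sum_mem _ fun i _ => app_mem_bdry _ (hm' i)

end DirectSum

/-! ### Morphisms into and out of mapping cones, up to homotopy. -/

section Homotopy

variable {k : Type u} [Field k] {C : DGCategory k} {M N Z : DGModule C}

/-- Transport along an equality of degrees. -/
def degCast (M : DGModule C) (c : C.Obj) {m n : ℤ} (h : m = n) : M.obj ⟨⟩ c m →ₗ[k] M.obj ⟨⟩ c n := by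
  subst h
  exact LinearMap.id

theorem d_degCast (c : C.Obj) {p p' q q' : ℤ} (hp : p = p') (hq : q = q') (h : p + 1 = q)
    (h' : p' + 1 = q') (x : M.obj ⟨⟩ c p) :
    M.d p' q' h' (degCast M c hp x) = degCast M c hq (M.d p q h x) := by
  subst hp
  subst hq
  rfl

theorem ract_degCast (c c' : C.Obj) {p p' n n' q : ℤ} (hp : p = p') (hn : n = n') (h : p + q = n)
    (h' : p' + q = n') (x : M.obj ⟨⟩ c p) (f : C.Hom c' c q) :
    M.ract p' q n' h' (degCast M c hp x) f = degCast M c' hn (M.ract p q n h x f) := by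
  subst hp
  subst hn
  rfl

theorem app_degCast (f : M ⟶ N) (c : C.Obj) {p p' : ℤ} (hp : p = p') (x : M.obj ⟨⟩ c p) :
    f.app ⟨⟩ c p' (degCast M c hp x) = degCast N c hp (f.app ⟨⟩ c p x) := by
  subst hp
  rfl

theorem degCast_degCast (c : C.Obj) {p q r : ℤ} (h : p = q) (h' : q = r) (x : M.obj ⟨⟩ c p) :
    degCast M c h' (degCast M c h x) = degCast M c (h.trans h') x := by
  subst h
  subst h'
  rfl

/-- The boundary `d h + h d` of a map of degree `-1`. -/
def Pre.boundary (h : Pre M N) : M ⟶ N :=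
  homMk
    (fun c n => N.d (n - 1) n (by omega) ∘ₗ h.app c n (n - 1) (by omega) +
      h.app c (n + 1) n rfl ∘ₗ M.d n (n + 1) rfl)
    (by
      intro c p q e m
      obtain rfl : q - 1 = p := by omega
      simp only [LinearMap.add_apply, LinearMap.comp_apply, map_add]
      rw [M.d_d, map_zero, add_zero, N.d_d, zero_add]
      -- The same degree appears as `q` on one side and as `q - 1 + 1` on the other. Replacing it by
      -- a variable `r` makes the substitution possible.
      have key : ∀ (r : ℤ) (hr : r = q) (h1 : q - 1 + 1 = r),
          N.d (q - 1) q e (h.app c q (q - 1) e (M.d (q - 1) q e m)) =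
            N.d (q - 1) q e (h.app c r (q - 1) h1 (M.d (q - 1) r h1 m)) := by
        intro r hr h1
        subst hr
        rfl
      exact key _ e rfl)
    (by
      intro c c' p q n e m f
      have e1 := h.app_ract p q n (p - 1) (n - 1) e (by omega) (by omega) m f
      have e2 := h.app_ract (p + 1) q (n + 1) p n (by omega) rfl rfl (M.d p (p + 1) rfl m) f
      have e3 := h.app_ract p (q + 1) (n + 1) (p - 1) n (by omega) (by omega) (by omega) m
        (C.d q (q + 1) rfl f)
      have e4 : koszulSign k p = -koszulSign k (p - 1) := by
        rw [← koszulSign_succ, sub_add_cancel]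
      simp only [LinearMap.add_apply, LinearMap.comp_apply, map_add]
      rw [e1, N.d_ract (p - 1) q (n - 1) p (q + 1) n (by omega) (by omega) rfl (by omega),
        M.d_ract p q n (p + 1) (q + 1) (n + 1) e rfl rfl rfl, map_add, map_smul, e2, e3, e4]
      module)

theorem Pre.isBoundary_boundary (h : Pre M N) : h.IsBoundary h.boundary := by
  intro c p q r hq hr m
  subst hr
  obtain rfl : q = p - 1 := by omega
  rfl

theorem Pre.null_boundary (h : Pre M N) : Null h.boundary := ⟨h, h.isBoundary_boundary⟩

theorem Pre.boundary_app (h : Pre M N) (c : C.Obj) (p q r : ℤ) (hq : q + 1 = p) (hr : p + 1 = r)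
    (m : M.obj ⟨⟩ c p) : h.boundary.app ⟨⟩ c p m =
      N.d q p hq (h.app c p q hq m) + h.app c r p hr (M.d p r hr m) :=
  h.isBoundary_boundary c p q r hq hr m

/-- The projection of the mapping cone to the shifted source. -/
def coneFst (f : M ⟶ N) : cone f ⟶ M.shift 1 :=
  homMk (fun c n => LinearMap.fst k _ _)
    (by
      intro c p q h m
      subst h
      change -_ = (koszulSign k 1 • M.d (p + 1) (p + 1 + 1) _) m.1
      have : koszulSign k 1 = -1 := by simp [koszulSign]
      rw [this, LinearMap.smul_apply, neg_smul, one_smul]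
      rfl)
    (by intros; rfl)

theorem shift_one_d (M : DGModule C) (c : C.Obj) (p q : ℤ) (h : p + 1 = q)
    (m : (M.shift 1).obj ⟨⟩ c p) :
    (M.shift 1).d p q h m = -M.d (p + 1) (q + 1) (by omega) m := by
  change (koszulSign k 1 • M.d (p + 1) (q + 1) _) m = _
  have : koszulSign k 1 = -1 := by simp [koszulSign]
  rw [this, LinearMap.smul_apply, neg_smul, one_smul]

/-- The morphism `(m, y) ↦ φ y + θ m` out of a mapping cone. -/
def coneDesc (f : M ⟶ N) (φ : N ⟶ Z) (θ : ∀ c n, M.obj ⟨⟩ c (n + 1) →ₗ[k] Z.obj ⟨⟩ c n)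
    (hd : ∀ c n (m : M.obj ⟨⟩ c (n + 1)), φ.app ⟨⟩ c (n + 1) (f.app ⟨⟩ c (n + 1) m) =
      Z.d n (n + 1) rfl (θ c n m) + θ c (n + 1) (M.d (n + 1) (n + 1 + 1) rfl m))
    (hr : ∀ c c' p q n (h : p + q = n) (m : M.obj ⟨⟩ c (p + 1)) (a : C.Hom c' c q),
      θ c' n (M.ract (p + 1) q (n + 1) (by omega) m a) = Z.ract p q n h (θ c p m) a) :
    cone f ⟶ Z :=
  homMk (fun c n => (φ.app ⟨⟩ c n).coprod (θ c n) ∘ₗ (LinearEquiv.prodComm k _ _).toLinearMap)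
    (by
      intro c p q h m
      subst h
      change φ.app _ c _ (f.app _ c _ m.1 + N.d p (p + 1) rfl m.2) +
          θ c (p + 1) (-M.d (p + 1) (p + 1 + 1) rfl m.1) =
        Z.d p (p + 1) rfl (φ.app _ c p m.2 + θ c p m.1)
      rw [map_add, hd, φ.app_d, map_neg, map_add]
      abel)
    (by
      intro c c' p q n h m a
      change φ.app _ c' n (N.ract p q n h m.2 a) +
          θ c' n (M.ract (p + 1) q (n + 1) _ m.1 a) =
        Z.ract p q n h (φ.app _ c p m.2 + θ c p m.1) a
      rw [φ.app_ract, hr c c' p q n h, map_add, LinearMap.add_apply])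

theorem coneInr_coneDesc (f : M ⟶ N) (φ : N ⟶ Z) (θ) (hd) (hr) :
    coneInr f ≫ coneDesc (Z := Z) f φ θ hd hr = φ := by
  refine hom_ext_app fun b c n m => ?_
  change φ.app _ c n m + θ c n 0 = _
  rw [map_zero, add_zero]

/-- The cone is a weak cokernel: a null-homotopy of `f ≫ φ` is exactly the missing component on
`M[1]`. -/
theorem exists_coneDesc (f : M ⟶ N) (φ : N ⟶ Z) (h : Null (f ≫ φ)) :
    ∃ ψ : cone f ⟶ Z, coneInr f ≫ ψ = φ := by
  obtain ⟨h, hh⟩ := h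
  refine ⟨coneDesc f φ (fun c n => h.app c (n + 1) n rfl) ?_ ?_, coneInr_coneDesc _ _ _ _ _⟩
  · intro c n m
    exact hh c (n + 1) n (n + 1 + 1) rfl rfl m
  · intro c c' p q n e m a
    exact h.app_ract (p + 1) q (n + 1) p n (by omega) rfl rfl m a

/-- The morphism `x ↦ (a x, θ x)` from a shift into a mapping cone. -/
def coneLift (f : M ⟶ N) (a : Z ⟶ M) (θ : ∀ c n, Z.obj ⟨⟩ c (n + 1) →ₗ[k] N.obj ⟨⟩ c n)
    (hd : ∀ c n (z : Z.obj ⟨⟩ c (n + 1)), f.app ⟨⟩ c (n + 1) (a.app ⟨⟩ c (n + 1) z) =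
      -N.d n (n + 1) rfl (θ c n z) - θ c (n + 1) (Z.d (n + 1) (n + 1 + 1) rfl z))
    (hr : ∀ c c' p q n (h : p + q = n) (z : Z.obj ⟨⟩ c (p + 1)) (g : C.Hom c' c q),
      θ c' n (Z.ract (p + 1) q (n + 1) (by omega) z g) = N.ract p q n h (θ c p z) g) :
    Z.shift 1 ⟶ cone f :=
  homMk (fun c n => (a.app ⟨⟩ c (n + 1)).prod (θ c n))
    (by
      intro c p q h z
      subst h
      rw [shift_one_d]
      change (_, _) = (_, _)
      refine Prod.ext ?_ ?_
      · change a.app _ c _ (-_) = -M.d _ _ _ (a.app _ c _ z)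
        rw [map_neg, a.app_d]
      · change θ c _ (-_) = f.app _ c _ (a.app _ c _ z) + N.d _ _ _ (θ c p z)
        rw [hd, map_neg]
        abel)
    (by
      intro c c' p q n h z g
      refine Prod.ext ?_ ?_
      · exact a.app_ract _ _ _ _ _ _
      · exact hr c c' p q n h z g)

/-- A morphism out of a mapping cone that vanishes on the target up to homotopy factors through
the shifted source. -/
theorem exists_coneFst_comp (f : M ⟶ N) (F : cone f ⟶ Z) (h : Null (coneInr f ≫ F)) :
    ∃ g : M.shift 1 ⟶ Z, (Q C).map F = (Q C).map (coneFst f ≫ g) := by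
  obtain ⟨h, hh⟩ := h
  -- The null-homotopy on `N` is extended by zero to the cone. After its boundary is subtracted, `F`
  -- vanishes strictly on `N`, and its restriction to `M[1]` becomes a chain map.
  let H : Pre (cone f) Z :=
    ⟨fun c p q e => h.app c p q e ∘ₗ LinearMap.snd k _ _, by
      intro c c' p q n p' n' e hp hn m a
      exact h.app_ract p q n p' n' e hp hn m.2 a⟩
  have hF : ∀ c n (y : N.obj ⟨⟩ c n), (F - H.boundary).app ⟨⟩ c n (0, y) = 0 := by
    intro c n y
    have e1 := hh c n (n - 1) (n + 1) (by omega) rfl y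
    rw [comp_app_apply, coneInr_app] at e1
    rw [sub_app_apply, H.boundary_app c n (n - 1) (n + 1) (by omega) rfl, e1, sub_eq_zero]
    congr 1
    change _ = h.app c (n + 1) n rfl (f.app _ c _ 0 + N.d n (n + 1) rfl y)
    rw [map_zero, zero_add]
  refine ⟨homMk (fun c n => (F - H.boundary).app ⟨⟩ c n ∘ₗ LinearMap.inl k _ _) ?_ ?_, ?_⟩
  · intro c p q e m
    subst e
    rw [shift_one_d]
    have e1 := (F - H.boundary).app_d p (p + 1) rfl ((m, 0) : M.obj ⟨⟩ c (p + 1) × N.obj ⟨⟩ c p)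
    refine Eq.trans ?_ e1
    have e2 := hF c (p + 1) (f.app _ c (p + 1) m)
    rw [LinearMap.comp_apply]
    refine (add_zero _).symm.trans ((congrArg (_ + ·) e2.symm).trans ?_)
    refine (map_add ((F - H.boundary).app _ c (p + 1)) _ _).symm.trans ?_
    congr 1
    refine Prod.ext ?_ ?_
    · exact add_zero _
    · change 0 + f.app _ c (p + 1) m = f.app _ c (p + 1) m + N.d _ _ _ 0
      rw [map_zero, zero_add, add_zero]
  · intro c c' p q n e m a
    refine Eq.trans ?_ ((F - H.boundary).app_ract p q n e
      ((m, 0) : M.obj ⟨⟩ c (p + 1) × N.obj ⟨⟩ c p) a)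
    change Hom.app (F - H.boundary) _ _ _ _ = _
    congr 1
    refine Prod.ext rfl ?_
    change 0 = N.ract p q n e 0 a
    rw [map_zero, LinearMap.zero_apply]
  · rw [Q_map_eq_iff]
    convert H.null_boundary using 1
    rw [sub_eq_iff_eq_add', ← sub_eq_iff_eq_add]
    refine hom_ext_app fun b c n x => ?_
    change (F - H.boundary).app ⟨⟩ c n x = (F - H.boundary).app ⟨⟩ c n (x.1, 0)
    have e2 := hF c n x.2
    rw [← add_zero ((F - H.boundary).app ⟨⟩ c n (x.1, 0)), ← e2, ← map_add]
    congr 1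
    exact Prod.ext (add_zero _).symm (zero_add _).symm

/-- A morphism into a mapping cone can be corrected by a homotopy so that its projection to the
shifted source becomes a given morphism in the same homotopy class. -/
theorem exists_comp_coneFst_eq (f : M ⟶ N) (F : Z ⟶ cone f) (u : Z ⟶ M.shift 1)
    (h : (Q C).map (F ≫ coneFst f) = (Q C).map u) :
    ∃ F' : Z ⟶ cone f, (Q C).map F' = (Q C).map F ∧ F' ≫ coneFst f = u := by
  rw [Q_map_eq_iff] at h
  obtain ⟨h, hh⟩ := h
  -- The homotopy is placed in the `M[1]` summand, so the boundary of `H` projects exactly to the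
  -- difference that has to be removed.
  let H : Pre Z (cone f) :=
    ⟨fun c p q e => LinearMap.inl k _ _ ∘ₗ h.app c p q e, by
      intro c c' p q n p' n' e hp hn m a
      refine Prod.ext (h.app_ract p q n p' n' e hp hn m a) ?_
      change 0 = N.ract _ _ _ _ 0 a
      rw [map_zero, LinearMap.zero_apply]⟩
  refine ⟨F - H.boundary, ?_, ?_⟩
  · rw [Q_map_eq_iff, sub_sub_cancel_left]
    exact H.null_boundary.neg
  · rw [Preadditive.sub_comp, sub_eq_iff_eq_add, ← sub_eq_iff_eq_add']
    refine hom_ext_app fun b c n x => ?_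
    have e1 := hh c n (n - 1) (n + 1) (by omega) rfl x
    refine e1.trans ?_
    rw [comp_app_apply, H.boundary_app c n (n - 1) (n + 1) (by omega) rfl, map_add]
    congr 1
    rw [(coneFst f).app_d]
    rfl

/-- A null-homotopy of `F ≫ coneInr s` has two components. The one in `M[1]` raises the degree back
to zero and is a chain map, which gives the lift `G`. The one in `N` is a homotopy between `F` and
`G ≫ s`. -/
theorem exists_comp_eq_of_null_coneInr (s : M ⟶ N) (F : Z ⟶ N) (h : Null (F ≫ coneInr s)) :
    ∃ G : Z ⟶ M, (Q C).map (G ≫ s) = (Q C).map F := by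
  obtain ⟨h, hh⟩ := h
  have key : ∀ c p q r (hq : q + 1 = p) (hr : p + 1 = r) (z : Z.obj ⟨⟩ c p),
      M.d (q + 1) (p + 1) (by omega) (h.app c p q hq z).1 =
        (h.app c r p hr (Z.d p r hr z)).1 ∧
      F.app ⟨⟩ c p z = degCast N c hq (s.app ⟨⟩ c (q + 1) (h.app c p q hq z).1) +
        N.d q p hq (h.app c p q hq z).2 + (h.app c r p hr (Z.d p r hr z)).2 := by
    intro c p q r hq hr z
    subst hq
    have e := hh c (q + 1) q r rfl hr z
    constructor
    · have e1 : (0 : M.obj ⟨⟩ c (q + 1 + 1)) =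
          -M.d (q + 1) (q + 1 + 1) rfl (h.app c (q + 1) q rfl z).1 +
          (h.app c r (q + 1) hr (Z.d (q + 1) r hr z)).1 := congrArg Prod.fst e
      exact (neg_add_eq_zero.1 e1.symm)
    · exact congrArg Prod.snd e
  let G : Z ⟶ M := homMk
    (fun c n => degCast M c (by omega) ∘ₗ LinearMap.fst k _ _ ∘ₗ h.app c n (n - 1) (by omega))
    (by
      intro c p q e z
      simp only [LinearMap.comp_apply, LinearMap.fst_apply]
      obtain rfl : p = q - 1 := by omega
      rw [d_degCast c (by omega : q - 1 - 1 + 1 = q - 1) e (by omega) (by omega),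
        (key c (q - 1) (q - 1 - 1) q (by omega) (by omega) z).1])
    (by
      intro c c' p q n e z a
      simp only [LinearMap.comp_apply, LinearMap.fst_apply]
      rw [ract_degCast c c' (by omega : p - 1 + 1 = p) (by omega : n - 1 + 1 = n) (by omega)]
      congr 1
      exact congrArg Prod.fst
        (h.app_ract p q n (p - 1) (n - 1) e (by omega) (by omega) z a))
  let H : Pre Z N :=
    ⟨fun c p q e => LinearMap.snd k _ _ ∘ₗ h.app c p q e, by
      intro c c' p q n p' n' e hp hn z a
      exact congrArg Prod.snd (h.app_ract p q n p' n' e hp hn z a)⟩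
  refine ⟨G, ?_⟩
  rw [eq_comm, Q_map_eq_iff]
  refine ⟨H, ?_⟩
  intro c p q r hq hr z
  rw [sub_app_apply, (key c p q r hq hr z).2, comp_app_apply, ← app_degCast]
  obtain rfl : q = p - 1 := by omega
  rw [add_assoc]
  exact add_sub_cancel_left _ _

end Homotopy

/-! ### Shifts as autoequivalences of the homotopy category. -/

section Shift

variable {k : Type u} [Field k] {C : DGCategory k} {M N : DGModule C}

theorem mem_cyc_shift (i : ℤ) (c : C.Obj) (n : ℤ) (m : M.obj ⟨⟩ c (n + i)) :
    (m : (M.shift i).obj ⟨⟩ c n) ∈ (M.shift i).cyc ⟨⟩ c n ↔ m ∈ M.cyc ⟨⟩ c (n + i) := by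
  rw [mem_cyc (n + 1) rfl, mem_cyc (n + 1 + i) (by omega)]
  change koszulSign k i • M.d (n + i) (n + 1 + i) _ m = 0 ↔ _
  constructor
  · intro h
    rw [← one_smul k (M.d _ _ _ m), ← koszulSign_mul_self k i, mul_smul, h, smul_zero]
  · intro h
    rw [h, smul_zero]

theorem mem_bdry_shift (i : ℤ) (c : C.Obj) (n : ℤ) (m : M.obj ⟨⟩ c (n + i)) :
    (m : (M.shift i).obj ⟨⟩ c n) ∈ (M.shift i).bdry ⟨⟩ c n ↔ m ∈ M.bdry ⟨⟩ c (n + i) := by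
  rw [mem_bdry (n - 1) (by omega), mem_bdry (n - 1 + i) (by omega)]
  constructor
  · rintro ⟨x, hx⟩
    exact ⟨koszulSign k i • x, (map_smul _ _ _).trans hx⟩
  · rintro ⟨x, hx⟩
    refine ⟨koszulSign k i • x, ?_⟩
    change koszulSign k i • M.d (n - 1 + i) (n + i) _ (koszulSign k i • x) = m
    rw [map_smul, smul_smul, koszulSign_mul_self, one_smul, hx]

/-- The shift of a morphism. -/
def shiftMap (i : ℤ) (f : M ⟶ N) : M.shift i ⟶ N.shift i :=
  homMk (fun c n => f.app ⟨⟩ c (n + i))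
    (by
      intro c p q h m
      change f.app _ c _ (koszulSign k i • M.d (p + i) (q + i) _ m) =
        koszulSign k i • N.d (p + i) (q + i) _ (f.app _ c _ m)
      rw [map_smul, f.app_d])
    (by
      intro c c' p q n h m a
      exact f.app_ract _ _ _ _ _ _)

theorem Null.shiftMap {f : M ⟶ N} (hf : Null f) (i : ℤ) : Null (shiftMap i f) := by
  obtain ⟨h, hh⟩ := hf
  refine ⟨⟨fun c p q e => koszulSign k i • h.app c (p + i) (q + i) (by omega), ?_⟩, ?_⟩
  · intro c c' p q n p' n' e hp hn m a
    have := h.app_ract (p + i) q (n + i) (p' + i) (n' + i) (by omega) (by omega) (by omega) m a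
    change koszulSign k i • h.app c' _ _ _ (M.ract (p + i) q (n + i) _ m a) =
      N.ract (p' + i) q (n' + i) _ (koszulSign k i • h.app c (p + i) (p' + i) _ m) a
    rw [this, map_smul, LinearMap.smul_apply]
  · intro c p q r hq hr m
    have := hh c (p + i) (q + i) (r + i) (by omega) (by omega) m
    change f.app _ c (p + i) m =
      koszulSign k i • N.d (q + i) (p + i) _ (koszulSign k i • h.app c (p + i) (q + i) _ m) +
      koszulSign k i • h.app c (r + i) (p + i) _ (koszulSign k i • M.d (p + i) (r + i) _ m)
    rw [map_smul, map_smul, smul_smul, smul_smul, koszulSign_mul_self, one_smul, one_smul, this]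

theorem IsQuasiIso.shiftMap {f : M ⟶ N} (hf : IsQuasiIso f) (i : ℤ) :
    IsQuasiIso (shiftMap i f) := by
  rw [isQuasiIso_iff] at *
  intro b c n
  constructor
  · intro m hm h
    exact (mem_bdry_shift i c n _).2 ((hf b c (n + i)).1 _ ((mem_cyc_shift i c n _).1 hm)
      ((mem_bdry_shift i c n _).1 h))
  · intro y hy
    obtain ⟨m, hm, h⟩ := (hf b c (n + i)).2 y ((mem_cyc_shift i c n _).1 hy)
    exact ⟨m, (mem_cyc_shift i c n _).2 hm, (mem_bdry_shift i c n _).2 h⟩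

theorem IsAcyclic.shift (hM : M.IsAcyclic) (i : ℤ) : (M.shift i).IsAcyclic := by
  rw [isAcyclic_iff] at *
  intro b c n m hm
  exact (mem_bdry_shift i c n _).2 (hM b c _ _ ((mem_cyc_shift i c n _).1 hm))

/-- Shifting by `i` and then by `j = -i` changes nothing. -/
def shiftShiftIso (M : DGModule C) (i j : ℤ) (h : i + j = 0) : (M.shift i).shift j ≅ M where
  hom := homMk (fun c n => degCast M c (by omega : n + j + i = n))
    (by
      intro c p q e m
      rw [d_degCast c (by omega : p + j + i = p) (by omega : q + j + i = q) (by omega)]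
      change degCast M c _ (koszulSign k j • koszulSign k i • M.d _ _ _ m) = _
      rw [smul_smul, ← koszulSign_add, add_comm j i, h, koszulSign_zero, one_smul])
    (by
      intro c c' p q n e m a
      rw [ract_degCast c c' (by omega : p + j + i = p) (by omega : n + j + i = n) (by omega)])
  inv := homMk (fun c n => degCast M c (by omega : n = n + j + i))
    (by
      intro c p q e m
      change _ = koszulSign k j • koszulSign k i • M.d (p + j + i) (q + j + i) _ _
      rw [smul_smul, ← koszulSign_add, add_comm j i, h, koszulSign_zero, one_smul,
        d_degCast c (by omega : p = p + j + i) (by omega : q = q + j + i) e])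
    (by
      intro c c' p q n e m a
      exact (ract_degCast c c' (by omega : p = p + j + i) (by omega) _ (by omega) _ _).symm)
  hom_inv_id := hom_ext_app fun b c n m => degCast_degCast c _ _ _
  inv_hom_id := hom_ext_app fun b c n m => degCast_degCast c _ _ _

/-- The shift functor on right dg modules. -/
def shiftFunctor (C : DGCategory k) (i : ℤ) : DGModule C ⥤ DGModule C where
  obj M := M.shift i
  map f := shiftMap i f

/-- The shift functor on the homotopy category. -/
def Ho.shift (C : DGCategory k) (i : ℤ) : Ho C ⥤ Ho C :=
  CategoryTheory.Quotient.lift (htpy C) (shiftFunctor C i ⋙ Q C) (by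
    intro M N f g h
    exact (Q_map_eq_iff _ _).2 (Null.shiftMap h i))

/-- Opposite shifts are inverse to each other. -/
def Ho.shiftShiftIso (C : DGCategory k) (i j : ℤ) (h : i + j = 0) :
    Ho.shift C i ⋙ Ho.shift C j ≅ 𝟭 (Ho C) :=
  CategoryTheory.Quotient.natIsoLift (htpy C)
    (NatIso.ofComponents (F := Q C ⋙ Ho.shift C i ⋙ Ho.shift C j) (G := Q C ⋙ 𝟭 (Ho C))
      (fun M => (Q C).mapIso (DGBimodule.shiftShiftIso M i j h)) (by
        intro M N f
        change (Q C).map _ ≫ (Q C).map _ = (Q C).map _ ≫ (Q C).map _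
        rw [← Functor.map_comp, ← Functor.map_comp]
        congr 1
        refine hom_ext_app fun b c n m => ?_
        exact (app_degCast f c _ _).symm))

/-- Fullness and faithfulness of this functor are what is used: they move homotopy classes of
morphisms between shifts back to the modules themselves. -/
instance (i : ℤ) : (Ho.shift C i).IsEquivalence :=
  (CategoryTheory.Equivalence.mk (Ho.shift C i) (Ho.shift C (-i))
    (Ho.shiftShiftIso C i (-i) (by omega)).symm
    (Ho.shiftShiftIso C (-i) i (by omega))).isEquivalence_functor

theorem exists_Q_map_shiftMap_eq (i : ℤ) (f : (Q C).obj (M.shift i) ⟶ (Q C).obj (N.shift i)) :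
    ∃ g : M ⟶ N, (Q C).map (shiftMap i g) = f := by
  obtain ⟨g, hg⟩ := (Ho.shift C i).map_surjective (X := (Q C).obj M) (Y := (Q C).obj N) f
  obtain ⟨g, rfl⟩ := (Q C).map_surjective g
  exact ⟨g, hg⟩

theorem Q_map_shiftMap_eq_iff (i : ℤ) (f g : M ⟶ N) :
    (Q C).map (shiftMap i f) = (Q C).map (shiftMap i g) ↔ (Q C).map f = (Q C).map g :=
  ⟨fun h => (Ho.shift C i).map_injective h, fun h => congrArg (Ho.shift C i).map h⟩

theorem shiftMap_comp {L : DGModule C} (i : ℤ) (f : M ⟶ N) (g : N ⟶ L) :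
    DGBimodule.shiftMap i (f ≫ g) = DGBimodule.shiftMap i f ≫ DGBimodule.shiftMap i g := rfl

end Shift

/-! ### Functoriality of mapping cones for squares that commute up to homotopy. -/

section ConeMap

variable {k : Type u} [Field k] {C : DGCategory k} {M N M' N' : DGModule C}

/-- The morphism of mapping cones given by a square that commutes up to the homotopy `θ`. -/
def coneMap (f : M ⟶ N) (f' : M' ⟶ N') (a : M ⟶ M') (b : N ⟶ N')
    (θ : ∀ c n, M.obj ⟨⟩ c (n + 1) →ₗ[k] N'.obj ⟨⟩ c n)
    (hd : ∀ c n (m : M.obj ⟨⟩ c (n + 1)), b.app ⟨⟩ c (n + 1) (f.app ⟨⟩ c (n + 1) m) =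
      f'.app ⟨⟩ c (n + 1) (a.app ⟨⟩ c (n + 1) m) +
      (N'.d n (n + 1) rfl (θ c n m) + θ c (n + 1) (M.d (n + 1) (n + 1 + 1) rfl m)))
    (hr : ∀ c c' p q n (h : p + q = n) (m : M.obj ⟨⟩ c (p + 1)) (g : C.Hom c' c q),
      θ c' n (M.ract (p + 1) q (n + 1) (by omega) m g) = N'.ract p q n h (θ c p m) g) :
    cone f ⟶ cone f' :=
  coneDesc f (b ≫ coneInr f') (fun c n => (a.app ⟨⟩ c (n + 1)).prod (θ c n))
    (by
      intro c n m
      change ((0 : M'.obj ⟨⟩ c (n + 1 + 1)), b.app _ c _ (f.app _ c _ m)) =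
        (-M'.d _ _ _ (a.app _ c _ m) + a.app _ c _ (M.d _ _ _ m),
          f'.app _ c _ (a.app _ c _ m) + N'.d _ _ _ (θ c n m) + θ c _ (M.d _ _ _ m))
      rw [a.app_d, neg_add_cancel, hd]
      exact congrArg (Prod.mk 0) (add_assoc _ _ _).symm)
    (by
      intro c c' p q n h m g
      exact Prod.ext (a.app_ract _ _ _ _ _ _) (hr c c' p q n h m g))

theorem coneMap_app (f : M ⟶ N) (f' : M' ⟶ N') (a : M ⟶ M') (b : N ⟶ N') (θ) (hd) (hr)
    (c : C.Obj) (n : ℤ) (x : (cone f).obj ⟨⟩ c n) :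
    (coneMap f f' a b θ hd hr).app ⟨⟩ c n x =
      (a.app ⟨⟩ c (n + 1) x.1, b.app ⟨⟩ c n x.2 + θ c n x.1) :=
  Prod.ext (zero_add _) rfl

/-- This is the five lemma for the two long exact sequences, done as a chase because the square
commutes only up to `θ`. On cocycles, `hd'` reduces the homotopy to a boundary. -/
theorem isQuasiIso_coneMap {f : M ⟶ N} {f' : M' ⟶ N'} {a : M ⟶ M'} {b : N ⟶ N'} {θ} {hd} {hr}
    (ha : IsQuasiIso a) (hb : IsQuasiIso b) : IsQuasiIso (coneMap f f' a b θ hd hr) := by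
  rw [isQuasiIso_iff] at *
  have hd' : ∀ c n (m : M.obj ⟨⟩ c (n + 1)), m ∈ M.cyc ⟨⟩ c (n + 1) →
      b.app ⟨⟩ c (n + 1) (f.app ⟨⟩ c (n + 1) m) -
        f'.app ⟨⟩ c (n + 1) (a.app ⟨⟩ c (n + 1) m) = N'.d n (n + 1) rfl (θ c n m) := by
    intro c n m hm
    rw [hd, (mem_cyc _ rfl).1 hm, map_zero, add_zero, add_sub_cancel_left]
  intro o c n
  obtain ⟨p, rfl⟩ : ∃ p, n = p + 1 := ⟨n - 1, by omega⟩
  constructor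
  · rintro ⟨x, y⟩ hm h
    rw [coneMap_app, mem_bdry_cone p rfl] at h
    obtain ⟨hx, hxy⟩ := mem_cyc_cone.1 hm
    obtain ⟨u, v, hu, hv⟩ := h
    dsimp only at hx hxy hu hv
    have h1 : a.app _ c (p + 1 + 1) x ∈ M'.bdry _ c (p + 1 + 1) := by
      rw [← neg_neg (a.app _ _ _ x), ← hu]
      exact neg_mem (d_mem_bdry _ _ _)
    obtain ⟨x', hx'⟩ := (mem_bdry (p + 1) rfl).1 ((ha ⟨⟩ c _).1 x hx h1)
    have hcyc : y + f.app _ c (p + 1) x' ∈ N.cyc ⟨⟩ c (p + 1) := by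
      rw [mem_cyc (p + 1 + 1) rfl, map_add, ← f.app_d _ _ rfl, hx', ← hxy]
      exact add_comm _ _
    have hu' : u + a.app _ c _ x' ∈ M'.cyc ⟨⟩ c (p + 1) := by
      rw [mem_cyc (p + 1 + 1) rfl, map_add, ← a.app_d _ _ rfl, hx', hu, neg_add_cancel]
    obtain ⟨x'', hx'', hxb⟩ := (ha ⟨⟩ c _).2 _ hu'
    -- Here `x'` is a primitive of `x`, and `x''` lifts the class of the cocycle `u + a x'`. The
    -- corrected `y` is a cocycle that becomes a boundary under `b`, so it is already a boundary.
    have h2 : y + f.app _ c (p + 1) x' - f.app _ c (p + 1) x'' ∈ N.bdry ⟨⟩ c (p + 1) := by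
      refine (hb ⟨⟩ c _).1 _ (sub_mem hcyc (app_mem_cyc f hx'')) ?_
      have e1 := hd c p x'
      have e2 := hd' c p x'' hx''
      rw [hx'] at e1
      have e3 : b.app _ c _ (y + f.app _ c (p + 1) x' - f.app _ c (p + 1) x'') =
          f'.app _ c _ (u + a.app _ c _ x' - a.app _ c _ x'') + N'.d p (p + 1) rfl v +
            N'.d p (p + 1) rfl (θ c p x' - θ c p x'') := by
        have e4 : b.app _ c _ y = f'.app _ c _ u + N'.d p (p + 1) rfl v - θ c (p + 1) x := by
          rw [hv, add_sub_cancel_right]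
        rw [sub_eq_iff_eq_add] at e2
        simp only [map_add, map_sub, e1, e2, e4]
        abel
      rw [e3]
      exact add_mem (add_mem (app_mem_bdry f' hxb) (d_mem_bdry _ _ _)) (d_mem_bdry _ _ _)
    obtain ⟨y'', hy''⟩ := (mem_bdry p rfl).1 h2
    refine (mem_bdry_cone p rfl).2 ⟨x'' - x', y'', ?_, ?_⟩
    · rw [map_sub, hx', (mem_cyc _ rfl).1 hx'', zero_sub]
    · rw [hy'', map_sub]
      change _ = y
      abel
  · rintro ⟨x, y⟩ hm
    obtain ⟨hx, hxy⟩ := mem_cyc_cone.1 hm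
    dsimp only at hx hxy
    obtain ⟨m, hm, hmb⟩ := (ha ⟨⟩ c _).2 x hx
    obtain ⟨u, hu⟩ := (mem_bdry (p + 1) rfl).1 hmb
    have hfm : f.app _ c _ m ∈ N.bdry ⟨⟩ c (p + 1 + 1) := by
      refine (hb ⟨⟩ c _).1 _ (app_mem_cyc f hm) ?_
      have e := hd' c (p + 1) m hm
      rw [sub_eq_iff_eq_add] at e
      rw [e]
      refine add_mem (d_mem_bdry _ _ _) ?_
      have e2 : f'.app _ c _ (a.app _ c _ m) = -N'.d (p + 1) _ rfl y -
          N'.d (p + 1) _ rfl (f'.app _ c _ u) := by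
        rw [← f'.app_d, hu, map_sub, eq_neg_of_add_eq_zero_left hxy, sub_sub_cancel]
      rw [e2]
      exact sub_mem (neg_mem (d_mem_bdry _ _ _)) (d_mem_bdry _ _ _)
    obtain ⟨v, hv⟩ := (mem_bdry (p + 1) rfl).1 hfm
    -- The pair `(m, -v)` is a first approximation to a lift of `(x, y)`. Modulo the boundary of
    -- `(u, 0)`, its defect is this cocycle of `N'`, and a lift `w` of its class along `b` gives the
    -- corrected lift `(m, w - v)`.
    have hz : y + f'.app _ c _ u + b.app _ c _ v - θ c (p + 1) m ∈ N'.cyc ⟨⟩ c (p + 1) := by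
      rw [mem_cyc (p + 1 + 1) rfl]
      have e := hd' c (p + 1) m hm
      have e1 := (b.app_d (b := ⟨⟩) (c := c) _ _ rfl v)
      have e2 := (f'.app_d (b := ⟨⟩) (c := c) _ _ rfl u)
      simp only [map_add, map_sub]
      rw [← e, ← e1, ← e2, hv, hu, map_sub, eq_neg_of_add_eq_zero_left hxy]
      abel
    obtain ⟨w, hw, hwb⟩ := (hb ⟨⟩ c _).2 _ hz
    obtain ⟨z, hz⟩ := (mem_bdry p rfl).1 hwb
    refine ⟨(m, w - v), mem_cyc_cone.2 ⟨hm, ?_⟩, ?_⟩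
    · dsimp only
      rw [map_sub, (mem_cyc _ rfl).1 hw, hv, zero_sub, add_neg_cancel]
    · rw [coneMap_app]
      refine (mem_bdry_cone p rfl).2 ⟨-u, z, ?_, ?_⟩
      · rw [map_neg, hu]
        rfl
      · rw [hz, map_neg]
        change _ = y - (b.app _ c _ (w - v) + θ c _ m)
        rw [map_sub]
        abel

theorem exists_coneMap {f : M ⟶ N} {f' : M' ⟶ N'} {a : M ⟶ M'} {b : N ⟶ N'}
    (h : (Q C).map (f ≫ b) = (Q C).map (a ≫ f')) (ha : IsQuasiIso a) (hb : IsQuasiIso b) :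
    ∃ ψ : cone f ⟶ cone f', IsQuasiIso ψ := by
  rw [Q_map_eq_iff] at h
  obtain ⟨h, hh⟩ := h
  refine ⟨coneMap f f' a b (fun c n => h.app c (n + 1) n rfl) ?_ ?_, isQuasiIso_coneMap ha hb⟩
  · intro c n m
    have := hh c (n + 1) n (n + 1 + 1) rfl rfl m
    rw [← this]
    exact (add_sub_cancel _ _).symm
  · intro c c' p q n e m g
    exact h.app_ract (p + 1) q (n + 1) p n (by omega) rfl rfl m g

/-- A null-homotopy of `g ≫ s` is, up to sign, the second component of a lift of `g[1]` to the cone.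
When `s` is a quasi-isomorphism, `g[1]` thereby factors through an acyclic module; this gives
uniqueness of lifts. -/
theorem exists_comp_coneFst_eq_shiftMap {Z : DGModule C} (s : M ⟶ N) (g : Z ⟶ M)
    (h : Null (g ≫ s)) : ∃ φ : Z.shift 1 ⟶ cone s, φ ≫ coneFst s = shiftMap 1 g := by
  obtain ⟨h, hh⟩ := h
  refine ⟨coneLift s g (fun c n => -h.app c (n + 1) n rfl) ?_ ?_, rfl⟩
  · intro c n z
    have := hh c (n + 1) n (n + 1 + 1) rfl rfl z
    refine this.trans ?_
    simp only [LinearMap.neg_apply, map_neg]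
    abel
  · intro c c' p q n e z a
    have := h.app_ract (p + 1) q (n + 1) p n (by omega) rfl rfl z a
    simp only [LinearMap.neg_apply, map_neg, this]

end ConeMap

/-! ### h-projective and compact modules. -/

section HProj

variable {k : Type u} [Field k] {C : DGCategory k} {M N Z P X Y : DGModule C}

/-- A right dg module is h-projective if all its morphisms to acyclic modules are
null-homotopic. -/
def HProj (P : DGModule C) : Prop := ∀ N : DGModule C, N.IsAcyclic → ∀ f : P ⟶ N, Null f

/-- Morphisms from `P[i]` to `N` correspond to morphisms from `P` to `N[-i]`, which is acyclic
together with `N`. -/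
theorem HProj.shift (hP : HProj P) (i : ℤ) : HProj (P.shift i) := by
  intro N hN f
  let σ := shiftShiftIso N (-i) i (by omega)
  obtain ⟨g, hg⟩ := exists_Q_map_shiftMap_eq i ((Q C).map (f ≫ σ.inv))
  have h0 := (hP _ (hN.shift _) g).shiftMap i
  rw [← Q_map_eq_zero_iff, hg, Q_map_eq_zero_iff] at h0
  rw [← Category.comp_id f, ← σ.inv_hom_id, ← Category.assoc]
  exact h0.comp _

/-- A morphism from the cone to an acyclic module is null on `N`, hence homotopic to one that
factors through `M[1]`, where it is null again. -/
theorem HProj.cone {f : M ⟶ N} (hM : HProj M) (hN : HProj N) : HProj (cone f) := by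
  intro Z hZ F
  obtain ⟨g, hg⟩ := exists_coneFst_comp f F (hN Z hZ _)
  rw [← Q_map_eq_zero_iff, hg, Q_map_eq_zero_iff]
  exact (hM.shift 1 Z hZ g).precomp _

theorem null_of_dsum {ι : Type u} {M : ι → DGModule C} {f : dsum M ⟶ N}
    (h : ∀ i, Null (dsumι M i ≫ f)) : Null f := by
  choose h hh using h
  have e : ∀ c p q n p' n' e hp hn (m : (dsum M).obj ⟨⟩ c p) c' (a : C.Hom c' c q),
      dsumLDesc (fun i => (h i).app c' n n' hn) ((dsum M).ract p q n e m a) =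
      N.ract p' q n' (by omega) (dsumLDesc (fun i => (h i).app c p p' hp) m) a := by
    intro c p q n p' n' e hp hn m c' a
    refine LinearMap.congr_fun
      (f := dsumLDesc (fun i => (h i).app c' n n' hn) ∘ₗ ((dsum M).ract p q n e).flip a)
      (g := (N.ract p' q n' (by omega)).flip a ∘ₗ dsumLDesc (fun i => (h i).app c p p' hp))
      (dsum_linearMap_ext fun i m => ?_) m
    simp only [LinearMap.comp_apply, LinearMap.flip_apply]
    rw [← (dsumι M i).app_ract, dsumLDesc_ι, dsumLDesc_ι,
      (h i).app_ract p q n p' n' e hp hn]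
  refine ⟨⟨fun c p q e => dsumLDesc fun i => (h i).app c p q e, ?_⟩, ?_⟩
  · intro c c' p q n p' n' e' hp hn m a
    exact e c p q n p' n' e' hp hn m c' a
  · intro c p q r hq hr m
    refine LinearMap.congr_fun (f := f.app ⟨⟩ c p)
      (g := N.d q p hq ∘ₗ (dsumLDesc fun i => (h i).app c p q hq) +
        (dsumLDesc fun i => (h i).app c r p hr) ∘ₗ (dsum M).d p r hr)
      (dsum_linearMap_ext fun i m => ?_) m
    simp only [LinearMap.add_apply, LinearMap.comp_apply]
    rw [← (dsumι M i).app_d, dsumLDesc_ι, dsumLDesc_ι]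
    exact hh i c p q r hq hr m

theorem HProj.dsum {ι : Type u} {M : ι → DGModule C} (h : ∀ i, HProj (M i)) :
    HProj (dsum M) := fun N hN _ => null_of_dsum fun i => h i N hN _

/-- The obstruction to lifting is the composite with `coneInr s`, a morphism to an acyclic module.
With `HProj.eq_of_comp_eq`, composition with a quasi-isomorphism is bijective on homotopy classes
out of `P`, so these classes are the morphisms of the derived category. -/
theorem HProj.exists_lift (hP : HProj P) {s : M ⟶ N} (hs : IsQuasiIso s)
    (f : (Q C).obj P ⟶ (Q C).obj N) : ∃ g : (Q C).obj P ⟶ (Q C).obj M, g ≫ (Q C).map s = f := by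
  obtain ⟨f, rfl⟩ := (Q C).map_surjective f
  obtain ⟨g, hg⟩ := exists_comp_eq_of_null_coneInr s f
    (hP _ (isQuasiIso_iff_isAcyclic_cone.1 hs) _)
  exact ⟨(Q C).map g, by rw [← Functor.map_comp, hg]⟩

/-- If the difference `l` dies after composition with `s`, then `l[1]` factors through the acyclic
cone of `s`. It is null because `P[1]` is h-projective, and the shift is faithful. -/
theorem HProj.eq_of_comp_eq (hP : HProj P) {s : M ⟶ N} (hs : IsQuasiIso s)
    {g g' : (Q C).obj P ⟶ (Q C).obj M} (h : g ≫ (Q C).map s = g' ≫ (Q C).map s) : g = g' := by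
  rw [← sub_eq_zero, ← Preadditive.sub_comp] at h
  rw [← sub_eq_zero]
  obtain ⟨l, hl⟩ := (Q C).map_surjective (g - g')
  rw [← hl, ← Functor.map_comp, Q_map_eq_zero_iff] at h
  obtain ⟨φ, hφ⟩ := exists_comp_coneFst_eq_shiftMap s l h
  have h1 : Null (shiftMap 1 l) := by
    rw [← hφ]
    exact (hP.shift 1 _ (isQuasiIso_iff_isAcyclic_cone.1 hs) φ).comp _
  rw [← hl]
  rw [← (Q C).map_zero, ← Q_map_shiftMap_eq_iff 1, (Q_map_eq_zero_iff _).2 h1, eq_comm,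
    Q_map_eq_zero_iff]
  exact null_zero.shiftMap 1

theorem Ho.dsum_hom_ext {ι : Type u} {M : ι → DGModule C}
    {f g : (Q C).obj (DGBimodule.dsum M) ⟶ (Q C).obj N}
    (h : ∀ i, (Q C).map (dsumι M i) ≫ f = (Q C).map (dsumι M i) ≫ g) : f = g := by
  obtain ⟨f, rfl⟩ := (Q C).map_surjective f
  obtain ⟨g, rfl⟩ := (Q C).map_surjective g
  rw [Q_map_eq_iff]
  refine null_of_dsum fun i => ?_
  rw [Preadditive.comp_sub, ← Q_map_eq_iff, Functor.map_comp, Functor.map_comp, h]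

/-- The projection of a direct sum to a finite partial sum. -/
noncomputable def dsumProj {ι : Type u} (Z : ι → DGModule C) (J : Finset ι) :
    dsum Z ⟶ dsum Z := ∑ j ∈ J, dsumπ Z j ≫ dsumι Z j

open Classical in
theorem dsumProj_app_of_subset {ι : Type u} (Z : ι → DGModule C) {J : Finset ι} {b : PUnit}
    {c : C.Obj} {n : ℤ} {m : (dsum Z).obj b c n} (h : DFinsupp.support m ⊆ J) :
    (dsumProj Z J).app b c n m = m := by
  rw [dsumProj, sum_app_apply]
  conv_rhs => rw [dsum_eq_sum Z m]
  refine (Finset.sum_subset h fun i _ hi => ?_).symm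
  rw [comp_app_apply, dsumπ_app, DFinsupp.notMem_support_iff.1 hi, map_zero]

theorem dsumι_proj_of_mem {ι : Type u} (Z : ι → DGModule C) {J : Finset ι} {j : ι} (hj : j ∈ J) :
    dsumι Z j ≫ dsumProj Z J = dsumι Z j := by
  rw [dsumProj, Preadditive.comp_sum, Finset.sum_eq_single j]
  · rw [← Category.assoc, dsumι_π, Category.id_comp]
  · intro i _ hi
    rw [← Category.assoc, dsumι_π_ne Z hi.symm, Limits.zero_comp]
  · exact fun h => (h hj).elim

theorem dsumProj_comp {ι : Type u} (Z : ι → DGModule C) {J J' : Finset ι} (h : J ⊆ J') :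
    dsumProj Z J ≫ dsumProj Z J' = dsumProj Z J := by
  conv_lhs => rw [dsumProj, Preadditive.sum_comp]
  refine Finset.sum_congr rfl fun j hj => ?_
  rw [Category.assoc, dsumι_proj_of_mem Z (h hj)]

/-- A right dg module is compact if every morphism of the homotopy category from it to a direct sum
takes values in a finite partial sum. -/
def KCompact (X : DGModule C) : Prop :=
  ∀ (ι : Type u) (Z : ι → DGModule C) (f : (Q C).obj X ⟶ (Q C).obj (dsum Z)),
    ∃ J : Finset ι, ∀ J', J ⊆ J' → f ≫ (Q C).map (dsumProj Z J') = f

theorem KCompact.retract (hY : KCompact Y) (i : (Q C).obj X ⟶ (Q C).obj Y)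
    (p : (Q C).obj Y ⟶ (Q C).obj X) (h : i ≫ p = 𝟙 _) : KCompact X := by
  intro ι Z f
  obtain ⟨J, hJ⟩ := hY ι Z (p ≫ f)
  refine ⟨J, fun J' h' => ?_⟩
  have := congrArg (i ≫ ·) (hJ J' h')
  simpa only [← Category.assoc, h, Category.id_comp] using this

/-- A shift of a direct sum is the direct sum of the shifts. -/
def shiftDsumIso {ι : Type u} (Z : ι → DGModule C) (i : ℤ) :
    (dsum Z).shift i ≅ dsum fun j => (Z j).shift i where
  hom := homMk (fun c n => LinearMap.id)
    (by
      intro c p q h m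
      refine DFinsupp.ext fun j => ?_
      rfl)
    (by intros; rfl)
  inv := homMk (fun c n => LinearMap.id)
    (by
      intro c p q h m
      refine DFinsupp.ext fun j => ?_
      rfl)
    (by intros; rfl)

theorem shiftMap_dsumProj {ι : Type u} (Z : ι → DGModule C) (i : ℤ) (J : Finset ι) :
    shiftMap i (dsumProj Z J) =
      (shiftDsumIso Z i).hom ≫ dsumProj (fun j => (Z j).shift i) J ≫ (shiftDsumIso Z i).inv := by
  refine hom_ext_app fun b c n m => ?_
  change Hom.app (dsumProj Z J) _ _ _ m = Hom.app (dsumProj (fun j => (Z j).shift i) J) _ _ _ m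
  rw [dsumProj, dsumProj, sum_app_apply, sum_app_apply]
  rfl

/-- By adjunction the target becomes `(⨁ Z)[-i]`, which is the direct sum of the `Z j` shifted by
`-i`; the finite set obtained there also serves for the original morphism. -/
theorem KCompact.shift (hX : KCompact X) (i : ℤ) : KCompact (X.shift i) := by
  intro ι Z f
  obtain ⟨f, rfl⟩ := (Q C).map_surjective f
  let σ := shiftShiftIso (DGBimodule.dsum Z) (-i) i (by omega)
  let τ := shiftDsumIso Z (-i)
  obtain ⟨g, hg⟩ := exists_Q_map_shiftMap_eq i ((Q C).map (f ≫ σ.inv))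
  obtain ⟨J, hJ⟩ := hX ι _ ((Q C).map (g ≫ τ.hom))
  refine ⟨J, fun J' h' => ?_⟩
  have e1 : (Q C).map (g ≫ shiftMap (-i) (dsumProj Z J')) = (Q C).map g := by
    have h := congrArg (· ≫ (Q C).map τ.inv) (hJ J' h')
    rw [← Functor.map_comp] at h
    rw [← Functor.map_comp, ← Functor.map_comp, Category.assoc, Category.assoc,
      Category.assoc, τ.hom_inv_id, Category.comp_id] at h
    rwa [shiftMap_dsumProj]
  have e3 : shiftMap i (shiftMap (-i) (dsumProj Z J')) ≫ σ.hom = σ.hom ≫ dsumProj Z J' := by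
    refine hom_ext_app fun b c n m => ?_
    exact (app_degCast (dsumProj Z J') c (by omega : n + i + -i = n) m).symm
  rw [← Q_map_shiftMap_eq_iff i, shiftMap_comp, Functor.map_comp, hg, ← Functor.map_comp] at e1
  have e2 := congrArg (· ≫ (Q C).map σ.hom) e1
  rw [← Functor.map_comp, ← Functor.map_comp, Category.assoc, e3, Category.assoc, Category.assoc,
    σ.inv_hom_id, ← Category.assoc σ.inv, σ.inv_hom_id, Category.id_comp, Category.comp_id,
    Functor.map_comp] at e2
  exact e2

/-- The part of `F` outside the finite sum over `J` vanishes on `N`, so it factors through `M[1]`,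
which is compact. Its finite set `J₂` is joined to `J`. -/
theorem KCompact.cone {f : M ⟶ N} (hM : KCompact M) (hN : KCompact N) : KCompact (cone f) := by
  classical
  intro ι Z F
  obtain ⟨J, hJ⟩ := hN ι Z ((Q C).map (coneInr f) ≫ F)
  obtain ⟨F', hF'⟩ := (Q C).map_surjective (F - F ≫ (Q C).map (dsumProj Z J))
  have h0 : Null (coneInr f ≫ F') := by
    rw [← Q_map_eq_zero_iff, Functor.map_comp, hF', Preadditive.comp_sub, ← Category.assoc,
      hJ J subset_rfl, sub_self]
  obtain ⟨g, hg⟩ := exists_coneFst_comp f F' h0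
  obtain ⟨J₂, hJ₂⟩ := hM.shift 1 ι Z ((Q C).map g)
  refine ⟨J ∪ J₂, fun J' h' => ?_⟩
  have e := hJ₂ J' (Finset.union_subset_right h')
  have e1 : (Q C).map F' ≫ (Q C).map (dsumProj Z J') = (Q C).map F' := by
    rw [hg, Functor.map_comp, Category.assoc, e]
  rw [hF', Preadditive.sub_comp, Category.assoc, ← Functor.map_comp,
    dsumProj_comp Z (Finset.union_subset_left h')] at e1
  exact sub_left_injective e1

theorem KCompact.dsum {ι : Type u} [Finite ι] {M : ι → DGModule C} (h : ∀ i, KCompact (M i)) :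
    KCompact (dsum M) := by
  classical
  have := Fintype.ofFinite ι
  intro κ Z f
  choose J hJ using fun i => h i κ Z ((Q C).map (dsumι M i) ≫ f)
  refine ⟨Finset.univ.biUnion J, fun J' h' => Ho.dsum_hom_ext fun i => ?_⟩
  rw [← Category.assoc]
  exact hJ i J' ((Finset.subset_biUnion_of_mem J (Finset.mem_univ i)).trans h')

/-- The Leibniz rule for `1 = 1 ∘ 1` reads `d 1 = d 1 + d 1`. -/
theorem _root_.DGCategory.d_one (x : C.Obj) : C.d 0 1 rfl (C.one x) = 0 := by
  have h := C.d_comp 0 0 0 1 1 1 rfl rfl rfl rfl (C.one x) (C.one x)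
  rw [C.one_comp, C.comp_one, koszulSign_zero, one_smul, C.one_comp] at h
  simpa using h

theorem representable_app (x : C.Obj) (f : C.representable x ⟶ N) (c : C.Obj) (n : ℤ)
    (a : C.Hom c x n) :
    f.app ⟨⟩ c n a = N.ract 0 n n (zero_add n) (f.app ⟨⟩ x 0 (C.one x)) a := by
  have := f.app_ract (b := ⟨⟩) 0 n n (zero_add n) (C.one x) a
  rw [← this]
  congr 1
  exact (C.one_comp n a).symm

/-- By the Yoneda formula, `f` is `m ↦ f(1) m` with `f(1)` a cocycle. A primitive `y` of `f(1)`, of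
degree `-1`, gives the null-homotopy `m ↦ y m`. -/
theorem hProj_representable (x : C.Obj) : HProj (C.representable x) := by
  intro N hN f
  have hc : f.app ⟨⟩ x 0 (C.one x) ∈ N.cyc ⟨⟩ x 0 := by
    refine app_mem_cyc f ((mem_cyc 1 rfl).2 ?_)
    exact C.d_one x
  obtain ⟨y, hy⟩ := (mem_bdry (-1) (by omega)).1 (isAcyclic_iff.1 hN _ _ _ _ hc)
  refine ⟨⟨fun c p q e => N.ract (-1) p q (by omega) y, ?_⟩, ?_⟩
  · intro c c' p q n p' n' e hp hn m a
    exact (N.ract_ract (-1) p q p' n n' (by omega) e (by omega) y m a).symm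
  · intro c p q r hq hr m
    rw [representable_app, ← hy]
    have := N.d_ract (-1) p q 0 r p (by omega) (by omega) hr hq y m
    rw [this, show koszulSign k (-1) = -1 by simp [koszulSign], neg_smul, one_smul]
    exact (neg_add_cancel_right _ _).symm

/-- A morphism is determined by the image of the identity, and that single element of the direct sum
has finite support. -/
theorem kCompact_representable (x : C.Obj) : KCompact (C.representable x) := by
  classical
  intro ι Z f
  obtain ⟨f, rfl⟩ := (Q C).map_surjective f
  refine ⟨DFinsupp.support (f.app ⟨⟩ x 0 (C.one x)), fun J' h' => ?_⟩
  rw [← Functor.map_comp]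
  congr 1
  refine hom_ext_app fun b c n a => ?_
  refine (representable_app x (f ≫ dsumProj Z J') c n a).trans ?_
  refine Eq.trans ?_ (representable_app x f c n a).symm
  rw [comp_app_apply, dsumProj_app_of_subset Z h']

/-- Compact h-projective modules. -/
structure Good (X : DGModule C) : Prop where
  hProj : HProj X
  kCompact : KCompact X

theorem Good.shift (hX : Good X) (i : ℤ) : Good (X.shift i) :=
  ⟨hX.hProj.shift i, hX.kCompact.shift i⟩

theorem Good.cone {f : M ⟶ N} (hM : Good M) (hN : Good N) : Good (cone f) :=
  ⟨hM.hProj.cone hN.hProj, hM.kCompact.cone hN.kCompact⟩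

theorem Good.dsum {ι : Type u} [Finite ι] {M : ι → DGModule C} (h : ∀ i, Good (M i)) :
    Good (dsum M) :=
  ⟨.dsum fun i => (h i).hProj, .dsum fun i => (h i).kCompact⟩

end HProj

/-! ### Splitting homotopy idempotents; compact h-projective resolutions of perfect modules. -/

section Resolution

variable {k : Type u} [Field k] {C : DGCategory k} {M N P X Y : DGModule C}

theorem sub_mem_bdry_of_Q_map_eq {f g : M ⟶ N} (h : (Q C).map f = (Q C).map g) {b : PUnit}
    {c : C.Obj} {n : ℤ} {m : M.obj b c n} (hm : m ∈ M.cyc b c n) :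
    f.app b c n m - g.app b c n m ∈ N.bdry b c n :=
  ((Q_map_eq_iff f g).1 h).app_mem_bdry hm

/-- A morphism out of the cone of a homotopy split monomorphism `u` is a quasi-isomorphism if its
restriction to the target of `u` is a cokernel of `u` in cohomology. -/
theorem isQuasiIso_of_homotopy_split {u : M ⟶ N} {r : N ⟶ M}
    (hr : (Q C).map (u ≫ r) = (Q C).map (𝟙 M)) {τ : cone u ⟶ P}
    (hsurj : ∀ b c n, ∀ y ∈ P.cyc b c n, ∃ v ∈ N.cyc b c n,
      y - (coneInr u ≫ τ).app b c n v ∈ P.bdry b c n)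
    (hinj : ∀ b c n, ∀ v ∈ N.cyc b c n, (coneInr u ≫ τ).app b c n v ∈ P.bdry b c n →
      v - u.app b c n (r.app b c n v) ∈ N.bdry b c n) : IsQuasiIso τ := by
  rw [isQuasiIso_iff]
  intro b c n
  constructor
  · rintro ⟨a, v⟩ hm h
    obtain ⟨ha, hav⟩ := mem_cyc_cone.1 hm
    dsimp only at ha hav
    have h1 : a ∈ M.bdry b c (n + 1) := by
      have e1 := sub_mem_bdry_of_Q_map_eq hr ha
      have e2 : r.app b c _ (u.app b c _ a) ∈ M.bdry b c (n + 1) := by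
        rw [eq_neg_of_add_eq_zero_left hav, map_neg]
        exact neg_mem (app_mem_bdry r (d_mem_bdry _ _ _))
      have e3 := sub_mem e2 e1
      rwa [comp_app_apply, id_app_apply, sub_sub_cancel] at e3
    -- The boundary of `(w, 0)` in the cone is `(-d w, u w)`. The cocycle `(d w, v)` is therefore
    -- cohomologous to `(0, v + u w)`, to which the hypothesis on the target of `u` applies.
    obtain ⟨w, rfl⟩ := (mem_bdry n rfl).1 h1
    have h2 : v + u.app b c n w ∈ N.cyc b c n := by
      rw [mem_cyc (n + 1) rfl, map_add, ← u.app_d _ _ rfl, ← hav]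
      exact add_comm _ _
    have h3 : (coneInr u ≫ τ).app b c n (v + u.app b c n w) ∈ P.bdry b c n := by
      have e : ((0, v + u.app b c n w) : (cone u).obj b c n) - (M.d n (n + 1) rfl w, v) ∈
          (cone u).bdry b c n := by
        refine (mem_bdry_cone (n - 1) (by omega)).2 ⟨w, 0, ?_, ?_⟩
        · change _ = -(0 - M.d n (n + 1) rfl w)
          rw [zero_sub, neg_neg]
        · change _ = v + u.app b c n w - v
          rw [map_zero, add_zero, add_sub_cancel_left]
      have e' := add_mem (app_mem_bdry τ e) h
      rwa [← map_add, sub_add_cancel] at e'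
    obtain ⟨z, hz⟩ := (mem_bdry (n - 1) (by omega)).1 (hinj b c n _ h2 h3)
    have hr' : r.app b c n (v + u.app b c n w) ∈ M.cyc b c n := app_mem_cyc r h2
    refine (mem_bdry_cone (n - 1) (by omega)).2 ⟨r.app b c n (v + u.app b c n w) - w, z, ?_, ?_⟩
    · rw [map_sub, (mem_cyc _ rfl).1 hr', zero_sub]
    · rw [hz, map_sub]
      change _ = v
      abel
  · intro y hy
    obtain ⟨v, hv, h⟩ := hsurj b c n y hy
    exact ⟨(coneInr u).app b c n v, app_mem_cyc _ hv, h⟩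

/-- A homotopy idempotent `e` on an h-projective module `X` whose image in cohomology is `N` can be
split: `N` has an h-projective resolution. -/
theorem exists_hProj_of_retract (hX : HProj X) {q : X ⟶ M} (hq : IsQuasiIso q) {j : N ⟶ M}
    {π : M ⟶ N} (hjπ : j ≫ π = 𝟙 N) :
    ∃ (T : DGModule C) (τ : T ⟶ N), HProj T ∧ IsQuasiIso τ := by
  -- This is the idempotent `π ≫ j` of `M` carried over to `X`. It is idempotent only up to
  -- homotopy, so its image cannot be taken naively.
  obtain ⟨e, he⟩ := hX.exists_lift hq ((Q C).map (q ≫ π ≫ j))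
  obtain ⟨e, rfl⟩ := (Q C).map_surjective e
  have hep : (Q C).map e ≫ (Q C).map (q ≫ π) = (Q C).map (q ≫ π) := by
    have := congrArg (· ≫ (Q C).map π) he
    simpa only [Category.assoc, ← Functor.map_comp, hjπ, Category.comp_id] using this
  have hee : (Q C).map e ≫ (Q C).map e = (Q C).map e := by
    refine hX.eq_of_comp_eq hq ?_
    rw [Category.assoc, he, ← Category.assoc q, Functor.map_comp _ (q ≫ π), ← Category.assoc, hep]
  let A : DGModule C := dsum fun _ : ULift.{u} ℕ => X
  let i : ℕ → (X ⟶ A) := fun n => dsumι (fun _ : ULift.{u} ℕ => X) ⟨n⟩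
  let π₀ : A ⟶ X := dsumπ (fun _ : ULift.{u} ℕ => X) ⟨0⟩
  let e' : X ⟶ X := 𝟙 X - e
  -- On countably many copies of `X`, the map `u` is the identity on the `1 - e` part and moves the
  -- `e` part to the next copy. The map `r` moves the `e` part back and kills it in copy `0`. Up to
  -- homotopy, `u` is a split monomorphism whose cokernel is the image of `e` in copy `0`, so its
  -- cone models `N`.
  let u : A ⟶ A := dsumDesc fun n => e' ≫ i n.down + e ≫ i (n.down + 1)
  let r : A ⟶ A := dsumDesc fun n =>
    Nat.casesOn n.down (e' ≫ i 0) (fun n => e' ≫ i (n + 1) + e ≫ i n)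
  have hA : ∀ {Z : DGModule C} {f g : A ⟶ Z},
      (∀ n, (Q C).map (i n) ≫ (Q C).map f = (Q C).map (i n) ≫ (Q C).map g) →
      (Q C).map f = (Q C).map g := fun h => Ho.dsum_hom_ext fun n => h n.down
  have hu : ∀ n, i n ≫ u = e' ≫ i n + e ≫ i (n + 1) := fun n =>
    dsumι_desc (M := fun _ : ULift.{u} ℕ => X) _ ⟨n⟩
  have hr0 : i 0 ≫ r = e' ≫ i 0 := dsumι_desc (M := fun _ : ULift.{u} ℕ => X) _ ⟨0⟩
  have hr : ∀ n, i (n + 1) ≫ r = e' ≫ i (n + 1) + e ≫ i n := fun n =>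
    dsumι_desc (M := fun _ : ULift.{u} ℕ => X) _ ⟨n + 1⟩
  have hπ0 : i 0 ≫ π₀ = 𝟙 X := dsumι_π (fun _ : ULift.{u} ℕ => X) ⟨0⟩
  have hπ : ∀ n, i (n + 1) ≫ π₀ = 0 := fun n =>
    dsumι_π_ne (fun _ : ULift.{u} ℕ => X) (by simp)
  have hU : ∀ n, (Q C).map (i n) ≫ (Q C).map u = (Q C).map (i n) -
      (Q C).map e ≫ (Q C).map (i n) + (Q C).map e ≫ (Q C).map (i (n + 1)) := fun n => by
    rw [← Functor.map_comp, hu, Preadditive.sub_comp, Category.id_comp, Functor.map_add,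
      Functor.map_sub, Functor.map_comp, Functor.map_comp]
  have hR0 : (Q C).map (i 0) ≫ (Q C).map r = (Q C).map (i 0) -
      (Q C).map e ≫ (Q C).map (i 0) := by
    rw [← Functor.map_comp, hr0, Preadditive.sub_comp, Category.id_comp,
      Functor.map_sub, Functor.map_comp]
  have hR : ∀ n, (Q C).map (i (n + 1)) ≫ (Q C).map r = (Q C).map (i (n + 1)) -
      (Q C).map e ≫ (Q C).map (i (n + 1)) + (Q C).map e ≫ (Q C).map (i n) := fun n => by
    rw [← Functor.map_comp, hr, Preadditive.sub_comp, Category.id_comp, Functor.map_add,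
      Functor.map_sub, Functor.map_comp, Functor.map_comp]
  have hur : (Q C).map (u ≫ r) = (Q C).map (𝟙 A) := by
    refine hA fun n => ?_
    rw [Functor.map_comp, reassoc_of% hU n, (Q C).map_id, Category.comp_id]
    cases n with
    | zero =>
      simp only [Preadditive.sub_comp, Preadditive.add_comp, Preadditive.comp_sub,
        Preadditive.comp_add, Category.assoc, hR0, hR, reassoc_of% hee]
      abel
    | succ n =>
      simp only [Preadditive.sub_comp, Preadditive.add_comp, Preadditive.comp_sub,
        Preadditive.comp_add, Category.assoc, hR, reassoc_of% hee]
      abel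
  have hru : (Q C).map (r ≫ u) = (Q C).map (𝟙 A - π₀ ≫ e ≫ i 0) := by
    refine hA fun n => ?_
    rw [← Functor.map_comp _ (i n) (𝟙 A - _), Preadditive.comp_sub, Category.comp_id,
      ← Category.assoc (i n) π₀, Functor.map_comp]
    cases n with
    | zero =>
      rw [reassoc_of% hR0, hπ0, Category.id_comp, Functor.map_sub, Functor.map_comp]
      simp only [Preadditive.sub_comp, Category.assoc, hU, Preadditive.comp_sub,
        Preadditive.comp_add, reassoc_of% hee]
      abel
    | succ n =>
      rw [reassoc_of% hR n, hπ, Limits.zero_comp, sub_zero]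
      simp only [Preadditive.sub_comp, Preadditive.add_comp, Category.assoc, hU,
        Preadditive.comp_sub, Preadditive.comp_add, reassoc_of% hee]
      abel
  have hnull : Null (u ≫ π₀ ≫ q ≫ π) := by
    rw [← Q_map_eq_zero_iff, ← (Q C).map_zero]
    refine hA fun n => ?_
    rw [← Functor.map_comp, ← Functor.map_comp, ← Category.assoc, hu, Limits.comp_zero]
    cases n with
    | zero =>
      rw [← Category.assoc, Preadditive.add_comp, Category.assoc, Category.assoc, hπ0, hπ,
        Limits.comp_zero, add_zero, Category.comp_id, Preadditive.sub_comp, Category.id_comp,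
        Functor.map_sub, Functor.map_comp _ e, hep, sub_self, Functor.map_zero]
    | succ n =>
      rw [← Category.assoc, Preadditive.add_comp, Category.assoc, Category.assoc, hπ, hπ,
        Limits.comp_zero, Limits.comp_zero, add_zero, Limits.zero_comp]
  obtain ⟨τ, hτ⟩ := exists_coneDesc u (π₀ ≫ q ≫ π) hnull
  have hAP : HProj A := HProj.dsum fun _ => hX
  refine ⟨cone u, τ, hAP.cone hAP, isQuasiIso_of_homotopy_split hur ?_ ?_⟩
  · intro b c n y hy
    obtain ⟨x, hx, h⟩ := (isQuasiIso_iff.1 hq b c n).2 _ (app_mem_cyc j hy)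
    refine ⟨(i 0).app b c n x, app_mem_cyc _ hx, ?_⟩
    have h' := app_mem_bdry π h
    rwa [map_sub, ← comp_app_apply j, hjπ, id_app_apply, ← comp_app_apply q,
      ← Category.id_comp (q ≫ π), ← hπ0, Category.assoc, comp_app_apply, ← hτ] at h'
  · intro b c n v hv h
    have hx := app_mem_cyc π₀ hv
    -- Under `q` this element is cohomologous to `j` applied to the image of `v` in `N`, which is a
    -- boundary by assumption; `q` detects boundaries.
    have h1 : e.app b c n (π₀.app b c n v) ∈ X.bdry b c n := by
      refine (isQuasiIso_iff.1 hq b c n).1 _ (app_mem_cyc e hx) ?_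
      rw [← Functor.map_comp] at he
      have h2 := sub_mem_bdry_of_Q_map_eq he hx
      rw [hτ] at h
      have h3 := add_mem h2 (app_mem_bdry j h)
      simpa only [comp_app_apply, sub_add_cancel] using h3
    have h2 := sub_mem_bdry_of_Q_map_eq hru hv
    have h3 := sub_mem (neg_mem (app_mem_bdry (i 0) h1)) h2
    -- The first two terms contain `i₀ e π₀ v` twice with a minus sign, once explicitly and once
    -- through the formula for `r ≫ u`. Adding it back twice restores the identity.
    have h4 : v - u.app b c n (r.app b c n v) = -(i 0).app b c n (e.app b c n (π₀.app b c n v)) -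
        ((r ≫ u).app b c n v - (𝟙 A - π₀ ≫ e ≫ i 0).app b c n v) + 2 •
          (i 0).app b c n (e.app b c n (π₀.app b c n v)) := by
      rw [sub_app_apply, id_app_apply]
      simp only [comp_app_apply]
      abel
    rw [h4]
    exact add_mem h3 (nsmul_mem (app_mem_bdry (i 0) h1) 2)

/-- Perfect modules have compact h-projective resolutions. -/
theorem exists_good {F : DGModule C} (hF : F ∈ C.Perf) :
    ∃ (X : DGModule C) (f : X ⟶ F), Good X ∧ IsQuasiIso f := by
  change C.Perf F at hF
  induction hF with
  | representable x =>
    exact ⟨_, 𝟙 _, ⟨hProj_representable x, kCompact_representable x⟩, isQuasiIso_id _⟩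
  | qis f hf _ ih =>
    obtain ⟨X, g, hX, hg⟩ := ih
    exact ⟨X, g ≫ f, hX, hg.comp hf⟩
  | qis_symm f hf _ ih =>
    obtain ⟨X, g, hX, hg⟩ := ih
    obtain ⟨l, hl⟩ := hX.hProj.exists_lift hf ((Q C).map g)
    obtain ⟨l, rfl⟩ := (Q C).map_surjective l
    rw [← Functor.map_comp] at hl
    exact ⟨X, l, hX, isQuasiIso_of_comp hf (hg.of_Q_map_eq hl.symm)⟩
  | shift i M _ ih =>
    obtain ⟨X, g, hX, hg⟩ := ih
    exact ⟨X.shift i, shiftMap i g, hX.shift i, hg.shiftMap i⟩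
  | cone f _ _ ihM ihN =>
    obtain ⟨X, a, hX, ha⟩ := ihM
    obtain ⟨Y, b, hY, hb⟩ := ihN
    -- The lift makes the square of resolutions commute only up to homotopy, which suffices for a
    -- quasi-isomorphism of cones.
    obtain ⟨l, hl⟩ := hX.hProj.exists_lift hb ((Q C).map (a ≫ f))
    obtain ⟨l, rfl⟩ := (Q C).map_surjective l
    rw [← Functor.map_comp] at hl
    obtain ⟨ψ, hψ⟩ := exists_coneMap hl ha hb
    exact ⟨cone l, ψ, hX.cone hY, hψ⟩
  | dsum M _ ih =>
    choose X f hX hf using ih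
    exact ⟨dsum X, dsumMap f, .dsum hX, .dsumMap hf⟩
  | summand M _ i ih =>
    obtain ⟨X, q, hX, hq⟩ := ih
    obtain ⟨T, τ, hT, hτ⟩ := exists_hProj_of_retract hX.hProj hq (dsumι_π M i)
    -- The module `T` was built from infinite sums, so its compactness is not visible from the
    -- construction. Lifting the inclusion and the projection of the summand makes it a retract of
    -- the compact module `X` in `Ho C`.
    obtain ⟨s, hs⟩ := hT.exists_lift hq ((Q C).map (τ ≫ dsumι M i))
    obtain ⟨p, hp⟩ := hX.hProj.exists_lift hτ ((Q C).map (q ≫ dsumπ M i))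
    refine ⟨T, τ, ⟨hT, hX.kCompact.retract s p (hT.eq_of_comp_eq hτ ?_)⟩, hτ⟩
    rw [Category.assoc, hp, Functor.map_comp, ← Category.assoc, hs, ← Functor.map_comp,
      Category.assoc, dsumι_π, Category.comp_id, Category.id_comp]

end Resolution

/-! ### Factorisation through compact objects: closure properties. -/

section Fact

variable {k : Type u} [Field k] {C : DGCategory k}

/-- The modules `Z` such that all homotopy classes of morphisms from compact h-projective modules to
`Z` factor through compact h-projective modules in the class `𝒜`. -/
def FactorsThrough (𝒜 : Set (DGModule C)) : Set (DGModule C) :=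
  {Z | ∀ X : DGModule C, Good X → ∀ f : (Q C).obj X ⟶ (Q C).obj Z, ∃ W : DGModule C,
    Good W ∧ W ∈ 𝒜 ∧ ∃ (a : (Q C).obj X ⟶ (Q C).obj W) (b : (Q C).obj W ⟶ (Q C).obj Z), a ≫ b = f}

variable {𝒜 ℬ : Set (DGModule C)} {M N Z : DGModule C}

theorem FactorsThrough.mono (h : 𝒜 ⊆ ℬ) (hZ : Z ∈ FactorsThrough 𝒜) : Z ∈ FactorsThrough ℬ := by
  intro X hX f
  obtain ⟨W, hW, hWA, a, b, h'⟩ := hZ X hX f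
  exact ⟨W, hW, h hWA, a, b, h'⟩

theorem FactorsThrough.retract (hM : M ∈ FactorsThrough 𝒜) (i : N ⟶ M) (p : M ⟶ N)
    (h : i ≫ p = 𝟙 N) : N ∈ FactorsThrough 𝒜 := by
  intro X hX f
  obtain ⟨W, hW, hWA, a, b, hab⟩ := hM X hX (f ≫ (Q C).map i)
  refine ⟨W, hW, hWA, a, b ≫ (Q C).map p, ?_⟩
  rw [← Category.assoc, hab, Category.assoc, ← Functor.map_comp, h, (Q C).map_id,
    Category.comp_id]

theorem FactorsThrough.qis {s : M ⟶ N} (hs : IsQuasiIso s) (hM : M ∈ FactorsThrough 𝒜) :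
    N ∈ FactorsThrough 𝒜 := by
  intro X hX f
  obtain ⟨g, rfl⟩ := hX.hProj.exists_lift hs f
  obtain ⟨W, hW, hWA, a, b, rfl⟩ := hM X hX g
  exact ⟨W, hW, hWA, a, b ≫ (Q C).map s, (Category.assoc _ _ _).symm⟩

/-- h-projectivity of `W` lifts the second factor through `s`; that of `X` shows that the new
factorisation gives back `f` itself. -/
theorem FactorsThrough.qis_symm {s : M ⟶ N} (hs : IsQuasiIso s) (hN : N ∈ FactorsThrough 𝒜) :
    M ∈ FactorsThrough 𝒜 := by
  intro X hX f
  obtain ⟨W, hW, hWA, a, b, hab⟩ := hN X hX (f ≫ (Q C).map s)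
  obtain ⟨b, rfl⟩ := hW.hProj.exists_lift hs b
  exact ⟨W, hW, hWA, a, b, hX.hProj.eq_of_comp_eq hs ((Category.assoc _ _ _).trans hab)⟩

theorem FactorsThrough.of_isAcyclic (hA : ∀ W : DGModule C, W.IsAcyclic → W ∈ 𝒜)
    (hZ : Z.IsAcyclic) : Z ∈ FactorsThrough 𝒜 := by
  intro X hX f
  -- The cone of the identity serves as a zero object that is at once acyclic, h-projective and
  -- compact.
  refine ⟨_, hX.cone (f := 𝟙 X) hX,
    hA _ (isQuasiIso_iff_isAcyclic_cone.1 (isQuasiIso_id X)), 0, 0, ?_⟩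
  obtain ⟨f, rfl⟩ := (Q C).map_surjective f
  rw [(Q_map_eq_zero_iff f).2 (hX.hProj _ hZ f), Limits.zero_comp]

/-- A compact h-projective module is, up to isomorphism, a shift of one. -/
theorem FactorsThrough.of_shift (i : ℤ)
    (h : ∀ X : DGModule C, Good X → ∀ f : X.shift i ⟶ Z, ∃ W : DGModule C,
      Good W ∧ W ∈ 𝒜 ∧ ∃ (a : X.shift i ⟶ W) (b : W ⟶ Z), (Q C).map (a ≫ b) = (Q C).map f) :
    Z ∈ FactorsThrough 𝒜 := by
  intro X hX f
  obtain ⟨f, rfl⟩ := (Q C).map_surjective f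
  let σ := shiftShiftIso X (-i) i (by omega)
  obtain ⟨W, hW, hWA, a, b, hab⟩ := h _ (hX.shift (-i)) (σ.hom ≫ f)
  refine ⟨W, hW, hWA, (Q C).map (σ.inv ≫ a), (Q C).map b, ?_⟩
  rw [← Functor.map_comp, Category.assoc, Functor.map_comp, hab, ← Functor.map_comp,
    σ.inv_hom_id_assoc]

theorem FactorsThrough.shift (i : ℤ) (hA : ∀ W ∈ 𝒜, W.shift i ∈ 𝒜)
    (hZ : Z ∈ FactorsThrough 𝒜) : Z.shift i ∈ FactorsThrough 𝒜 := by
  refine FactorsThrough.of_shift i fun X hX f => ?_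
  obtain ⟨g, hg⟩ := exists_Q_map_shiftMap_eq i ((Q C).map f)
  obtain ⟨W, hW, hWA, a, b, hab⟩ := hZ X hX ((Q C).map g)
  obtain ⟨a, rfl⟩ := (Q C).map_surjective a
  obtain ⟨b, rfl⟩ := (Q C).map_surjective b
  refine ⟨_, hW.shift i, hA W hWA, shiftMap i a, shiftMap i b, ?_⟩
  rw [← shiftMap_comp, ← hg, Q_map_shiftMap_eq_iff, Functor.map_comp, hab]

/-- Compactness of `X` confines `f` to finitely many summands, and its components are factored
separately. Arbitrary sums of modules thus cost only finite sums in `𝒜`. -/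
theorem FactorsThrough.dsum
    (hA : ∀ (ι : Type u) [Finite ι] (W : ι → DGModule C), (∀ i, W i ∈ 𝒜) → dsum W ∈ 𝒜)
    {ι : Type u} {M : ι → DGModule C} (hM : ∀ i, M i ∈ FactorsThrough 𝒜) :
    DGBimodule.dsum M ∈ FactorsThrough 𝒜 := by
  intro X hX f
  obtain ⟨J, hJ⟩ := hX.kCompact ι M f
  choose W hW hWA a b hab using fun i => hM i X hX (f ≫ (Q C).map (dsumπ M i))
  choose a' ha using fun i => (Q C).map_surjective (a i)
  choose b' hb using fun i => (Q C).map_surjective (b i)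
  let V : J → DGModule C := fun j => W j
  refine ⟨DGBimodule.dsum V, .dsum fun j => hW j, hA _ V fun j => hWA j,
    (Q C).map (∑ j : J, a' j ≫ dsumι V j),
    (Q C).map (dsumDesc (M := V) fun j => b' j ≫ dsumι M j), ?_⟩
  rw [← hJ J subset_rfl, ← Functor.map_comp, Preadditive.sum_comp, dsumProj, Functor.map_sum,
    Functor.map_sum, Preadditive.comp_sum, ← Finset.sum_coe_sort J]
  refine Finset.sum_congr rfl fun j _ => ?_
  rw [Category.assoc, dsumι_desc, Functor.map_comp, Functor.map_comp, Functor.map_comp, ha, hb,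
    ← Category.assoc, hab, Category.assoc]

/-- The number of layers is preserved because `W₁ ∈ 𝒜` and `W₂ ∈ ℬ` are found successively and then
joined by a single cone. Explicit homotopies take the place of the octahedral axiom. -/
theorem FactorsThrough.star (hM : M ∈ FactorsThrough 𝒜) (hN : N ∈ FactorsThrough ℬ)
    (g : M ⟶ N) : cone g ∈ FactorsThrough (star 𝒜 ℬ) := by
  refine FactorsThrough.of_shift 1 fun X hX f => ?_
  obtain ⟨f₁, hf₁⟩ := exists_Q_map_shiftMap_eq 1 ((Q C).map (f ≫ coneFst g))
  obtain ⟨W₁, hW₁, hWA, a₁, b₁, hab₁⟩ := hM X hX ((Q C).map f₁)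
  obtain ⟨a₁, rfl⟩ := (Q C).map_surjective a₁
  obtain ⟨b₁, rfl⟩ := (Q C).map_surjective b₁
  rw [← Functor.map_comp, eq_comm, ← Q_map_shiftMap_eq_iff 1, hf₁] at hab₁
  -- After this correction the `M[1]` component of `f'` is strictly `b₁` after `a₁`. Closedness of
  -- `f'` then says that its `N` component is, up to sign, a null-homotopy of `a₁ ≫ b₁ ≫ g`.
  obtain ⟨f', hff', hf'⟩ := exists_comp_coneFst_eq g f _ hab₁
  have hf'1 : ∀ c n (x : X.obj ⟨⟩ c (n + 1)),
      (f'.app ⟨⟩ c n x).1 = b₁.app ⟨⟩ c (n + 1) (a₁.app ⟨⟩ c (n + 1) x) := fun c n x =>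
    congrArg (fun l : X.shift 1 ⟶ M.shift 1 => l.app ⟨⟩ c n x) hf'
  have hf'2 : ∀ c n (x : X.obj ⟨⟩ c (n + 1)),
      g.app ⟨⟩ c (n + 1) (b₁.app ⟨⟩ c (n + 1) (a₁.app ⟨⟩ c (n + 1) x)) =
        -N.d n (n + 1) rfl (f'.app ⟨⟩ c n x).2 -
          (f'.app ⟨⟩ c (n + 1) (X.d (n + 1) (n + 1 + 1) rfl x)).2 := fun c n x => by
    have e := congrArg Prod.snd (f'.app_d (b := ⟨⟩) (c := c) n (n + 1) rfl x)
    rw [shift_one_d, map_neg] at e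
    change -(f'.app ⟨⟩ c (n + 1) (X.d (n + 1) (n + 1 + 1) rfl x)).2 =
      g.app ⟨⟩ c (n + 1) (f'.app ⟨⟩ c n x).1 + N.d n (n + 1) rfl (f'.app ⟨⟩ c n x).2 at e
    rw [hf'1] at e
    rw [sub_eq_add_neg, e]
    abel
  -- That null-homotopy extends `b₁ ≫ g` from `W₁` to the cone of `a₁`. Since this cone is compact
  -- and h-projective, the hypothesis on `N` applies to `ψ`.
  let ψ : cone a₁ ⟶ N := coneDesc a₁ (b₁ ≫ g)
    (fun c n => -(LinearMap.snd k _ _ ∘ₗ f'.app ⟨⟩ c n))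
    (by
      intro c n x
      change g.app _ c _ (b₁.app _ c _ _) = N.d n (n + 1) rfl (-(f'.app ⟨⟩ c n x).2) +
        -(f'.app ⟨⟩ c (n + 1) (X.d (n + 1) (n + 1 + 1) rfl x)).2
      rw [hf'2, map_neg]
      abel)
    (by
      intro c c' p q n h x a
      have e := congrArg Prod.snd (f'.app_ract (b := ⟨⟩) p q n h x a)
      change -(f'.app ⟨⟩ c' n (X.ract (p + 1) q (n + 1) _ x a)).2 =
        N.ract p q n h (-(f'.app ⟨⟩ c p x).2) a
      rw [map_neg, LinearMap.neg_apply]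
      exact congrArg Neg.neg e)
  have hψ : ∀ c n (x : (cone a₁).obj ⟨⟩ c n), ψ.app ⟨⟩ c n x =
      g.app ⟨⟩ c n (b₁.app ⟨⟩ c n x.2) + -(f'.app ⟨⟩ c n x.1).2 := fun c n x => rfl
  obtain ⟨W₂, hW₂, hWB, a₂, b₂, hab₂⟩ := hN _ (hX.cone (f := a₁) hW₁) ((Q C).map ψ)
  obtain ⟨a₂, rfl⟩ := (Q C).map_surjective a₂
  obtain ⟨b₂, rfl⟩ := (Q C).map_surjective b₂
  rw [← Functor.map_comp, eq_comm, Q_map_eq_iff] at hab₂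
  obtain ⟨K, hK⟩ := hab₂
  have hK' : ∀ c n (x : (cone a₁).obj ⟨⟩ c (n + 1)),
      ψ.app ⟨⟩ c (n + 1) x - b₂.app ⟨⟩ c (n + 1) (a₂.app ⟨⟩ c (n + 1) x) =
        N.d n (n + 1) rfl (K.app c (n + 1) n rfl x) + K.app c (n + 1 + 1) (n + 1) rfl
          (coneD a₁ ⟨⟩ c (n + 1) (n + 1 + 1) rfl x) := fun c n x =>
    hK c (n + 1) n (n + 1 + 1) rfl rfl x
  -- The homotopy `K` from `ψ` to `a₂ ≫ b₂` is separated into its parts on `X[1]` and on `W₁`. The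
  -- part on `W₁` fills the square defining `β`; the part on `X[1]` compares `f'` with `α ≫ β`.
  have hKx : ∀ c n (x : X.obj ⟨⟩ c (n + 1 + 1)),
      -(f'.app ⟨⟩ c (n + 1) x).2 - b₂.app ⟨⟩ c (n + 1) (a₂.app ⟨⟩ c (n + 1) (x, 0)) =
        N.d n (n + 1) rfl (K.app c (n + 1) n rfl (x, 0)) + K.app c (n + 1 + 1) (n + 1) rfl
          (-X.d (n + 1 + 1) (n + 1 + 1 + 1) rfl x, a₁.app ⟨⟩ c (n + 1 + 1) x) := fun c n x => by
    have e := hK' c n (x, 0)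
    rw [hψ, coneD_apply] at e
    simpa only [map_zero, zero_add, add_zero] using e
  have hKw : ∀ c n (w : W₁.obj ⟨⟩ c (n + 1)), g.app ⟨⟩ c (n + 1) (b₁.app ⟨⟩ c (n + 1) w) -
      b₂.app ⟨⟩ c (n + 1) (a₂.app ⟨⟩ c (n + 1) (0, w)) =
        N.d n (n + 1) rfl (K.app c (n + 1) n rfl (0, w)) + K.app c (n + 1 + 1) (n + 1) rfl
          (0, W₁.d (n + 1) (n + 1 + 1) rfl w) := fun c n w => by
    have e := hK' c n (0, w)
    rw [hψ, coneD_apply, map_zero (f'.app ⟨⟩ c (n + 1))] at e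
    simpa only [map_zero, zero_add, add_zero, neg_zero, Prod.snd_zero] using e
  have ha₂ : ∀ c n (x : X.obj ⟨⟩ c (n + 1)),
      a₂.app ⟨⟩ c (n + 1) (-X.d (n + 1) (n + 1 + 1) rfl x, a₁.app ⟨⟩ c (n + 1) x) =
        W₂.d n (n + 1) rfl (a₂.app ⟨⟩ c n (x, 0)) := fun c n x => by
    rw [← a₂.app_d]
    change _ = a₂.app ⟨⟩ c (n + 1) (coneD a₁ ⟨⟩ c n (n + 1) rfl (x, 0))
    rw [coneD_apply, map_zero, add_zero]
  -- The composite of `a₁` with `coneInr a₁` is null in the cone of `a₁`, through the inclusion of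
  -- `X[1]`. Applying `a₂` to this null-homotopy gives the second component of `α`.
  let α : X.shift 1 ⟶ cone (coneInr a₁ ≫ a₂) := coneLift (coneInr a₁ ≫ a₂) a₁
    (fun c n => -(a₂.app ⟨⟩ c n ∘ₗ LinearMap.inl k _ _))
    (by
      intro c n x
      change a₂.app ⟨⟩ c (n + 1) (0, a₁.app ⟨⟩ c (n + 1) x) =
        -W₂.d n (n + 1) rfl (-a₂.app ⟨⟩ c n (x, 0)) -
          -a₂.app ⟨⟩ c (n + 1) (X.d (n + 1) (n + 1 + 1) rfl x, 0)
      rw [map_neg, neg_neg, ← ha₂, sub_neg_eq_add, ← map_add]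
      congr 1
      exact Prod.ext (neg_add_cancel _).symm (add_zero _).symm)
    (by
      intro c c' p q n h x a
      have e := a₂.app_ract (b := ⟨⟩) p q n h ((x, 0) : (cone a₁).obj ⟨⟩ c p) a
      change -a₂.app ⟨⟩ c' n (X.ract (p + 1) q (n + 1) _ x a, 0) =
        W₂.ract p q n h (-a₂.app ⟨⟩ c p (x, 0)) a
      rw [map_neg, LinearMap.neg_apply, ← e]
      congr 2
      refine Prod.ext rfl ?_
      change 0 = W₁.ract p q n h 0 a
      rw [map_zero, LinearMap.zero_apply])
  let β : cone (coneInr a₁ ≫ a₂) ⟶ cone g := coneMap (coneInr a₁ ≫ a₂) g b₁ b₂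
    (fun c n => -(K.app c (n + 1) n rfl ∘ₗ LinearMap.inr k _ _))
    (by
      intro c n w
      change b₂.app ⟨⟩ c (n + 1) (a₂.app ⟨⟩ c (n + 1) (0, w)) =
        g.app ⟨⟩ c (n + 1) (b₁.app ⟨⟩ c (n + 1) w) +
          (N.d n (n + 1) rfl (-K.app c (n + 1) n rfl (0, w)) +
            -K.app c (n + 1 + 1) (n + 1) rfl (0, W₁.d (n + 1) (n + 1 + 1) rfl w))
      rw [map_neg, ← neg_add, ← hKw, neg_sub, add_sub_cancel])
    (by
      intro c c' p q n h w a
      have e := K.app_ract (p + 1) q (n + 1) p n (by omega) rfl rfl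
        ((0, w) : (cone a₁).obj ⟨⟩ c (p + 1)) a
      change -K.app c' (n + 1) n rfl (0, W₁.ract (p + 1) q (n + 1) _ w a) =
        N.ract p q n h (-K.app c (p + 1) p rfl (0, w)) a
      rw [map_neg, LinearMap.neg_apply, ← e]
      congr 2
      refine Prod.ext ?_ rfl
      change 0 = X.ract (p + 1 + 1) q (n + 1 + 1) _ 0 a
      rw [map_zero, LinearMap.zero_apply])
  have hαβ : ∀ c n (x : X.obj ⟨⟩ c (n + 1)), (α ≫ β).app ⟨⟩ c n x =
      (b₁.app ⟨⟩ c (n + 1) (a₁.app ⟨⟩ c (n + 1) x),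
        b₂.app ⟨⟩ c n (-a₂.app ⟨⟩ c n (x, 0)) +
          -K.app c (n + 1) n rfl (0, a₁.app ⟨⟩ c (n + 1) x)) := fun c n x => by
    rw [comp_app_apply]
    exact coneMap_app _ _ _ _ _ _ _ c n _
  refine ⟨cone (coneInr a₁ ≫ a₂), hW₁.cone hW₂, ⟨W₁, hWA, W₂, hWB, _, rfl⟩, α, β, ?_⟩
  rw [← hff', eq_comm, Q_map_eq_iff]
  -- Both morphisms have the same `M[1]` component, so the homotopy takes values in the summand `N`
  -- only. It is the negative of `K` on `X[1]`.
  refine ⟨⟨fun c p q e => -(LinearMap.inr k _ _ ∘ₗ K.app c p q e ∘ₗ LinearMap.inl k _ _), ?_⟩, ?_⟩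
  · intro c c' p q n p' n' h hp hn x a
    have e := K.app_ract p q n p' n' h hp hn ((x, 0) : (cone a₁).obj ⟨⟩ c p) a
    have e' : (cone a₁).ract p q n h ((x, 0) : (cone a₁).obj ⟨⟩ c p) a =
        ((X.shift 1).ract p q n h x a, 0) := by
      refine Prod.ext rfl ?_
      change W₁.ract p q n h 0 a = 0
      rw [map_zero, LinearMap.zero_apply]
    rw [e'] at e
    refine Prod.ext ?_ ?_
    · change -(0 : M.obj ⟨⟩ c' (n' + 1)) = M.ract (p' + 1) q (n' + 1) _ (-0) a
      rw [neg_zero, neg_zero, map_zero, LinearMap.zero_apply]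
    · change -K.app c' n n' hn _ = N.ract p' q n' _ (-K.app c p p' hp (x, 0)) a
      rw [map_neg, LinearMap.neg_apply, ← e]
      rfl
  · intro c p q r hq hr x
    subst hq
    subst hr
    rw [sub_app_apply, hαβ, shift_one_d]
    refine Prod.ext ?_ ?_
    · change (f'.app ⟨⟩ c (q + 1) x).1 - _ = -M.d (q + 1) (q + 1 + 1) rfl (-0) + -0
      rw [hf'1, sub_self, neg_zero, map_zero, neg_zero, add_zero]
    · change (f'.app ⟨⟩ c (q + 1) x).2 - (b₂.app ⟨⟩ c (q + 1) (-a₂.app ⟨⟩ c (q + 1) (x, 0)) +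
          -K.app c (q + 1 + 1) (q + 1) rfl (0, a₁.app ⟨⟩ c (q + 1 + 1) x)) =
        g.app ⟨⟩ c (q + 1) (-0) + N.d q (q + 1) rfl (-K.app c (q + 1) q rfl (x, 0)) +
          -K.app c (q + 1 + 1) (q + 1) rfl (-X.d (q + 1 + 1) (q + 1 + 1 + 1) rfl x, 0)
      have e := hKx c q x
      have e' : K.app c (q + 1 + 1) (q + 1) rfl
          (-X.d (q + 1 + 1) (q + 1 + 1 + 1) rfl x, a₁.app ⟨⟩ c (q + 1 + 1) x) =
          K.app c (q + 1 + 1) (q + 1) rfl (-X.d (q + 1 + 1) (q + 1 + 1 + 1) rfl x, 0) +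
          K.app c (q + 1 + 1) (q + 1) rfl (0, a₁.app ⟨⟩ c (q + 1 + 1) x) := by
        rw [← map_add]
        congr 1
        exact Prod.ext (add_zero _).symm (zero_add _).symm
      rw [e', sub_eq_iff_eq_add] at e
      rw [neg_zero, map_zero, map_neg, map_neg, ← neg_neg (f'.app ⟨⟩ c (q + 1) x).2, e]
      abel

end Fact

/-! ### Functoriality of convolution in the bimodule; h-flatness. -/

section Convolution

variable {k : Type u} [Field k] {B C : DGCategory k}

theorem tensor_ext {X : DGModule B} {K : DGBimodule B C} {Z : DGModule C} {f g : tensor X K ⟶ Z}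
    (h : ∀ (b : B.Obj) (c : C.Obj) (p q n : ℤ) (e : p + q = n) (x : X.obj ⟨⟩ b p)
      (y : K.obj b c q),
      f.app ⟨⟩ c n (tmul X K p q n e x y) = g.app ⟨⟩ c n (tmul X K p q n e x y)) : f = g :=
  hom_ext_app fun ⟨⟩ c n => LinearMap.congr_fun (tensor_hom_ext fun b p q e x y =>
    h b c p q n e x y)

/-- The morphism of right modules `X ⊗ K ⟶ Z` given by a compatible family of balanced bilinear
maps. -/
noncomputable def tensorDesc {X : DGModule B} {K : DGBimodule B C} {Z : DGModule C}
    (φ : ∀ (b : B.Obj) (c : C.Obj) (p q n : ℤ), p + q = n →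
      (X.obj ⟨⟩ b p →ₗ[k] K.obj b c q →ₗ[k] Z.obj ⟨⟩ c n))
    (hφ : ∀ (c : C.Obj) (b b' : B.Obj) (p r q s t n : ℤ) (hs : p + r = s) (ht : r + q = t)
      (hn : p + t = n) (x : X.obj ⟨⟩ b' p) (g : B.Hom b b' r) (y : K.obj b c q),
      φ b c s q n (by omega) (X.ract p r s hs x g) y =
        φ b' c p t n hn x (K.lact r q t ht g y))
    (hd : ∀ (b : B.Obj) (c : C.Obj) (p q n : ℤ) (e : p + q = n) (x : X.obj ⟨⟩ b p)
      (y : K.obj b c q), Z.d n (n + 1) rfl (φ b c p q n e x y) =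
        φ b c (p + 1) q (n + 1) (by omega) (X.d p (p + 1) rfl x) y +
        koszulSign k p • φ b c p (q + 1) (n + 1) (by omega) x (K.d q (q + 1) rfl y))
    (hr : ∀ (b : B.Obj) (c c' : C.Obj) (p q r n : ℤ) (e : p + q = n) (x : X.obj ⟨⟩ b p)
      (y : K.obj b c q) (a : C.Hom c' c r), Z.ract n r (n + r) rfl (φ b c p q n e x y) a =
        φ b c' p (q + r) (n + r) (by omega) x (K.ract q r (q + r) rfl y a)) :
    tensor X K ⟶ Z :=
  homMk
    (fun c n => tensorLift (fun b p q e => φ b c p q n e) (fun b b' p r q s t hs ht hn => hφ c b b' p r q s t n hs ht hn))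
    (by
      intro c n n' h m
      subst h
      refine LinearMap.congr_fun
        (f := tensorLift (fun b p q e => φ b c p q (n + 1) e)
          (fun b b' p r q s t hs ht hn => hφ c b b' p r q s t (n + 1) hs ht hn) ∘ₗ tensorD X K ⟨⟩ c n (n + 1) rfl)
        (g := Z.d n (n + 1) rfl ∘ₗ tensorLift (fun b p q e => φ b c p q n e)
          (fun b b' p r q s t hs ht hn => hφ c b b' p r q s t n hs ht hn))
        (tensor_hom_ext ?_) m
      intro b p q e x y
      simp only [LinearMap.comp_apply]
      rw [tensorD_tmul X K p q n (p + 1) (q + 1) (n + 1) e rfl rfl rfl, map_add, map_smul,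
        tensorLift_tmul, tensorLift_tmul, tensorLift_tmul, hd])
    (by
      intro c c' n r n' h m a
      subst h
      refine LinearMap.congr_fun
        (f := tensorLift (fun b p q e => φ b c' p q (n + r) e)
          (fun b b' p l q s t hs ht hn => hφ c' b b' p l q s t (n + r) hs ht hn) ∘ₗ
          (tensorRact X K n r (n + r) rfl).flip a)
        (g := (Z.ract n r (n + r) rfl).flip a ∘ₗ tensorLift (fun b p q e => φ b c p q n e)
          (fun b b' p l q s t hs ht hn => hφ c b b' p l q s t n hs ht hn))
        (tensor_hom_ext ?_) m
      intro b p q e x y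
      simp only [LinearMap.comp_apply, LinearMap.flip_apply]
      rw [tensorRact_tmul X K p q r n (q + r) (n + r) e rfl rfl, tensorLift_tmul,
        tensorLift_tmul, hr])

theorem tensorDesc_tmul {X : DGModule B} {K : DGBimodule B C} {Z : DGModule C} (φ) (hφ) (hd) (hr)
    (b : B.Obj) (c : C.Obj) (p q n : ℤ) (e : p + q = n) (x : X.obj ⟨⟩ b p) (y : K.obj b c q) :
    (tensorDesc (X := X) (K := K) (Z := Z) φ hφ hd hr).app ⟨⟩ c n (tmul X K p q n e x y) =
      φ b c p q n e x y :=
  tensorLift_tmul (fun b p q e => φ b c p q n e)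
    (fun b b' p r q s t hs ht hn => hφ c b b' p r q s t n hs ht hn) p q e x y

variable (X : DGModule B) {K L : DGBimodule B C}

/-- The functoriality of `X ⊗ K` in `K`. -/
noncomputable def tensorMap (f : K ⟶ L) : tensor X K ⟶ tensor X L :=
  tensorDesc (fun b c p q n e => (tmul X L p q n e).compl₂ (f.app b c q))
    (by
      intro c b b' p r q s t n hs ht hn x g y
      simp only [LinearMap.compl₂_apply]
      rw [f.app_lact, tmul_balanced X L p r q s t n hs ht hn])
    (by
      intro b c p q n e x y
      simp only [LinearMap.compl₂_apply]
      rw [f.app_d]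
      exact tensorD_tmul X L p q n (p + 1) (q + 1) (n + 1) e rfl rfl rfl x _)
    (by
      intro b c c' p q r n e x y a
      simp only [LinearMap.compl₂_apply]
      rw [f.app_ract]
      exact tensorRact_tmul X L p q r n (q + r) (n + r) e rfl rfl x _ a)

theorem tensorMap_tmul (f : K ⟶ L) (b : B.Obj) (c : C.Obj) (p q n : ℤ) (e : p + q = n)
    (x : X.obj ⟨⟩ b p) (y : K.obj b c q) :
    (tensorMap X f).app ⟨⟩ c n (tmul X K p q n e x y) = tmul X L p q n e x (f.app b c q y) :=
  tensorDesc_tmul _ _ _ _ b c p q n e x y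

theorem tensorMap_id : tensorMap X (𝟙 K) = 𝟙 (tensor X K) :=
  tensor_ext fun b c p q n e x y => tensorMap_tmul X (𝟙 K) b c p q n e x y

theorem tensorMap_comp {L' : DGBimodule B C} (f : K ⟶ L) (g : L ⟶ L') :
    tensorMap X (f ≫ g) = tensorMap X f ≫ tensorMap X g :=
  tensor_ext fun b c p q n e x y => by
    rw [comp_app_apply, tensorMap_tmul, tensorMap_tmul, tensorMap_tmul, comp_app_apply]

section Restrict

/-- The left module `N(-, c)` of a bimodule `N`. -/
@[reducible] def restrict (N : DGBimodule B C) (c : C.Obj) :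
    DGBimodule B (DGCategory.unit k) where
  obj := fun b _ n => N.obj b c n
  d := fun p q h => N.d p q h
  lact := fun p q n h => N.lact p q n h
  ract := fun {b _ _} p q n h => (scalarAct (fun n => N.obj b c n) q p n (by omega)).flip
  d_d := N.d_d
  d_lact := N.d_lact
  d_ract := by
    intro b _ _ p q n p' q' n' h hp hq hn m f
    have e := scalarAct_comm (fun n => N.obj b c n) (W := fun n => N.obj b c n) 1
      (fun q s h => N.d q s h) q p n p' n' (by omega) hp (by omega) f m
    have e' : scalarAct (k := k) (fun n => N.obj b c n) q' p n' (by omega) 0 m = 0 := by simp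
    refine e.trans ((add_zero _).symm.trans ?_)
    refine congrArg (_ + ·) ?_
    exact (((congrArg (koszulSign k p • ·) e').trans (smul_zero _))).symm
  lact_lact := N.lact_lact
  ract_ract := by
    intro b _ _ _ p q r s t n hs ht hn m f f'
    exact (scalarAct_scalarAct (fun n => N.obj b c n) r q p t s n (by omega) (by omega)
      (by omega) f' f _ m (mul_comm _ _)).symm
  lact_ract := by
    intro b b' _ _ p q r s t n hs ht hn g m f
    exact (scalarAct_comm (fun n => N.obj b c n) (W := fun n => N.obj b' c n) p
      (fun q s h => N.lact p q s (by omega) g) r q t s n (by omega) (by omega) (by omega) f m).symm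
  one_lact := N.one_lact
  ract_one := by
    intro b _ p m
    exact (scalarAct_zero (k := k) (fun n => N.obj b c n) p (zero_add p) _ m).trans (one_smul k _)

/-- The complex of `X ⊗ N` at `c` involves only the left module `N(-, c)`. The definition of
h-flatness, stated for left modules, therefore covers bimodules. -/
theorem IsHFlat.isAcyclic_tensor {X : DGModule B} (hX : IsHFlat X) {N : DGBimodule B C}
    (hN : N.IsAcyclic) : (tensor X N).IsAcyclic := by
  intro _ c
  exact hX (restrict N c) (fun b _ => hN b c) ⟨⟩ ⟨⟩

end Restrict

end Convolution

/-! ### Convolution and shifts. -/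

section Shift

variable {k : Type u} [Field k] {B C : DGCategory k}

/-- An element of degree `q`, as an element of degree `q - i` of the shift by `i`. -/
def shiftIn (M : DGBimodule B C) {b : B.Obj} {c : C.Obj} (i q q' : ℤ) (h : q' + i = q) :
    M.obj b c q →ₗ[k] (M.shift i).obj b c q' := by
  subst h
  exact LinearMap.id

variable {M : DGBimodule B C}

theorem d_shiftIn {b : B.Obj} {c : C.Obj} (i q q' r r' : ℤ) (h : q' + i = q) (h' : r' + i = r)
    (e : q + 1 = r) (e' : q' + 1 = r') (m : M.obj b c q) :
    (M.shift i).d q' r' e' (shiftIn M i q q' h m) =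
      koszulSign k i • shiftIn M i r r' h' (M.d q r e m) := by
  subst h
  subst h'
  rfl

theorem lact_shiftIn {b b' : B.Obj} {c : C.Obj} (i p q q' n n' : ℤ) (h : q' + i = q)
    (h' : n' + i = n) (e : p + q = n) (e' : p + q' = n') (g : B.Hom b b' p) (m : M.obj b c q) :
    (M.shift i).lact p q' n' e' g (shiftIn M i q q' h m) =
      koszulSign k (i * p) • shiftIn M i n n' h' (M.lact p q n e g m) := by
  subst h
  subst h'
  rfl

theorem ract_shiftIn {b : B.Obj} {c c' : C.Obj} (i q q' r n n' : ℤ) (h : q' + i = q)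
    (h' : n' + i = n) (e : q + r = n) (e' : q' + r = n') (m : M.obj b c q) (a : C.Hom c' c r) :
    (M.shift i).ract q' r n' e' (shiftIn M i q q' h m) a =
      shiftIn M i n n' h' (M.ract q r n e m a) := by
  subst h
  subst h'
  rfl

variable (X : DGModule B) (K : DGBimodule B C) (i : ℤ)

/-- The comparison `X ⊗ K[i] ⟶ (X ⊗ K)[i]`. -/
noncomputable def tensorShiftHom : tensor X (K.shift i) ⟶ (tensor X K).shift i :=
  tensorDesc
    -- The sign comes from moving the shift of degree `i` past `x` of degree `p`. It compensates the
    -- twisted left action on `K[i]`.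
    (fun b c p q n e => koszulSign k (i * p) • tmul X K p (q + i) (n + i) (by omega))
    (by
      intro c b b' p r q s t n hs ht hn x g y
      have e1 := tmul_balanced X K p r (q + i) s (t + i) (n + i) hs (by omega) (by omega) x g y
      subst hs
      simp only [LinearMap.smul_apply, map_smul]
      rw [e1, mul_add, koszulSign_add, smul_smul, mul_comm (koszulSign k (i * r))])
    (by
      intro b c p q n e x y
      have e1 := tensorD_tmul X K p (q + i) (n + i) (p + 1) (q + 1 + i) (n + 1 + i) (by omega) rfl
        (by omega) (by omega) x y
      simp only [LinearMap.smul_apply, map_smul]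
      rw [e1, mul_add, mul_one, koszulSign_add]
      module)
    (by
      intro b c c' p q r n e x y a
      have e1 := tensorRact_tmul X K p (q + i) r (n + i) (q + r + i) (n + r + i) (by omega)
        (by omega) (by omega) x y a
      simp only [LinearMap.smul_apply, map_smul]
      rw [e1])

/-- The components of the comparison `(X ⊗ K)[i] ⟶ X ⊗ K[i]`. -/
noncomputable def tensorShiftInvApp (c : C.Obj) (n : ℤ) :
    TensorObj X K ⟨⟩ c (n + i) →ₗ[k] TensorObj X (K.shift i) ⟨⟩ c n :=
  tensorLift (fun b p q e => koszulSign k (i * p) •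
      (tmul X (K.shift i) p (q - i) n (by omega)).compl₂ (shiftIn K i q (q - i) (by omega)))
    (by
      intro b b' p r q s t hs ht hn x g y
      have e1 := tmul_balanced X (K.shift i) p r (q - i) s (t - i) n hs (by omega) (by omega) x g
        (shiftIn K i q (q - i) (by omega) y)
      rw [lact_shiftIn i r q (q - i) t (t - i) (by omega) (by omega) ht (by omega)] at e1
      subst hs
      simp only [LinearMap.smul_apply, LinearMap.compl₂_apply]
      rw [e1, map_smul, smul_smul, mul_add, koszulSign_add, mul_assoc, koszulSign_mul_self,
        mul_one])

theorem tensorShiftInvApp_tmul {b : B.Obj} {c : C.Obj} (n p q q' : ℤ) (e : p + q = n + i)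
    (e' : q' + i = q) (x : X.obj ⟨⟩ b p) (y : K.obj b c q) :
    tensorShiftInvApp X K i c n (tmul X K p q (n + i) e x y) =
      koszulSign k (i * p) • tmul X (K.shift i) p q' n (by omega) x (shiftIn K i q q' e' y) := by
  obtain rfl : q' = q - i := by omega
  rw [tensorShiftInvApp, tensorLift_tmul]
  rfl

/-- The comparison `(X ⊗ K)[i] ⟶ X ⊗ K[i]`. -/
noncomputable def tensorShiftInv : (tensor X K).shift i ⟶ tensor X (K.shift i) :=
  homMk (tensorShiftInvApp X K i)
    (by
      intro c n n' h m
      subst h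
      refine LinearMap.congr_fun
        (f := tensorShiftInvApp X K i c (n + 1) ∘ₗ
          (koszulSign k i • tensorD X K ⟨⟩ c (n + i) (n + 1 + i) (by omega)))
        (g := tensorD X (K.shift i) ⟨⟩ c n (n + 1) rfl ∘ₗ tensorShiftInvApp X K i c n)
        (tensor_hom_ext ?_) m
      intro b p q e x y
      simp only [LinearMap.comp_apply, LinearMap.smul_apply, map_smul]
      rw [tensorD_tmul X K p q (n + i) (p + 1) (q + 1) (n + 1 + i) e rfl rfl, map_add, map_smul,
        tensorShiftInvApp_tmul X K i (n + 1) (p + 1) q (q - i) (by omega) (by omega),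
        tensorShiftInvApp_tmul X K i (n + 1) p (q + 1) (q + 1 - i) (by omega) (by omega),
        tensorShiftInvApp_tmul X K i n p q (q - i) e (by omega), map_smul,
        tensorD_tmul X (K.shift i) p (q - i) n (p + 1) (q + 1 - i) (n + 1) (by omega) rfl
          (by omega) rfl,
        d_shiftIn i q (q - i) (q + 1) (q + 1 - i) (by omega) (by omega) rfl, map_smul, mul_add,
        mul_one, koszulSign_add]
      simp only [smul_add, smul_smul]
      congr 2
      · rw [mul_comm, mul_assoc, koszulSign_mul_self, mul_one]
      · ring)
    (by
      intro c c' n r n' h m a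
      subst h
      refine LinearMap.congr_fun
        (f := tensorShiftInvApp X K i c' (n + r) ∘ₗ
          (tensorRact X K (n + i) r (n + r + i) (by omega)).flip a)
        (g := (tensorRact X (K.shift i) n r (n + r) rfl).flip a ∘ₗ tensorShiftInvApp X K i c n)
        (tensor_hom_ext ?_) m
      intro b p q e x y
      simp only [LinearMap.comp_apply, LinearMap.flip_apply]
      rw [tensorRact_tmul X K p q r (n + i) (q + r) (n + r + i) e rfl,
        tensorShiftInvApp_tmul X K i (n + r) p (q + r) (q + r - i) (by omega) (by omega),
        tensorShiftInvApp_tmul X K i n p q (q - i) e (by omega), map_smul, LinearMap.smul_apply,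
        tensorRact_tmul X (K.shift i) p (q - i) r n (q + r - i) (n + r) (by omega) (by omega) rfl,
        ract_shiftIn i q (q - i) r (q + r) (q + r - i) (by omega) (by omega) rfl])

/-- One of the two identities is enough: it makes `X ⊗ K[i]` a retract of `(X ⊗ K)[i]`, and
`FactorsThrough` is closed under retracts. The same holds for direct sums and for the diagonal
below. -/
theorem tensorShiftHom_inv : tensorShiftHom X K i ≫ tensorShiftInv X K i = 𝟙 _ := by
  refine tensor_ext fun b c p q n e x y => ?_
  rw [comp_app_apply, tensorShiftHom, tensorDesc_tmul]
  change tensorShiftInvApp X K i c n (koszulSign k (i * p) • tmul X K p (q + i) (n + i) _ x y) = _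
  rw [map_smul, tensorShiftInvApp_tmul X K i n p (q + i) q _ rfl, smul_smul, koszulSign_mul_self,
    one_smul]
  rfl

end Shift

/-! ### Convolution and direct sums. -/

section DirectSum

variable {k : Type u} [Field k] {B C : DGCategory k} (X : DGModule B) {ι : Type u}
  (K : ι → DGBimodule B C)

variable {K} in
/-- The bilinear map to a direct sum given by a family of bilinear maps. -/
noncomputable def dsumBilin {V : Type u} [AddCommGroup V] [Module k V] {Z : ι → DGModule C}
    {b : B.Obj} {c : C.Obj} {q n : ℤ}
    (φ : ∀ i, V →ₗ[k] (K i).obj b c q →ₗ[k] (Z i).obj ⟨⟩ c n) :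
    V →ₗ[k] (dsum K).obj b c q →ₗ[k] (dsum Z).obj ⟨⟩ c n :=
  LinearMap.mk₂ k (fun x m => DFinsupp.mapRange.linearMap (fun i => φ i x) m)
    (by intros; ext i; simp) (by intros; ext i; simp)
    (by intros; ext i; simp) (by intros; ext i; simp)

variable {K} in
theorem dsumBilin_dsumι {V : Type u} [AddCommGroup V] [Module k V] {Z : ι → DGModule C}
    {b : B.Obj} {c : C.Obj} {q n : ℤ}
    (φ : ∀ i, V →ₗ[k] (K i).obj b c q →ₗ[k] (Z i).obj ⟨⟩ c n) (x : V) (i : ι)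
    (m : (K i).obj b c q) :
    dsumBilin φ x ((dsumι K i).app b c q m) = (dsumι Z i).app ⟨⟩ c n (φ i x m) := by
  classical
  exact DFinsupp.mapRange_single (f := fun i => ⇑(φ i x)) (hf := fun i => map_zero (φ i x))

/-- The comparison `X ⊗ ⨁ K i ⟶ ⨁ X ⊗ K i`. -/
noncomputable def tensorDsumHom : tensor X (dsum K) ⟶ dsum fun i => tensor X (K i) :=
  tensorDesc
    (fun b c p q n e => dsumBilin (Z := fun i => tensor X (K i)) fun i => tmul X (K i) p q n e)
    (by
      intro c b b' p r q s t n hs ht hn x g y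
      refine DFinsupp.ext fun i => ?_
      exact tmul_balanced X (K i) p r q s t n hs ht hn x g (y i))
    (by
      intro b c p q n e x y
      refine DFinsupp.ext fun i => ?_
      exact tensorD_tmul X (K i) p q n (p + 1) (q + 1) (n + 1) e rfl rfl rfl x (y i))
    (by
      intro b c c' p q r n e x y a
      refine DFinsupp.ext fun i => ?_
      exact tensorRact_tmul X (K i) p q r n (q + r) (n + r) e rfl rfl x (y i) a)

theorem tensorDsumHom_desc :
    tensorDsumHom X K ≫ dsumDesc (fun i => tensorMap X (dsumι K i)) = 𝟙 _ := by
  classical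
  refine tensor_ext fun b c p q n e x y => ?_
  refine LinearMap.congr_fun
    (f := ((tensorDsumHom X K ≫ dsumDesc (fun i => tensorMap X (dsumι K i))).app ⟨⟩ c n) ∘ₗ
      tmul X (dsum K) p q n e x)
    (g := tmul X (dsum K) p q n e x) (dsum_linearMap_ext fun i m => ?_) y
  rw [LinearMap.comp_apply, comp_app_apply, tensorDsumHom, tensorDesc_tmul]
  have e1 := dsumBilin_dsumι (Z := fun i => tensor X (K i)) (fun i => tmul X (K i) p q n e) x i m
  refine (congrArg _ e1).trans ?_
  rw [← comp_app_apply, dsumι_desc, tensorMap_tmul]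

end DirectSum

/-! ### Convolution and mapping cones. -/

section Cone

variable {k : Type u} [Field k] {B C : DGCategory k} {M N : DGBimodule B C}

/-- The inclusion of the shifted source in the mapping cone. -/
def coneInl (f : M ⟶ N) {b : B.Obj} {c : C.Obj} (q q' : ℤ) (h : q' + 1 = q) :
    M.obj b c q →ₗ[k] (cone f).obj b c q' := by
  subst h
  exact LinearMap.inl k _ _

theorem d_coneInl (f : M ⟶ N) {b : B.Obj} {c : C.Obj} (q q' r : ℤ) (h : q' + 1 = q)
    (hr : q + 1 = r) (m : M.obj b c q) :
    (cone f).d q' q h (coneInl f q q' h m) =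
      -coneInl f r q hr (M.d q r hr m) + (coneInr f).app b c q (f.app b c q m) := by
  subst h
  subst hr
  change coneD f b c q' (q' + 1) rfl (m, 0) = -(_, 0) + (0, _)
  rw [coneD_apply, map_zero, add_zero]
  exact Prod.ext (add_zero _).symm (by simp)

theorem lact_coneInl (f : M ⟶ N) {b b' : B.Obj} {c : C.Obj} (p q q' n n' : ℤ) (h : q' + 1 = q)
    (h' : n' + 1 = n) (e : p + q = n) (e' : p + q' = n') (g : B.Hom b b' p) (m : M.obj b c q) :
    (cone f).lact p q' n' e' g (coneInl f q q' h m) =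
      koszulSign k p • coneInl f n n' h' (M.lact p q n e g m) := by
  subst h
  subst h'
  refine Prod.ext rfl ?_
  change N.lact p q' n' e' g 0 = koszulSign k p • 0
  rw [map_zero, smul_zero]

theorem ract_coneInl (f : M ⟶ N) {b : B.Obj} {c c' : C.Obj} (q q' r n n' : ℤ) (h : q' + 1 = q)
    (h' : n' + 1 = n) (e : q + r = n) (e' : q' + r = n') (m : M.obj b c q) (a : C.Hom c' c r) :
    (cone f).ract q' r n' e' (coneInl f q q' h m) a =
      coneInl f n n' h' (M.ract q r n e m a) := by
  subst h
  subst h'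
  refine Prod.ext rfl ?_
  change N.ract q' r n' e' 0 a = 0
  rw [map_zero, LinearMap.zero_apply]

theorem cone_lact_apply (f : M ⟶ N) {b b' : B.Obj} {c : C.Obj} (p q n : ℤ) (h : p + q = n)
    (g : B.Hom b b' p) (m : (cone f).obj b c q) :
    (cone f).lact p q n h g m =
      (koszulSign k p • M.lact p (q + 1) (n + 1) (by omega) g m.1, N.lact p q n h g m.2) := rfl

theorem cone_ract_apply (f : M ⟶ N) {b : B.Obj} {c c' : C.Obj} (p q n : ℤ) (h : p + q = n)
    (m : (cone f).obj b c p) (a : C.Hom c' c q) :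
    (cone f).ract p q n h m a =
      (M.ract (p + 1) q (n + 1) (by omega) m.1 a, N.ract p q n h m.2 a) := rfl

theorem cone_d_apply (f : M ⟶ N) {b : B.Obj} {c : C.Obj} (p : ℤ) (m : (cone f).obj b c p) :
    (cone f).d p (p + 1) rfl m =
      (-M.d (p + 1) (p + 1 + 1) rfl m.1, f.app b c (p + 1) m.1 + N.d p (p + 1) rfl m.2) :=
  coneD_apply f b c p m

/-- The bilinear map to a mapping cone given by a pair of bilinear maps. -/
def coneBilin {f : M ⟶ N} {M' N' : DGModule C} {f' : M' ⟶ N'} {V : Type u} [AddCommGroup V]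
    [Module k V] {b : B.Obj} {c : C.Obj} {q n : ℤ}
    (φ : V →ₗ[k] M.obj b c (q + 1) →ₗ[k] M'.obj ⟨⟩ c (n + 1))
    (ψ : V →ₗ[k] N.obj b c q →ₗ[k] N'.obj ⟨⟩ c n) :
    V →ₗ[k] (cone f).obj b c q →ₗ[k] (cone f').obj ⟨⟩ c n :=
  LinearMap.mk₂ k (fun x y => (φ x y.1, ψ x y.2))
    (by intros; ext <;> simp) (by intros; ext <;> simp)
    (by intros; ext <;> simp) (by intros; ext <;> simp)

theorem coneBilin_apply {f : M ⟶ N} {M' N' : DGModule C} {f' : M' ⟶ N'} {V : Type u}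
    [AddCommGroup V] [Module k V] {b : B.Obj} {c : C.Obj} {q n : ℤ}
    (φ : V →ₗ[k] M.obj b c (q + 1) →ₗ[k] M'.obj ⟨⟩ c (n + 1))
    (ψ : V →ₗ[k] N.obj b c q →ₗ[k] N'.obj ⟨⟩ c n) (x : V) (y : (cone f).obj b c q) :
    coneBilin (f := f) (f' := f') φ ψ x y = (φ x y.1, ψ x y.2) := rfl

variable (X : DGModule B) (f : M ⟶ N)

/-- The comparison `X ⊗ cone f ⟶ cone (X ⊗ f)`. -/
noncomputable def tensorConeHom : tensor X (cone f) ⟶ cone (tensorMap X f) :=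
  tensorDesc
    (fun b c p q n e => coneBilin (M' := tensor X M) (N' := tensor X N)
      (koszulSign k p • tmul X M p (q + 1) (n + 1) (by omega)) (tmul X N p q n e))
    (by
      intro c b b' p r q s t n hs ht hn x g y
      have e1 := tmul_balanced X M p r (q + 1) s (t + 1) (n + 1) hs (by omega) (by omega) x g y.1
      have e2 := tmul_balanced X N p r q s t n hs ht hn x g y.2
      subst hs
      rw [coneBilin_apply, coneBilin_apply, cone_lact_apply, e2]
      simp only [LinearMap.smul_apply, map_smul]
      rw [e1, koszulSign_add, smul_smul, mul_comm])
    (by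
      intro b c p q n e x y
      have e1 := tensorD_tmul X M p (q + 1) (n + 1) (p + 1) (q + 1 + 1) (n + 1 + 1) (by omega) rfl
        rfl rfl x y.1
      have e2 := tensorD_tmul X N p q n (p + 1) (q + 1) (n + 1) e rfl rfl rfl x y.2
      have e3 := tensorMap_tmul X f b c p (q + 1) (n + 1) (by omega) x y.1
      rw [cone_d_apply, coneBilin_apply, coneBilin_apply, coneBilin_apply, cone_d_apply]
      simp only [LinearMap.smul_apply, map_smul, map_neg, map_add]
      rw [e1, e2, e3, koszulSign_succ]
      refine Prod.ext ?_ ?_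
      · simp only [Prod.fst_add, Prod.smul_fst]
        module
      · simp only [Prod.snd_add, Prod.smul_snd]
        module)
    (by
      intro b c c' p q r n e x y a
      have e1 := tensorRact_tmul X M p (q + 1) r (n + 1) (q + r + 1) (n + r + 1) (by omega)
        (by omega) (by omega) x y.1 a
      have e2 := tensorRact_tmul X N p q r n (q + r) (n + r) e rfl rfl x y.2 a
      rw [coneBilin_apply, cone_ract_apply, coneBilin_apply, cone_ract_apply]
      simp only [LinearMap.smul_apply, map_smul]
      rw [e1, e2])

theorem tensorConeHom_tmul (b : B.Obj) (c : C.Obj) (p q n : ℤ) (e : p + q = n)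
    (x : X.obj ⟨⟩ b p) (y : (cone f).obj b c q) :
    (tensorConeHom X f).app ⟨⟩ c n (tmul X (cone f) p q n e x y) =
      (koszulSign k p • tmul X M p (q + 1) (n + 1) (by omega) x y.1, tmul X N p q n e x y.2) := by
  rw [tensorConeHom, tensorDesc_tmul]
  rfl

/-- The first component of the comparison `cone (X ⊗ f) ⟶ X ⊗ cone f`. -/
noncomputable def tensorConeInvApp (c : C.Obj) (n : ℤ) :
    TensorObj X M ⟨⟩ c (n + 1) →ₗ[k] TensorObj X (cone f) ⟨⟩ c n :=
  tensorLift (fun b p q e => koszulSign k p •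
      (tmul X (cone f) p (q - 1) n (by omega)).compl₂ (coneInl f q (q - 1) (by omega)))
    (by
      intro b b' p r q s t hs ht hn x g y
      have e1 := tmul_balanced X (cone f) p r (q - 1) s (t - 1) n hs (by omega) (by omega) x g
        (coneInl f q (q - 1) (by omega) y)
      rw [lact_coneInl f r q (q - 1) t (t - 1) (by omega) (by omega) ht (by omega)] at e1
      subst hs
      simp only [LinearMap.smul_apply, LinearMap.compl₂_apply]
      rw [e1, map_smul, smul_smul, koszulSign_add, mul_assoc, koszulSign_mul_self, mul_one])

theorem tensorConeInvApp_tmul {b : B.Obj} {c : C.Obj} (n p q q' : ℤ) (e : p + q = n + 1)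
    (e' : q' + 1 = q) (x : X.obj ⟨⟩ b p) (y : M.obj b c q) :
    tensorConeInvApp X f c n (tmul X M p q (n + 1) e x y) =
      koszulSign k p • tmul X (cone f) p q' n (by omega) x (coneInl f q q' e' y) := by
  obtain rfl : q' = q - 1 := by omega
  rw [tensorConeInvApp, tensorLift_tmul]
  rfl

/-- The comparison `cone (X ⊗ f) ⟶ X ⊗ cone f`. -/
noncomputable def tensorConeInv : cone (tensorMap X f) ⟶ tensor X (cone f) :=
  coneDesc (tensorMap X f) (tensorMap X (coneInr f)) (tensorConeInvApp X f)
    (by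
      intro c n m
      refine LinearMap.congr_fun
        (f := (tensorMap X (coneInr f)).app ⟨⟩ c (n + 1) ∘ₗ (tensorMap X f).app ⟨⟩ c (n + 1))
        (g := tensorD X (cone f) ⟨⟩ c n (n + 1) rfl ∘ₗ tensorConeInvApp X f c n +
          tensorConeInvApp X f c (n + 1) ∘ₗ tensorD X M ⟨⟩ c (n + 1) (n + 1 + 1) rfl)
        (tensor_hom_ext ?_) m
      intro b p q e x y
      simp only [LinearMap.comp_apply, LinearMap.add_apply]
      rw [tensorMap_tmul, tensorMap_tmul,
        tensorConeInvApp_tmul X f n p q (q - 1) e (by omega), map_smul,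
        tensorD_tmul X (cone f) p (q - 1) n (p + 1) q (n + 1) (by omega) rfl (by omega) rfl,
        d_coneInl f q (q - 1) (q + 1) (by omega) rfl,
        tensorD_tmul X M p q (n + 1) (p + 1) (q + 1) (n + 1 + 1) e rfl rfl rfl,
        map_add (tensorConeInvApp X f c (n + 1)), map_smul,
        tensorConeInvApp_tmul X f (n + 1) (p + 1) q (q - 1) (by omega) (by omega),
        tensorConeInvApp_tmul X f (n + 1) p (q + 1) q (by omega) rfl, koszulSign_succ,
        map_add, map_neg]
      simp only [smul_add, smul_neg, neg_smul, smul_smul, koszulSign_mul_self, one_smul]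
      abel)
    (by
      intro c c' n r n' h m a
      subst h
      refine LinearMap.congr_fun
        (f := tensorConeInvApp X f c' (n + r) ∘ₗ
          (tensorRact X M (n + 1) r (n + r + 1) (by omega)).flip a)
        (g := (tensorRact X (cone f) n r (n + r) rfl).flip a ∘ₗ tensorConeInvApp X f c n)
        (tensor_hom_ext ?_) m
      intro b p q e x y
      simp only [LinearMap.comp_apply, LinearMap.flip_apply]
      rw [tensorRact_tmul X M p q r (n + 1) (q + r) (n + r + 1) e rfl,
        tensorConeInvApp_tmul X f (n + r) p (q + r) (q + r - 1) (by omega) (by omega),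
        tensorConeInvApp_tmul X f n p q (q - 1) e (by omega), map_smul, LinearMap.smul_apply,
        tensorRact_tmul X (cone f) p (q - 1) r n (q + r - 1) (n + r) (by omega) (by omega) rfl,
        ract_coneInl f q (q - 1) r (q + r) (q + r - 1) (by omega) (by omega) rfl])

theorem tensorConeInv_app (c : C.Obj) (n : ℤ) (z : (cone (tensorMap X f)).obj ⟨⟩ c n) :
    (tensorConeInv X f).app ⟨⟩ c n z =
      (tensorMap X (coneInr f)).app ⟨⟩ c n z.2 + tensorConeInvApp X f c n z.1 := rfl

/-- Convolution commutes with mapping cones. -/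
noncomputable def tensorConeIso : tensor X (cone f) ≅ cone (tensorMap X f) where
  hom := tensorConeHom X f
  inv := tensorConeInv X f
  hom_inv_id := by
    refine tensor_ext fun b c p q n e x y => ?_
    rw [comp_app_apply, tensorConeHom_tmul, tensorConeInv_app, tensorMap_tmul, map_smul,
      tensorConeInvApp_tmul X f n p (q + 1) q _ rfl, smul_smul, koszulSign_mul_self, one_smul,
      ← map_add]
    exact congrArg (tmul X (cone f) p q n e x)
      (Prod.ext (zero_add y.1) (add_zero y.2) : ((0, y.2) + (y.1, 0) : _ × _) = y)
  inv_hom_id := by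
    refine hom_ext_app fun b c n z => ?_
    have e1 : tensorMap X (coneInr f) ≫ tensorConeHom X f = coneInr (tensorMap X f) := by
      refine tensor_ext fun b c p q n e x y => ?_
      rw [comp_app_apply, tensorMap_tmul, tensorConeHom_tmul, coneInr_app]
      refine Prod.ext ?_ rfl
      change koszulSign k p • tmul X M _ _ _ _ x 0 = 0
      rw [map_zero, smul_zero]
    have e2 : (tensorConeHom X f).app ⟨⟩ c n ∘ₗ tensorConeInvApp X f c n =
        LinearMap.inl k _ _ := by
      refine tensor_hom_ext fun b p q e x y => ?_
      obtain ⟨q, rfl⟩ : ∃ q', q = q' + 1 := ⟨q - 1, by omega⟩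
      rw [LinearMap.comp_apply, tensorConeInvApp_tmul X f n p (q + 1) q e rfl, map_smul,
        tensorConeHom_tmul]
      refine Prod.ext ?_ ?_
      · change koszulSign k p • koszulSign k p • tmul X M _ _ _ _ x y = _
        rw [smul_smul, koszulSign_mul_self, one_smul]
        rfl
      · change koszulSign k p • tmul X N _ _ _ _ x 0 = 0
        rw [map_zero, smul_zero]
    rw [comp_app_apply, tensorConeInv_app, map_add, ← comp_app_apply, e1, coneInr_app]
    refine (congrArg (_ + ·) (LinearMap.congr_fun e2 z.1)).trans ?_
    exact Prod.ext (zero_add _) (add_zero _)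

-- The cone of `X ⊗ f` is `X ⊗ cone f`, which is acyclic when `X` is h-flat and `cone f` is acyclic.
variable {X f} in
theorem IsHFlat.isQuasiIso_tensorMap (hX : IsHFlat X) (hf : IsQuasiIso f) :
    IsQuasiIso (tensorMap X f) := by
  rw [isQuasiIso_iff_isAcyclic_cone] at hf ⊢
  exact (hX.isAcyclic_tensor hf).of_isQuasiIso (isQuasiIso_of_isIso (tensorConeIso X f).hom)

end Cone

/-! ### Convolution with the diagonal bimodule. -/

section Diagonal

variable {k : Type u} [Field k] {C : DGCategory k} (X : DGModule C)

/-- The map `x ⊗ a ↦ x a`. -/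
noncomputable def tensorDiagonalHom : tensor X C.diagonal ⟶ X :=
  tensorDesc (fun b c p q n e => X.ract p q n e)
    (by
      intro c b b' p r q s t n hs ht hn x g y
      exact X.ract_ract p r q s t n hs ht hn x g y)
    (by
      intro b c p q n e x y
      exact X.d_ract p q n (p + 1) (q + 1) (n + 1) e rfl rfl rfl x y)
    (by
      intro b c c' p q r n e x y a
      exact X.ract_ract p q r n (q + r) (n + r) e rfl (by omega) x y a)

/-- The map `x ↦ x ⊗ 1`. -/
noncomputable def tensorDiagonalInv : X ⟶ tensor X C.diagonal :=
  homMk (fun c n => (tmul X C.diagonal n 0 n (add_zero n)).flip (C.one c))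
    (by
      intro c p q h x
      refine Eq.trans ?_ (tensorD_tmul X C.diagonal p 0 p q 1 q (add_zero p) h rfl h x
        (C.one c)).symm
      change _ = _ + koszulSign k p • tmul X C.diagonal _ _ _ _ x (C.d 0 1 rfl (C.one c))
      rw [C.d_one, map_zero, smul_zero, add_zero]
      rfl)
    (by
      intro c c' p q n h x a
      refine Eq.trans ?_ (tensorRact_tmul X C.diagonal p 0 q p q n (add_zero p) (zero_add q) h x
        (C.one c) a).symm
      refine (tmul_balanced X C.diagonal p q 0 n q n h (add_zero q) h x a (C.one c')).trans ?_
      change tmul X C.diagonal _ _ _ _ x (C.comp q 0 q _ a (C.one c')) =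
        tmul X C.diagonal _ _ _ _ x (C.comp 0 q q _ (C.one c) a)
      rw [C.comp_one, C.one_comp])

theorem tensorDiagonalHom_tmul (b c : C.Obj) (p q n : ℤ) (e : p + q = n) (x : X.obj ⟨⟩ b p)
    (y : C.Hom c b q) :
    (tensorDiagonalHom X).app ⟨⟩ c n (tmul X C.diagonal p q n e x y) = X.ract p q n e x y := by
  rw [tensorDiagonalHom]
  exact tensorDesc_tmul (K := C.diagonal) (fun b c p q n e => X.ract p q n e) _ _ _ b c p q n e x y

theorem tensorDiagonalInv_hom : tensorDiagonalInv X ≫ tensorDiagonalHom X = 𝟙 X :=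
  hom_ext_app fun ⟨⟩ c n x => by
    rw [comp_app_apply]
    change (tensorDiagonalHom X).app ⟨⟩ c n (tmul X C.diagonal n 0 n (add_zero n) x (C.one c)) = x
    rw [tensorDiagonalHom_tmul]
    exact X.ract_one n x

end Diagonal

/-! ### From the generation of the diagonal to the generation of perfect modules. -/

section Generation

variable {k : Type u} [Field k] {B C : DGCategory k}

/-- A homotopy retract of a module lies in its idempotent closure. -/
theorem mem_finClosure_of_homotopy_retract {𝒢 : Set (DGModule C)} {X W : DGModule C}
    (a : X ⟶ W) (r : W ⟶ X) (h : (Q C).map (a ≫ r) = (Q C).map (𝟙 X)) (hW : W ∈ finClosure 𝒢) :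
    X ∈ finClosure 𝒢 := by
  -- The closure admits strict summands only. The family `V` consists of `X` and `cone a`, and `W`
  -- is shown to be quasi-isomorphic to its direct sum, of which `X` is a strict summand.
  let V : ULift.{u} Bool → DGModule C := fun i => cond i.down X (cone a)
  let π₁ : dsum V ⟶ X := dsumπ V ⟨true⟩
  let π₂ : dsum V ⟶ cone a := dsumπ V ⟨false⟩
  let φ : W ⟶ dsum V := r ≫ (show X ⟶ dsum V from dsumι V ⟨true⟩) +
    coneInr a ≫ (show cone a ⟶ dsum V from dsumι V ⟨false⟩)
  have h₁ : φ ≫ π₁ = r := by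
    have e : (show cone a ⟶ dsum V from dsumι V ⟨false⟩) ≫ π₁ = 0 :=
      dsumι_π_ne V (by simp)
    have e' : (show X ⟶ dsum V from dsumι V ⟨true⟩) ≫ π₁ = 𝟙 X := dsumι_π V ⟨true⟩
    rw [Preadditive.add_comp, Category.assoc, Category.assoc, e, e', Limits.comp_zero, add_zero,
      Category.comp_id]
  have h₂ : φ ≫ π₂ = coneInr a := by
    have e : (show X ⟶ dsum V from dsumι V ⟨true⟩) ≫ π₂ = 0 := dsumι_π_ne V (by simp)
    have e' : (show cone a ⟶ dsum V from dsumι V ⟨false⟩) ≫ π₂ = 𝟙 _ := dsumι_π V ⟨false⟩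
    rw [Preadditive.add_comp, Category.assoc, Category.assoc, e, e', Limits.comp_zero, zero_add,
      Category.comp_id]
  -- In cohomology `a` is injective with left inverse `r`, so the cohomology of `W` is that of `X`
  -- plus the cokernel of `a`, which is the cohomology of `cone a`.
  have hφ : IsQuasiIso φ := by
    rw [isQuasiIso_iff]
    intro b c n
    refine ⟨fun w hw hφw => ?_, fun y hy => ?_⟩
    · have hrw : r.app b c n w ∈ X.bdry b c n := by
        rw [← h₁]
        exact app_mem_bdry π₁ hφw
      have haw : (coneInr a).app b c n w ∈ (cone a).bdry b c n := by
        rw [← h₂]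
        exact app_mem_bdry π₂ hφw
      rw [mem_bdry_cone (n - 1) (by omega)] at haw
      obtain ⟨x, v, hx, hv⟩ := haw
      rw [coneInr_app, neg_zero] at hx
      rw [coneInr_app] at hv
      have hxc : x ∈ X.cyc b c n := (mem_cyc (n + 1) rfl).2 hx
      have hxb : x ∈ X.bdry b c n := by
        have e := sub_mem_bdry_of_Q_map_eq h hxc
        have e' : r.app b c n (a.app b c n x) ∈ X.bdry b c n := by
          have : a.app b c n x = w - W.d (n - 1) n (by omega) v := by
            rw [eq_sub_iff_add_eq]; exact hv
          rw [this, map_sub]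
          exact sub_mem hrw (app_mem_bdry r (d_mem_bdry _ _ _))
        have := sub_mem e' e
        rwa [comp_app_apply, id_app_apply, sub_sub_cancel] at this
      have hw' : w = a.app b c n x + W.d (n - 1) n (by omega) v := hv.symm
      rw [hw']
      exact add_mem (app_mem_bdry a hxb) (d_mem_bdry _ _ _)
    · have hy₁ : π₁.app b c n y ∈ X.cyc b c n := app_mem_cyc π₁ hy
      have hy₂ : π₂.app b c n y ∈ (cone a).cyc b c n := app_mem_cyc π₂ hy
      rw [mem_cyc_cone] at hy₂
      obtain ⟨hu, huv⟩ := hy₂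
      generalize hz : π₂.app b c n y = z at hu huv
      obtain ⟨u, v⟩ := z
      dsimp only at hu huv
      have hub : u ∈ X.bdry b c (n + 1) := by
        have e := sub_mem_bdry_of_Q_map_eq h hu
        have e' : r.app b c (n + 1) (a.app b c (n + 1) u) ∈ X.bdry b c (n + 1) := by
          rw [eq_neg_of_add_eq_zero_left huv, map_neg]
          exact neg_mem (app_mem_bdry r (d_mem_bdry _ _ _))
        have := sub_mem e' e
        rwa [comp_app_apply, id_app_apply, sub_sub_cancel] at this
      obtain ⟨t, rfl⟩ := (mem_bdry n rfl).1 hub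
      have hw₁ : v + a.app b c n t ∈ W.cyc b c n := by
        rw [mem_cyc (n + 1) rfl, map_add, ← a.app_d]
        exact (add_comm _ _).trans huv
      set w₁ := v + a.app b c n t with hw₁'
      have hx : π₁.app b c n y - r.app b c n w₁ ∈ X.cyc b c n :=
        sub_mem hy₁ (app_mem_cyc r hw₁)
      -- The cocycle `w₁` already has the right image in `cone a`. Adding `a x` corrects the image
      -- in `X` and changes the image in the cone only by the boundary of `(x, 0)`.
      set x := π₁.app b c n y - r.app b c n w₁ with hx'
      refine ⟨w₁ + a.app b c n x, add_mem hw₁ (app_mem_cyc a hx), dsum_mem_bdry ?_⟩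
      rintro ⟨i⟩
      cases i
      · change π₂.app b c n (y - φ.app b c n (w₁ + a.app b c n x)) ∈ (cone a).bdry b c n
        rw [map_sub, hz, ← comp_app_apply, h₂, coneInr_app, mem_bdry_cone (n - 1) (by omega)]
        refine ⟨-(t + x), 0, ?_, ?_⟩
        · change _ = -(X.d n (n + 1) rfl t - 0)
          rw [map_neg, map_add, (mem_cyc (n + 1) rfl).1 hx, add_zero, sub_zero]
        · change a.app b c n (-(t + x)) + W.d (n - 1) n _ 0 = v - (w₁ + a.app b c n x)
          rw [hw₁', map_zero, map_neg, map_add]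
          abel
      · change π₁.app b c n (y - φ.app b c n (w₁ + a.app b c n x)) ∈ X.bdry b c n
        rw [map_sub, ← comp_app_apply, h₁, map_add, ← sub_sub, ← hx']
        have e := sub_mem_bdry_of_Q_map_eq h hx
        rw [comp_app_apply, id_app_apply] at e
        rw [← neg_sub]
        exact neg_mem e
  have hV : dsum V ∈ finClosure 𝒢 := finClosure.qis φ hφ hW
  exact finClosure.summand V hV ⟨true⟩

/-- Compactness: a morphism from a perfect module to an object of `ads(G)`, with `G` perfect,
factors through an object of `⟨G⟩`. -/
theorem ads_subset_factorsThrough {G : DGModule C} (hG : G ∈ C.Perf) :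
    ads {G} ⊆ FactorsThrough (finClosure {G}) := by
  intro M hM
  change ads {G} M at hM
  induction hM with
  | of M h =>
    obtain rfl := Set.mem_singleton_iff.1 h
    -- The object in the middle of a factorisation has to be compact and h-projective, so `G` is
    -- replaced by a resolution, which stays in the closure.
    obtain ⟨W, s, hW, hs⟩ := exists_good hG
    intro X hX f
    obtain ⟨g, hg⟩ := hX.hProj.exists_lift hs f
    exact ⟨W, hW, .qis_symm s hs (.of _ rfl), g, _, hg⟩
  | qis f hf _ ih => exact .qis hf ih
  | qis_symm f hf _ ih => exact .qis_symm hf ih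
  | shift i M _ ih => exact .shift i (fun W hW => .shift i W hW) ih
  | dsum M _ ih => exact .dsum (fun ι _ W hW => .dsum W hW) ih
  | summand M _ i ih => exact .retract ih (dsumι M i) (dsumπ M i) (dsumι_π M i)

/-- Each closure operation passes through `X ⊗ -`, up to a retract or a quasi-isomorphism. No
closure of `𝒜` under summands or quasi-isomorphisms is needed, since `FactorsThrough 𝒜` is closed
under both for any `𝒜`. -/
theorem tensor_mem_factorsThrough_of_mem_finClosure {X : DGModule B} (hX : IsHFlat X)
    {𝒢 : Set (DGBimodule B C)} {𝒜 : Set (DGModule C)}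
    (hshift : ∀ (i : ℤ), ∀ W ∈ 𝒜, W.shift i ∈ 𝒜)
    (hdsum : ∀ (ι : Type u) [Finite ι] (W : ι → DGModule C), (∀ i, W i ∈ 𝒜) → dsum W ∈ 𝒜)
    (h : ∀ M ∈ 𝒢, tensor X M ∈ FactorsThrough 𝒜) {M : DGBimodule B C}
    (hM : M ∈ finClosure 𝒢) : tensor X M ∈ FactorsThrough 𝒜 := by
  change finClosure 𝒢 M at hM
  induction hM with
  | of M hM => exact h M hM
  | qis f hf _ ih => exact .qis (hX.isQuasiIso_tensorMap hf) ih
  | qis_symm f hf _ ih => exact .qis_symm (hX.isQuasiIso_tensorMap hf) ih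
  | shift i M _ ih => exact .retract (.shift i (hshift i) ih) _ _ (tensorShiftHom_inv X M i)
  | dsum M _ ih => exact .retract (.dsum hdsum ih) _ _ (tensorDsumHom_desc X M)
  | summand M _ i ih =>
    refine .retract ih (tensorMap X (dsumι M i)) (tensorMap X (dsumπ M i)) ?_
    rw [← tensorMap_comp, dsumι_π, tensorMap_id]

/-- Convolution with `X` maps `⟨K⟩ₙ` to modules through which morphisms from perfect modules
factor over `⟨G⟩ₙ`, if this holds for `K` and `⟨G⟩`. -/
theorem tensor_mem_factorsThrough_gen {X : DGModule B} (hX : IsHFlat X) {K : DGBimodule B C}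
    {G : DGModule C} (hK : tensor X K ∈ FactorsThrough (finClosure {G})) (n : ℕ)
    {M : DGBimodule B C} (hM : M ∈ gen {K} n) : tensor X M ∈ FactorsThrough (gen {G} n) := by
  induction n generalizing M with
  | zero => exact .of_isAcyclic (fun _ h => h) (hX.isAcyclic_tensor hM)
  | succ n ih =>
    refine tensor_mem_factorsThrough_of_mem_finClosure hX (fun i W hW => .shift i W hW)
      (fun ι _ W hW => .dsum W hW) ?_ hM
    rintro _ ⟨M₁, h₁, M₂, h₂, f, rfl⟩
    have h₂' : tensor X M₂ ∈ FactorsThrough (finClosure {G}) :=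
      tensor_mem_factorsThrough_of_mem_finClosure hX (fun i W hW => .shift i W hW)
        (fun ι _ W hW => .dsum W hW) (fun M hM => by rwa [Set.mem_singleton_iff.1 hM]) h₂
    exact .retract (.mono (fun W hW => .of W hW) (.star (ih h₁) h₂' (tensorMap X f))) _ _
      (tensorConeIso X f).hom_inv_id

/-- The retraction of `P ⊗ Δ` onto `P` puts `P` into `FactorsThrough (gen {G} (n + 1))`. Factoring
the resolution `Y ⟶ F`, lifted to `P`, through some `W` makes `Y` a homotopy retract of `W`. -/
theorem mem_gen_of_diagonal_mem_gen {K : DGBimodule C C} {F G X : DGModule C} (hF : F ∈ C.Perf)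
    (hG : G ∈ C.Perf) (hX : IsConvolution K F X) (hXG : X ∈ ads {G}) {n : ℕ}
    (hΔ : C.diagonal ∈ gen {K} (n + 1)) : F ∈ gen {G} (n + 1) := by
  obtain ⟨P, s, hs, hP, rfl⟩ := hX
  obtain ⟨Y, t, hY, ht⟩ := exists_good hF
  have hPn : P ∈ FactorsThrough (gen {G} (n + 1)) :=
    .retract (tensor_mem_factorsThrough_gen hP (ads_subset_factorsThrough hG hXG) (n + 1) hΔ) _ _
      (tensorDiagonalInv_hom P)
  -- The given `P` is only h-flat, so the two resolutions are compared by a morphism from `Y` to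
  -- `P`. The way back exists only from h-projective modules such as `W`, which is lifted to `Y`
  -- over `F`.
  obtain ⟨l, hl⟩ := hY.hProj.exists_lift hs ((Q C).map t)
  obtain ⟨W, hW, hWG, a, b, hab⟩ := hPn Y hY l
  obtain ⟨r, hr⟩ := hW.hProj.exists_lift ht (b ≫ (Q C).map s)
  have har : a ≫ r = 𝟙 _ := hY.hProj.eq_of_comp_eq ht (by
    rw [Category.assoc, hr, ← Category.assoc, hab, hl, Category.id_comp])
  obtain ⟨a, rfl⟩ := (Q C).map_surjective a
  obtain ⟨r, rfl⟩ := (Q C).map_surjective r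
  exact finClosure.qis t ht (mem_finClosure_of_homotopy_retract a r
    (by rw [Functor.map_comp, har, (Q C).map_id]) hWG)

/-- A finite infimum of natural numbers is attained. Finding the index `t` itself avoids any appeal
to monotonicity of `gen` in the number of layers. -/
theorem subset_gen_of_genTime_eq {𝒢 ℰ : Set (DGBimodule B C)} {t : ℕ} (h : genTime 𝒢 ℰ = t) :
    ℰ ⊆ gen 𝒢 (t + 1) := by
  have hlt : genTime 𝒢 ℰ < (t + 1 : ℕ) := by
    rw [h]
    exact_mod_cast Nat.lt_succ_self t
  obtain ⟨n, hn⟩ := iInf_lt_iff.1 hlt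
  obtain ⟨hE, hn⟩ := iInf_lt_iff.1 hn
  have hle : genTime 𝒢 ℰ ≤ n := iInf₂_le n hE
  rw [h] at hle
  obtain rfl : n = t := le_antisymm (Nat.lt_succ_iff.1 (by exact_mod_cast hn)) (by exact_mod_cast hle)
  exact hE

end Generation

end DGBimodule

theorem mainTheorem1 {k : Type u} [Field k] (C : DGCategory k) (G₁₂ : DGBimodule C C) (t : ℕ)
    (hΔ : DGBimodule.genTime {G₁₂} {C.diagonal} = t) :
    (∀ (ℰ : Set (DGModule C)) (G₂ : DGModule C), ℰ ⊆ C.Perf →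
      DGCategory.IsWeaklyProductOn ℰ G₁₂ G₂ → DGBimodule.genTime {G₂} ℰ ≤ t) ∧
    (DGCategory.IsWeaklyProduct G₁₂ → C.Rdim ≤ t) := by
  have key : ∀ (ℰ : Set (DGModule C)) (G₂ : DGModule C), ℰ ⊆ C.Perf →
      DGCategory.IsWeaklyProductOn ℰ G₁₂ G₂ → DGBimodule.genTime {G₂} ℰ ≤ t := by
    rintro ℰ G₂ hℰ ⟨hG₂, h⟩
    refine iInf₂_le t fun F hF => ?_
    obtain ⟨X, hX, hXG⟩ := h F hF
    exact DGBimodule.mem_gen_of_diagonal_mem_gen (hℰ hF) hG₂ hX hXG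
      (DGBimodule.subset_gen_of_genTime_eq hΔ rfl)
  exact ⟨key, fun ⟨G₂, hG⟩ => (iInf₂_le G₂ hG.1).trans (key _ G₂ subset_rfl hG)⟩
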